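/- **Network.** Let $\mathbb F$ be a finite field. A layered linear deterministic (ADT) relay network $G$ over $\mathbb F$ consists of a finite set of nodes, divided into layers $1,\dots,L$ ($L\ge 2$), where layer $1$ consists of the source $S$ alone and layer $L$ of the destination $D$ alone; a finite set $\mathcal V_x$ of inputs and a finite set of outputs, each belonging to a node ($\mathcal A(x)$, $\mathcal A(y)$); and coefficients $T(x,y)\in\mathbb F$ for inputs $x$ and outputs $y$, such that $T(x,y)\neq 0$ only if $\mathcal A(y)$ lies in the layer following that of $\mathcal A(x)$. The edges are the pairs $(x,y)$ with $T(x,y)\ne0$; an edge is in layer cut $l$ if $\mathcal A(x)$ is in layer $l$. Let $d$ be the maximum number of edges leaving one input. The adjacency matrix $T(E)$ of a set $E$ of edges is the submatrix of $T$ whose rows are the inputs and whose columns are the outputs occurring in $E$. The unicast capacity of $G$ is $$C=\min_{\Omega}\ \operatorname{rank} T(E_\Omega),$$ where $\Omega$ runs over the sets of nodes with $S\in\Omega$, $D\notin\Omega$, and $E_\Omega$ is the set of edges from $\Omega$ to its complement. An $S$–$D$ path is a sequence of edges $(x_1,y_1),\dots,(x_m,y_m)$, $m\ge1$, with $\mathcal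 A(x_1)=S$, $\mathcal A(y_i)=\mathcal A(x_{i+1})$ and $\mathcal A(y_m)=D$. A family of $k$ $S$–$D$ paths is linearly independent if for every layer cut $l=1,\dots,L-1$ the set $E_l$ of the edges of the paths in this layer cut has $k$ elements and $\operatorname{rank}T(E_l)=k$. **Algorithm.** $U^l$ denotes the set of edges currently used by the paths in layer cut $l$, and $U^l_x$, $U^l_y$ the sets of their inputs and outputs; initially all $U^l$ are empty. In each iteration all nodes, inputs and outputs are labelled unexplored, all inputs get type $1$, and $E(S)$ is called; the algorithm stops after the first iteration in which this call fails, and returns the paths formed by the used edges. The recursive function $E(A)$, for a node $A$ in layer $l$, labels $A$ explored and tries the following in turn; it succeeds as soon as $D$ is reached, and $U$ is restored after every failed attempt. 1. For every unused unexplored input $x$ of $A$ of type $2$: label $x$ explored and try forward moves from $x$: for every edge $(x,y)$ with $y\notin U^l_y$ and $\mathcal A(y)$ unexplored such that $T(x,y)\ne\sum_{u\in\Lambda_x}a_uT(u,y)$, add $(x,y)$ to $U^l$; succeed if $\mathcal A(y)=D$, otherwise call $E(\mathcal A(y))$. Here $\Lambda_x\subseteq U^l_x$ and the nonzero coefficients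 $a_u$ are those with $T(x,v)=\sum_{u\in\Lambda_x}a_uT(u,v)$ for all $v\in U^l_y$. 2. For every unused unexplored input $x$ of $A$ of type $1$: label $x$ explored, compute $\Lambda_x$ and its coefficients by Gaussian elimination, and try forward moves from $x$ as in 1. Then find alternating paths (of unused and used edges) from $x$ to all $x'\in\Lambda_x$ by graph traversal, and for every $x'\in\Lambda_x$ do a same-layer rewiring: label $x'$ unexplored, give it type $2$, obtain $\Lambda_{x'}=\Lambda_x+x-x'$ and its coefficients from those of $\Lambda_x$, exchange unused and used edges along the alternating path (so that $x$ replaces $x'$ in $U^l_x$), and call $E(\mathcal A(x'))$. 3. For every unexplored output $y\in U^{l-1}_y$ of $A$ that was used at the beginning of the iteration do a backward rewiring: label $y$ explored, find one $x\in U^{l-1}_x$ such that the matrix of the coefficients $T$ between $U_x^{l-1}-x$ and $U_y^{l-1}-y$ is regular (by Gaussian elimination), rematch these inputs and outputs along an alternating path from $y$ to $x$, label $x$ unexplored, give it type $1$, and call $E(\mathcal A(x))$. Running time is the number of steps on a unit-cost random access machine (one step for an arithmetic operation in $\mathbb F$, a look-up or a comparison, and so on), where $G$ is given by a list of the inputs,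 for every input a list of the outputs it is connected to, and random access to $T$, $\mathcal A$ and the layer numbers. For each node and type, the inputs of the node that have become unexplored with this type and have not been inspected since are kept in a list. **Theorem.** There is an absolute constant $K$ such that for every finite field $\mathbb F$, every layered linear deterministic relay network $G$ over $\mathbb F$ and all orders of its lists, the algorithm terminates and returns linearly independent $S$–$D$ paths whose number is the unicast capacity $C$ of $G$; this is the maximum number of linearly independent $S$–$D$ paths in $G$. If $C\ge1$, its running time is at most $$K\,\bigl(|\mathcal V_x|\,C^4+d\,|\mathcal V_x|\,C^3\bigr).$$ -/

import Mathlib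

/-! ### Layered linear deterministic relay networks -/

/-- A layered linear deterministic (ADT) relay network over the field `F`, with set of nodes `V`,
set of inputs `X` (transmit levels) and set of outputs `Y` (receive levels).  The entry `T x y` is
the channel coefficient from `x` to `y`, and the edges are the pairs `(x, y)` with `T x y ≠ 0`. -/
structure ADTNetwork (F V X Y : Type) [Field F] where
  /-- the node that an input belongs to -/
  nodeX : X → V
  /-- the node that an output belongs to -/
  nodeY : Y → V
  T : Matrix X Y F
  /-- the number of layers -/
  L : ℕ
  two_le_L : 2 ≤ L
  layer : V → ℕ
  S : V
  D : V
  one_le_layer : ∀ v, 1 ≤ layer v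
  layer_le : ∀ v, layer v ≤ L
  layer_eq_one : ∀ v, layer v = 1 ↔ v = S
  layer_eq_L : ∀ v, layer v = L ↔ v = D
  layer_edge : ∀ x y, T x y ≠ 0 → layer (nodeY y) = layer (nodeX x) + 1

namespace ADTNetwork

section Network

variable {F V X Y : Type} [Field F] [DecidableEq F] [DecidableEq V] [Fintype X] [DecidableEq X]
  [Fintype Y] [DecidableEq Y] (G : ADTNetwork F V X Y)

/-- The maximum number `d` of edges leaving one input. -/
def maxOutDegree : ℕ :=
  Finset.univ.sup fun x => (Finset.univ.filter fun y => G.T x y ≠ 0).card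

/-- The adjacency matrix of a set of edges: its rows are the inputs and its columns the outputs
that occur in the set. -/
def adjacency (E : Finset (X × Y)) :
    Matrix {x // x ∈ E.image Prod.fst} {y // y ∈ E.image Prod.snd} F :=
  G.T.submatrix Subtype.val Subtype.val

/-- The edges that cross the cut `(Ω, Ωᶜ)`. -/
def cutEdges (Ω : Finset V) : Finset (X × Y) :=
  Finset.univ.filter fun e => G.T e.1 e.2 ≠ 0 ∧ G.nodeX e.1 ∈ Ω ∧ G.nodeY e.2 ∉ Ω

/-- The value of a cut: the rank of the adjacency matrix of the edges that cross it. -/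
noncomputable def cutValue (Ω : Finset V) : ℕ := (G.adjacency (G.cutEdges Ω)).rank

/-- The unicast capacity: the minimum value of a cut that separates `S` from `D`. -/
noncomputable def capacity : ℕ :=
  sInf {r | ∃ Ω : Finset V, G.S ∈ Ω ∧ G.D ∉ Ω ∧ r = G.cutValue Ω}

/-- `p` is (the list of edges of) a path from `S` to `D`. -/
def IsPath (p : List (X × Y)) : Prop :=
  (∀ e ∈ p, G.T e.1 e.2 ≠ 0) ∧
  p.IsChain (fun e e' => G.nodeY e.2 = G.nodeX e'.1) ∧
  (p.head?.map fun e => G.nodeX e.1) = some G.S ∧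
  (p.getLast?.map fun e => G.nodeY e.2) = some G.D

/-- The set of edges that the paths in `P` use in the layer cut `l`. -/
def layerEdges (P : List (List (X × Y))) (l : ℕ) : Finset (X × Y) :=
  P.flatten.toFinset.filter fun e => G.layer (G.nodeX e.1) = l

/-- Linear independence of paths: in every layer cut, the edges of the `k` paths are `k`
linearly independent edges. -/
def LinIndepPaths (P : List (List (X × Y))) : Prop :=
  ∀ l, 1 ≤ l → l < G.L →
    (G.layerEdges P l).card = P.length ∧ (G.adjacency (G.layerEdges P l)).rank = P.length

end Network

/-- A list representation of a network, in an arbitrary order: the list of all inputs and, for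
every input, the list of the outputs it is connected to. -/
structure Listing {F V X Y : Type} [Field F] (G : ADTNetwork F V X Y) where
  inputs : List X
  nodup_inputs : inputs.Nodup
  mem_inputs : ∀ x, x ∈ inputs
  succ : X → List Y
  nodup_succ : ∀ x, (succ x).Nodup
  mem_succ : ∀ x y, y ∈ succ x ↔ G.T x y ≠ 0

end ADTNetwork

/-! ### Counting steps

Unit-cost random access model.  One step pays for a bounded number of elementary operations: an
arithmetic operation or a zero test in `F`, a comparison of identifiers, a look-up in the network
data, reading or writing one array cell, and forming or taking apart one cell of a linked list.
Lists are immutable linked lists, so that copying a reference to a list is elementary. -/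

/-- A value together with the number of steps used to compute it. -/
structure Timed (α : Type) where
  val : α
  time : ℕ

namespace Timed

instance : Monad Timed where
  pure a := ⟨a, 0⟩
  bind m f := ⟨(f m.val).val, m.time + (f m.val).time⟩

/-- One step. -/
def step : Timed PUnit := ⟨PUnit.unit, 1⟩

section Lists

variable {α β F : Type}

/-- Search for the first element with an elementary property `p`. -/
def find (p : α → Bool) : List α → Timed (Option α)
  | [] => do step; pure none
  | a :: l => do
    step
    if p a then pure (some a) else find p l

/-- Does some element have the elementary property `p`? -/
def any (p : α → Bool) : List α → Timed Bool
  | [] => do step; pure false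
  | a :: l => do
    step
    if p a then pure true else any p l

/-- The elements with the elementary property `p`. -/
def filter (p : α → Bool) : List α → Timed (List α)
  | [] => do step; pure []
  | a :: l => do
    step
    let r ← filter p l
    pure (if p a then a :: r else r)

def map (f : α → Timed β) : List α → Timed (List β)
  | [] => do step; pure []
  | a :: l => do
    step
    let b ← f a
    let r ← map f l
    pure (b :: r)

def length : List α → Timed ℕ
  | [] => do step; pure 0
  | _ :: l => do
    step
    let n ← length l
    pure (n + 1)

def append : List α → List α → Timed (List α)
  | [], m => do step; pure m
  | a :: l, m => do
    step
    let r ← append l m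
    pure (a :: r)

/-- Remove the first occurrence of `a`. -/
def erase [DecidableEq α] (a : α) : List α → Timed (List α)
  | [] => do step; pure []
  | b :: l => do
    step
    if b = a then pure l
    else do
      let r ← erase a l
      pure (b :: r)

/-- Take the first element with the elementary property `p` out of a list. -/
def extract (p : α → Bool) : List α → Timed (Option (α × List α))
  | [] => do step; pure none
  | a :: l => do
    step
    if p a then pure (some (a, l))
    else do
      match ← extract p l with
      | none => pure none
      | some (b, r) => pure (some (b, a :: r))

/-! Gaussian elimination.  An equation is a pair of the list of its coefficients and its
right-hand side. -/

variable [Field F] [DecidableEq F]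

/-- The row `u - c v`. -/
def subRow (c : F) : List F → List F → Timed (List F)
  | a :: u, b :: v => do
    step
    let r ← subRow c u v
    pure ((a - c * b) :: r)
  | _, _ => do step; pure []

/-- The sum of the products of the given coefficients with the given values of unknowns. -/
def dot : List F → List (α × F) → Timed F
  | a :: u, z :: w => do
    step
    let r ← dot u w
    pure (a * z.2 + r)
  | _, _ => do step; pure 0

/-- Does the first unknown occur in the equation? -/
def isPivot (r : List F × F) : Bool :=
  match r.1 with
  | [] => false
  | c :: _ => decide (c ≠ 0)

/-- Use the equation `(a :: v, b)`, where `a ≠ 0`, to remove the first unknown. -/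
def eliminate (a : F) (v : List F) (b : F) (r : List F × F) : Timed (List F × F) :=
  match r.1 with
  | [] => do step; pure r
  | c :: u => do
    step
    let w ← subRow (c / a) u v
    pure (w, r.2 - c / a * b)

/-- The solution of a square linear system with a regular matrix, for the given list of unknowns:
elimination of the first unknown, recursion, back substitution. -/
def solve : List α → List (List F × F) → Timed (List (α × F))
  | [], _ => do step; pure []
  | x :: xs, rows => do
    step
    match ← extract isPivot rows with
    | none => pure []
    | some (r, rest) =>
      match r.1 with
      | [] => pure []
      | a :: v => do
        let rest' ← map (eliminate a v r.2) rest
        let z ← solve xs rest'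
        let s ← dot v z
        pure ((x, (r.2 - s) / a) :: z)

end Lists

end Timed

/-! ### The improved unicast algorithm -/

/-- The memory of the algorithm. -/
structure UnicastMemory (F V X Y : Type) where
  /-- `used l` is the list of the edges that the current (partial) paths use in layer cut `l` -/
  used : ℕ → List (X × Y)
  /-- the labels explored / unexplored of nodes, inputs and outputs -/
  exploredV : V → Bool
  exploredX : X → Bool
  exploredY : Y → Bool
  /-- the types, 1 or 2, of the inputs -/
  type : X → ℕ
  /-- was the output used by a path at the beginning of the iteration? -/
  initial : Y → Bool
  /-- for each type and each node, the inputs of the node that became unexplored with this type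
  and have not been looked at since -/
  pending : ℕ → V → List X
  /-- the set `Λ x` with its coefficients, for inputs `x` of type 2 -/
  lam : X → List (X × F)
  /-- the number of steps so far -/
  clock : ℕ

/-- Imperative programs: partial functions on the memory, undefined when they do not terminate. -/
abbrev UnicastProg (F V X Y : Type) (α : Type) := StateT (UnicastMemory F V X Y) Option α

namespace UnicastProg

variable {F V X Y α : Type}

/-- One step. -/
def step : UnicastProg F V X Y PUnit := modify fun m => { m with clock := m.clock + 1 }

/-- Read (from one array cell). -/
def look (f : UnicastMemory F V X Y → α) : UnicastProg F V X Y α := do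
  step
  let m ← get
  pure (f m)

/-- Write (to one array cell). -/
def write (f : UnicastMemory F V X Y → UnicastMemory F V X Y) : UnicastProg F V X Y PUnit := do
  step
  modify f

/-- Run a subroutine and account for its steps. -/
def call (c : Timed α) : UnicastProg F V X Y α := do
  modify fun m => { m with clock := m.clock + c.time }
  pure c.val

section Cells

variable [DecidableEq V] [DecidableEq X] [DecidableEq Y]

def setUsed (l : ℕ) (U : List (X × Y)) : UnicastProg F V X Y PUnit :=
  write fun m => { m with used := Function.update m.used l U }

def setExploredV (A : V) (b : Bool) : UnicastProg F V X Y PUnit :=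
  write fun m => { m with exploredV := Function.update m.exploredV A b }

def setExploredX (x : X) (b : Bool) : UnicastProg F V X Y PUnit :=
  write fun m => { m with exploredX := Function.update m.exploredX x b }

def setExploredY (y : Y) (b : Bool) : UnicastProg F V X Y PUnit :=
  write fun m => { m with exploredY := Function.update m.exploredY y b }

def setType (x : X) (t : ℕ) : UnicastProg F V X Y PUnit :=
  write fun m => { m with type := Function.update m.type x t }

def setInitial (y : Y) (b : Bool) : UnicastProg F V X Y PUnit :=
  write fun m => { m with initial := Function.update m.initial y b }

def setLam (x : X) (Λ : List (X × F)) : UnicastProg F V X Y PUnit :=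
  write fun m => { m with lam := Function.update m.lam x Λ }

def setPending (t : ℕ) (A : V) (xs : List X) : UnicastProg F V X Y PUnit :=
  write fun m =>
    { m with pending := Function.update m.pending t (Function.update (m.pending t) A xs) }

def pushPending (t : ℕ) (A : V) (x : X) : UnicastProg F V X Y PUnit := do
  let xs ← look fun m => m.pending t A
  setPending t A (x :: xs)

/-- Take one input out of a list of pending inputs. -/
def popPending (t : ℕ) (A : V) : UnicastProg F V X Y (Option X) := do
  let xs ← look fun m => m.pending t A
  match xs with
  | [] => pure none
  | x :: xs' => do
    setPending t A xs'
    pure (some x)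

end Cells

end UnicastProg

namespace ADTNetwork

section Algorithm

variable {F V X Y : Type} [Field F] [DecidableEq F] [DecidableEq V] [DecidableEq X] [DecidableEq Y]
  (G : ADTNetwork F V X Y)

/-- Coefficients `a`, with the zero ones left out, such that `∑ a u * T u v = b v` for all used
outputs `v`, where `u` runs through the used inputs.  The edges in `U` are the used edges. -/
def combine (U : List (X × Y)) (b : Y → F) : Timed (List (X × F)) := do
  let names ← Timed.map (fun e => pure e.1) U
  let rows ← Timed.map (fun e => do
    let r ← Timed.map (fun e' => pure (G.T e'.1 e.2)) U
    pure (r, b e.2)) U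
  let z ← Timed.solve names rows
  Timed.filter (fun t => decide (t.2 ≠ 0)) z

/-- The sum of `a u * T u y` over the pairs `(u, a u)` in the list. -/
def combination (y : Y) : List (X × F) → Timed F
  | [] => do Timed.step; pure 0
  | (u, a) :: Λ => do
    Timed.step
    let r ← combination y Λ
    pure (a * G.T u y + r)

/-- From the representation of the row of `x` by the rows in `Λ x`, the representation of the row
of `x'` by the rows in `Λ x + x - x'`, where `a` is the coefficient of `x'` in the former one. -/
def exchange (x x' : X) (a : F) (Λ : List (X × F)) : Timed (List (X × F)) := do
  let Λ' ← Timed.filter (fun t => decide (t.1 ≠ x')) Λ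
  let r ← Timed.map (fun t => pure (t.1, -(t.2 / a))) Λ'
  pure ((x, 1 / a) :: r)

/-- An input reached by an alternating path, together with that path: a list (with the last part
first) of pairs, each an edge `(x, y)` to be used next and a used edge `(x', y)` to be given up. -/
abbrev Reached (X Y : Type) := X × List ((X × Y) × (X × Y))

/-- Prolong an alternating path that has reached `x` in all ways by used edges from the list.
Returns the results and the remaining used edges. -/
def prolong (x : X) (π : List ((X × Y) × (X × Y))) :
    List (X × Y) → Timed (List (Reached X Y) × List (X × Y))
  | [] => do Timed.step; pure ([], [])
  | e :: U => do
    Timed.step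
    let (found, rest) ← prolong x π U
    if G.T x e.2 ≠ 0 then pure ((e.1, ((x, e.2), e) :: π) :: found, rest)
    else pure (found, e :: rest)

/-- Graph traversal along alternating paths.  The arguments are a bound for the number of rounds,
the inputs that are reached but not processed, and the used edges that are not reached. -/
def traverse : ℕ → List (Reached X Y) → List (X × Y) → Timed (List (Reached X Y))
  | _, [], _ => do Timed.step; pure []
  | 0, _ :: _, _ => do Timed.step; pure []
  | n + 1, q :: queue, U => do
    Timed.step
    let (found, rest) ← G.prolong q.1 q.2 U
    let queue' ← Timed.append found queue
    let r ← traverse n queue' rest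
    pure (q :: r)

/-- Alternating paths, relative to the used edges in `U`, from `x` to every input that can be
reached in this way. -/
def alternatingPaths (x : X) (U : List (X × Y)) : Timed (List (Reached X Y)) := do
  let n ← Timed.length U
  G.traverse (n + 1) [(x, [])] U

/-- Exchange unused and used edges along an alternating path. -/
def rematch : List ((X × Y) × (X × Y)) → List (X × Y) → Timed (List (X × Y))
  | [], U => do Timed.step; pure U
  | (e, e') :: π, U => do
    Timed.step
    let U' ← Timed.erase e' U
    rematch π (e :: U')

/-- Given the used edges `U` of a layer cut and a used output `y`: an input `x` such that the
adjacency matrix remains regular when `x` and `y` are removed, and a rematching of the remaining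
used inputs and outputs along an alternating path from `y` to `x`. -/
def release (y : Y) (U : List (X × Y)) : Timed (Option (X × List (X × Y))) := do
  let z ← G.combine U (fun v => if v = y then 1 else 0)
  match z with
  | [] => pure none
  | (x, _) :: _ => do
    match ← Timed.extract (fun e => decide (e.2 = y)) U with
    | none => pure none
    | some (e, U') => do
      let paths ← G.alternatingPaths e.1 U'
      match ← Timed.find (fun r => decide (r.1 = x)) paths with
      | none => pure none
      | some r => do
        let U'' ← rematch r.2 U'
        pure (some (x, U''))

open UnicastProg

variable {G}

/-- Is `x` unused, unexplored and of type `t`? -/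
def isOpen (G : ADTNetwork F V X Y) (x : X) (t : ℕ) : UnicastProg F V X Y Bool := do
  let U ← look fun m => m.used (G.layer (G.nodeX x))
  let u ← call (Timed.any (fun e => decide (e.1 = x)) U)
  let b ← look fun m => m.exploredX x
  let t' ← look fun m => m.type x
  pure (!u && !b && decide (t' = t))

mutual

/-- The function `E_A`: try to complete the new path from node `A`. -/
def exploreNode (I : G.Listing) (A : V) : UnicastProg F V X Y Bool := do
  setExploredV A true
  let r₂ ← exploreType₂ I A
  if r₂ then pure true
  else do
    let r₁ ← exploreType₁ I A
    if r₁ then pure true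
    else do
      let U ← look fun m => m.used (G.layer A - 1)
      let U' ← call (Timed.filter (fun e => decide (G.nodeY e.2 = A)) U)
      backward I A U'
  partial_fixpoint

/-- Explore the open inputs of type 2 of node `A`. -/
def exploreType₂ (I : G.Listing) (A : V) : UnicastProg F V X Y Bool := do
  match ← popPending 2 A with
  | none => pure false
  | some x => do
    let o ← isOpen G x 2
    if o then do
      setExploredX x true
      let Λ ← look fun m => m.lam x
      let r ← forward I x Λ (I.succ x)
      if r then pure true else exploreType₂ I A
    else exploreType₂ I A
  partial_fixpoint

/-- Explore the open inputs of type 1 of node `A`. -/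
def exploreType₁ (I : G.Listing) (A : V) : UnicastProg F V X Y Bool := do
  match ← popPending 1 A with
  | none => pure false
  | some x => do
    let o ← isOpen G x 1
    if o then do
      setExploredX x true
      let U ← look fun m => m.used (G.layer A)
      let Λ ← call (G.combine U (G.T x))
      let r ← forward I x Λ (I.succ x)
      if r then pure true
      else do
        let paths ← call (G.alternatingPaths x U)
        let r' ← sameLayer I x Λ paths Λ
        if r' then pure true else exploreType₁ I A
    else exploreType₁ I A
  partial_fixpoint

/-- Forward moves from `x` to the outputs in the list. -/
def forward (I : G.Listing) (x : X) (Λ : List (X × F)) (ys : List Y) : UnicastProg F V X Y Bool := do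
  step
  match ys with
  | [] => pure false
  | y :: ys' => do
    let U ← look fun m => m.used (G.layer (G.nodeX x))
    let u ← call (Timed.any (fun e => decide (e.2 = y)) U)
    let b ← look fun m => m.exploredV (G.nodeY y)
    if u || b then forward I x Λ ys'
    else do
      let c ← call (G.combination y Λ)
      if G.T x y ≠ c then do
        setUsed (G.layer (G.nodeX x)) ((x, y) :: U)
        if G.nodeY y = G.D then pure true
        else do
          let r ← exploreNode I (G.nodeY y)
          if r then pure true
          else do
            setUsed (G.layer (G.nodeX x)) U
            forward I x Λ ys'
      else forward I x Λ ys'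
  partial_fixpoint

/-- Same-layer rewirings from the input `x` of type 1 to the inputs in the list `Λ'`. -/
def sameLayer (I : G.Listing) (x : X) (Λ : List (X × F)) (paths : List (Reached X Y))
    (Λ' : List (X × F)) : UnicastProg F V X Y Bool := do
  step
  match Λ' with
  | [] => pure false
  | (x', a) :: Λ'' => do
    match ← call (Timed.find (fun r => decide (r.1 = x')) paths) with
    | none => sameLayer I x Λ paths Λ''
    | some r => do
      setExploredX x' false
      setType x' 2
      pushPending 2 (G.nodeX x') x'
      let Λx' ← call (exchange x x' a Λ)
      setLam x' Λx'
      let U ← look fun m => m.used (G.layer (G.nodeX x))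
      let U' ← call (rematch r.2 U)
      setUsed (G.layer (G.nodeX x)) U'
      let b ← exploreNode I (G.nodeX x')
      if b then pure true
      else do
        setUsed (G.layer (G.nodeX x)) U
        sameLayer I x Λ paths Λ''
  partial_fixpoint

/-- Backward rewirings at node `A` from the used outputs of the edges in the list. -/
def backward (I : G.Listing) (A : V) (es : List (X × Y)) : UnicastProg F V X Y Bool := do
  step
  match es with
  | [] => pure false
  | (_, y) :: es' => do
    let U ← look fun m => m.used (G.layer A - 1)
    let u ← call (Timed.any (fun e => decide (e.2 = y)) U)
    let b ← look fun m => m.exploredY y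
    let i ← look fun m => m.initial y
    if u && !b && i then do
      setExploredY y true
      match ← call (G.release y U) with
      | none => backward I A es'
      | some (x, U') => do
        setExploredX x false
        setType x 1
        pushPending 1 (G.nodeX x) x
        setUsed (G.layer A - 1) U'
        let r ← exploreNode I (G.nodeX x)
        if r then pure true
        else do
          setUsed (G.layer A - 1) U
          backward I A es'
    else backward I A es'
  partial_fixpoint

end

/-- Initialize the labels, the types and the lists at the beginning of an iteration. -/
def reset (I : G.Listing) : UnicastProg F V X Y PUnit := do
  I.inputs.forM fun x => do
    setExploredV (G.nodeX x) false
    setExploredX x false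
    setType x 1
    setPending 1 (G.nodeX x) []
    setPending 2 (G.nodeX x) []
    (I.succ x).forM fun y => do
      setExploredV (G.nodeY y) false
      setExploredY y false
      let U ← look fun m => m.used (G.layer (G.nodeX x))
      let u ← call (Timed.any (fun e => decide (e.2 = y)) U)
      setInitial y u
  I.inputs.forM fun x => pushPending 1 (G.nodeX x) x

/-- Repeat iterations, each of which finds one more path, until one fails. -/
def iterate (I : G.Listing) : UnicastProg F V X Y PUnit := do
  reset I
  let r ← exploreNode I G.S
  if r then iterate I else pure PUnit.unit
  partial_fixpoint

variable (G)

/-- Prolong partial paths that end in `D` backward, each by one of the edges in the list. -/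
def prependEdges : List (List (X × Y)) → List (X × Y) → Timed (List (List (X × Y)))
  | p :: P, U => do
    Timed.step
    match p with
    | [] => pure []
    | e :: _ => do
      match ← Timed.extract (fun e' => decide (G.nodeY e'.2 = G.nodeX e.1)) U with
      | none => pure []
      | some (e', U') => do
        let P' ← prependEdges P U'
        pure ((e' :: p) :: P')
  | [], _ => do Timed.step; pure []

/-- Put the edges in the layer cuts `l, l - 1, …, 1` in front of the partial paths in `P`. -/
def assemble (used : ℕ → List (X × Y)) : ℕ → List (List (X × Y)) → Timed (List (List (X × Y)))
  | 0, P => do Timed.step; pure P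
  | l + 1, P => do
    Timed.step
    let P' ← G.prependEdges P (used (l + 1))
    assemble used l P'

variable {G}

/-- The complete program: find paths as long as possible, then write them down. -/
def unicastProg (I : G.Listing) : UnicastProg F V X Y (List (List (X × Y))) := do
  iterate I
  let used ← look fun m => m.used
  let P ← call (Timed.map (fun e => pure [e]) (used (G.L - 1)))
  call (G.assemble used (G.L - 2) P)

/-- The improved unicast algorithm: the list of paths it returns and the number of steps it takes,
or `none` if it does not terminate. -/
def unicast (I : G.Listing) : Option (List (List (X × Y)) × ℕ) := do
  let (P, m) ← (unicastProg I).run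
    { used := fun _ => [], exploredV := fun _ => false, exploredX := fun _ => false,
      exploredY := fun _ => false, type := fun _ => 1, initial := fun _ => false,
      pending := fun _ _ => [], lam := fun _ => [], clock := 0 }
  pure (P, m.clock)

end Algorithm

end ADTNetwork

/-!
The used edges at the end of an iteration form a *flow* of some value `k`: in every layer cut they
are a matching of `k` edges with regular adjacency matrix, and every inner node has as many used
outputs as used inputs.  Flows correspond to families of linearly independent paths
(`excess_of_paths`, `PartialPaths.complete`), and a flow is bounded by the value of every cut
(`Excess.le_cutValue`).  It remains to see that an iteration either increases the value of the flow
by one or exhibits a cut whose value is that of the flow, and to count its steps.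

*Moves.*  During an iteration the used edges form a flow together with a partial path from `S` to
the current node (`Excess`).  Forward moves, same-layer rewirings and backward rewirings preserve
this, because regularity survives adding a row and a column, exchanging a row and removing a row and
a column (`Independent.cons`, `Independent.exchange`, `Independent.remove`); the rematchings are
found by alternating paths (`IsCombination.mem_alternatingPaths`, `release_spec`).  When the partial
path reaches `D`, the value of the flow has gone up (`Excess.complete`).

*Failure.*  The explored nodes after a failed iteration are to be a tight cut.  Three notions say
that a set `Ω` of nodes is closed under the moves: outside `Ω`, the row of an input is a combination
of rows of used inputs in `Ω` (`RowIn`); the moves from an unused input stay in `Ω` (`XClosed`); the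
moves after the release of a used output stay in `Ω` (`YClosed`).  The search takes place while the
used edges change, but closure with respect to the current used edges implies closure with respect
to those at the beginning of the iteration (`Transfers`), provided that `Ω` is closed under the
moves that led from one to the other.  These moves are still in progress, and the invariant
(`Labels`) therefore speaks of all `Ω` that contain the explored nodes and satisfy assumptions `H`,
which say that `Ω` is closed under the moves in progress; when all moves from an input have failed,
its assumption is discharged (`HeadClosed`, `Labels.discharge`).  At the end no assumption is left,
and the set of explored nodes is closed with respect to the flow, so that its cut has rank at most
`k`: its rows are spanned by those of the used inputs, which satisfy one independent relation for
each used output (`Excess.cutValue_le`, `Failure.capacity_le`).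

*Running time and termination.*  The steps are paid for by a `potential`, which holds credits for
the edges into unexplored nodes, for the unexplored outputs used initially, and for the pending
inputs of both types.  The clock plus the potential grows at most by a credit that is given to the
call (`Post`).  The potential and this credit together are smaller for every recursive call; hence
the six mutually recursive functions meet their specifications by strong induction on their sum
(`specification`), which proves termination and the bound at once.  An iteration takes
`O(|X| (N³ + d N²))` steps, where `N = k + 1` (`iterationTime_le`), and there are `C + 1` of them
(`iterate_spec`).
-/

/-! ### Values and running times of the list subroutines -/

namespace Timed

section Basic

variable {α β F : Type}

@[simp] theorem val_pure (a : α) : (pure a : Timed α).val = a := rfl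
@[simp] theorem time_pure (a : α) : (pure a : Timed α).time = 0 := rfl
@[simp] theorem val_bind (m : Timed α) (f : α → Timed β) : (m >>= f).val = (f m.val).val := rfl
@[simp] theorem time_bind (m : Timed α) (f : α → Timed β) :
    (m >>= f).time = m.time + (f m.val).time := rfl
@[simp] theorem time_step : step.time = 1 := rfl

theorem find_val (p : α → Bool) (l : List α) : (find p l).val = l.find? p := by
  induction l with
  | nil => rfl
  | cons a l ih => by_cases h : p a <;> simp [find, h, ih]

theorem find_time (p : α → Bool) (l : List α) : (find p l).time ≤ l.length + 1 := by
  induction l with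
  | nil => simp [find]
  | cons a l ih => by_cases h : p a <;> simp [find, h]; omega

theorem any_val (p : α → Bool) (l : List α) : (any p l).val = l.any p := by
  induction l with
  | nil => rfl
  | cons a l ih => by_cases h : p a <;> simp [any, h, ih]

theorem any_time (p : α → Bool) (l : List α) : (any p l).time ≤ l.length + 1 := by
  induction l with
  | nil => simp [any]
  | cons a l ih => by_cases h : p a <;> simp [any, h]; omega

theorem filter_val (p : α → Bool) (l : List α) : (filter p l).val = l.filter p := by
  induction l with
  | nil => rfl
  | cons a l ih => by_cases h : p a <;> simp [filter, h, ih]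

theorem filter_time (p : α → Bool) (l : List α) : (filter p l).time = l.length + 1 := by
  induction l with
  | nil => simp [filter]
  | cons a l ih => simp [filter, ih]; omega

theorem map_val (f : α → Timed β) (l : List α) : (map f l).val = l.map fun a => (f a).val := by
  induction l with
  | nil => rfl
  | cons a l ih => simp [map, ih]

theorem map_time_le (f : α → Timed β) (l : List α) (t : ℕ) (h : ∀ a ∈ l, (f a).time ≤ t) :
    (map f l).time ≤ l.length * (t + 1) + 1 := by
  induction l with
  | nil => simp [map]
  | cons a l ih =>
    have h1 := h a (by simp)
    have h2 := ih fun b hb => h b (by simp [hb])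
    simp only [map, time_bind, time_step, time_pure, List.length_cons, Nat.add_mul]
    omega

theorem length_val (l : List α) : (length l).val = l.length := by
  induction l with
  | nil => rfl
  | cons a l ih => simp [length, ih]

theorem length_time (l : List α) : (length l).time = l.length + 1 := by
  induction l with
  | nil => rfl
  | cons a l ih => simp [length, ih]; omega

theorem append_val (l m : List α) : (append l m).val = l ++ m := by
  induction l with
  | nil => rfl
  | cons a l ih => simp [append, ih]

theorem append_time (l m : List α) : (append l m).time = l.length + 1 := by
  induction l with
  | nil => rfl
  | cons a l ih => simp [append, ih]; omega

theorem erase_val [DecidableEq α] (a : α) (l : List α) : (erase a l).val = l.erase a := by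
  induction l with
  | nil => rfl
  | cons b l ih => by_cases h : b = a <;> simp [erase, h, ih]

theorem perm_cons_erase [DecidableEq α] {a : α} {l : List α} (h : a ∈ l) :
    l.Perm (a :: (erase a l).val) := by
  rw [erase_val]; exact List.perm_cons_erase h

theorem mem_erase_of_ne [DecidableEq α] {a b : α} {l : List α} (h : a ≠ b) :
    a ∈ (erase b l).val ↔ a ∈ l := by
  rw [erase_val]; exact List.mem_erase_of_ne h

theorem erase_time [DecidableEq α] (a : α) (l : List α) : (erase a l).time ≤ l.length + 1 := by
  induction l with
  | nil => simp [erase]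
  | cons b l ih => by_cases h : b = a <;> simp [erase, h]; omega

theorem extract_time (p : α → Bool) (l : List α) : (extract p l).time ≤ l.length + 1 := by
  induction l with
  | nil => simp [extract]
  | cons a l ih =>
    by_cases h : p a
    · simp [extract, h]
    · simp only [extract, h, time_bind, time_step, List.length_cons, Bool.false_eq_true, if_false]
      cases (extract p l).val <;> simp only [time_pure] <;> omega

theorem extract_eq_none {p : α → Bool} {l : List α} (h : (extract p l).val = none) :
    ∀ a ∈ l, p a = false := by
  induction l with
  | nil => simp
  | cons a l ih =>
    by_cases hp : p a
    · simp [extract, hp] at h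
    · simp only [extract, hp, val_bind, Bool.false_eq_true, if_false] at h
      cases he : (extract p l).val with
      | none =>
        intro b hb
        rcases List.mem_cons.1 hb with rfl | hb
        · simpa using hp
        · exact ih he b hb
      | some q => rw [he] at h; simp at h

theorem extract_eq_some {p : α → Bool} {l r : List α} {b : α}
    (h : (extract p l).val = some (b, r)) : p b = true ∧ l.Perm (b :: r) := by
  induction l generalizing b r with
  | nil => simp [extract] at h
  | cons a l ih =>
    by_cases hp : p a
    · simp only [extract, hp, val_bind, if_true, val_pure, Option.some.injEq, Prod.mk.injEq] at h
      obtain ⟨rfl, rfl⟩ := h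
      exact ⟨hp, List.Perm.refl _⟩
    · simp only [extract, hp, val_bind, Bool.false_eq_true, if_false] at h
      cases he : (extract p l).val with
      | none => rw [he] at h; simp at h
      | some q =>
        rw [he] at h
        simp only [val_pure, Option.some.injEq, Prod.mk.injEq] at h
        obtain ⟨rfl, rfl⟩ := h
        obtain ⟨h1, h2⟩ := ih (b := q.1) (r := q.2) he
        exact ⟨h1, (h2.cons a).trans (List.Perm.swap _ _ _)⟩

end Basic

/-! ### Gaussian elimination -/

section Elimination

variable {α F : Type} [Field F]

/-- The scalar product of the coefficients of an equation with the values of the unknowns. -/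
def dotProd (u z : List F) : F := (List.zipWith (· * ·) u z).sum

@[simp] theorem dotProd_cons (a b : F) (u z : List F) :
    dotProd (a :: u) (b :: z) = a * b + dotProd u z := by simp [dotProd]

@[simp] theorem dotProd_nil_left (z : List F) : dotProd [] z = 0 := by simp [dotProd]

@[simp] theorem dotProd_nil_right (z : List F) : dotProd z [] = 0 := by simp [dotProd]

theorem dotProd_eq_zero {z : List F} (hz : ∀ a ∈ z, a = 0) (u : List F) : dotProd u z = 0 := by
  induction z generalizing u with
  | nil => simp
  | cons a z ih =>
    cases u with
    | nil => simp
    | cons b u => simp [hz a (by simp), ih fun c hc => hz c (by simp [hc])]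

theorem subRow_length (c : F) (u v : List F) (h : u.length = v.length) :
    (subRow c u v).val.length = u.length := by
  induction u generalizing v with
  | nil => simp [subRow]
  | cons a u ih =>
    cases v with
    | nil => simp at h
    | cons b v => simp [subRow, ih v (by simpa using h)]

theorem subRow_time (c : F) (u v : List F) : (subRow c u v).time ≤ u.length + 1 := by
  induction u generalizing v with
  | nil => simp [subRow]
  | cons a u ih =>
    cases v with
    | nil => simp [subRow]
    | cons b v =>
      have := ih v
      simp only [subRow, time_bind, time_step, time_pure, List.length_cons]
      omega

theorem dotProd_subRow (c : F) (u v z : List F) (h : u.length = v.length) :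
    dotProd (subRow c u v).val z = dotProd u z - c * dotProd v z := by
  induction u generalizing v z with
  | nil =>
    have : v = [] := List.length_eq_zero_iff.1 (by simpa using h.symm)
    simp [subRow, this]
  | cons a u ih =>
    cases v with
    | nil => simp at h
    | cons b v =>
      cases z with
      | nil => simp
      | cons e z =>
        simp only [subRow, val_bind, val_pure, dotProd_cons, ih v z (by simpa using h)]
        ring

theorem dot_val (u : List F) (w : List (α × F)) :
    (dot u w).val = dotProd u (w.map Prod.snd) := by
  induction u generalizing w with
  | nil => simp [dot]
  | cons a u ih =>
    cases w with
    | nil => simp [dot]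
    | cons b w => simp [dot, ih]

theorem dot_time (u : List F) (w : List (α × F)) : (dot u w).time ≤ u.length + 1 := by
  induction u generalizing w with
  | nil => simp [dot]
  | cons a u ih =>
    cases w with
    | nil => simp [dot]
    | cons b w =>
      have := ih w
      simp only [dot, time_bind, time_step, time_pure, List.length_cons]
      omega

theorem eliminate_time (a : F) (v : List F) (b : F) (r : List F × F) :
    (eliminate a v b r).time ≤ r.1.length + 1 := by
  obtain ⟨r, s⟩ := r
  cases r with
  | nil => simp [eliminate]
  | cons c u =>
    have := subRow_time (c / a) u v
    simp only [eliminate, time_bind, time_step, time_pure, List.length_cons]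
    omega

theorem eliminate_length (a : F) (v : List F) (b : F) (r : List F × F) :
    (eliminate a v b r).val.1.length ≤ r.1.length := by
  obtain ⟨r, s⟩ := r
  cases r with
  | nil => simp [eliminate]
  | cons c u =>
    have : (subRow (c / a) u v).val.length ≤ u.length := by
      induction u generalizing v with
      | nil => simp [subRow]
      | cons e u ih =>
        cases v with
        | nil => simp [subRow]
        | cons f v => simpa [subRow] using ih v
    simp only [eliminate, val_bind, val_pure, List.length_cons]
    omega

variable [DecidableEq F]

theorem solve_time (names : List α) (rows : List (List F × F)) (m : ℕ) (h : rows.length ≤ m)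
    (hr : ∀ r ∈ rows, r.1.length ≤ m) :
    (solve names rows).time ≤ names.length * (m ^ 2 + 5 * m + 5) + 1 := by
  induction names generalizing rows with
  | nil => simp [solve]
  | cons x xs ih =>
    have he := extract_time isPivot rows
    simp only [solve, time_bind, time_step, List.length_cons, Nat.add_mul]
    cases hp : (extract isPivot rows).val with
    | none => simp only [time_pure]; nlinarith
    | some q =>
      obtain ⟨⟨r, s⟩, rest⟩ := q
      have hperm := (extract_eq_some hp).2
      have hlen : rest.length + 1 ≤ m := by simpa [hperm.length_eq] using h
      have hr' : ∀ q ∈ rest, q.1.length ≤ m := fun q hq => hr q (hperm.symm.subset (by simp [hq]))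
      have hr0 : r.length ≤ m := hr (r, s) (hperm.symm.subset (by simp))
      cases r with
      | nil => simp only [time_pure]; nlinarith
      | cons a v =>
        simp only [time_bind, time_pure]
        have h1 := map_time_le (eliminate a v s) rest (m + 1) fun q hq =>
          (eliminate_time a v s q).trans (by have := hr' q hq; omega)
        have h2 := ih (map (eliminate a v s) rest).val (by rw [map_val, List.length_map]; omega)
          (by
            intro q hq
            rw [map_val] at hq
            obtain ⟨q', hq', rfl⟩ := List.mem_map.1 hq
            exact (eliminate_length a v s q').trans (hr' q' hq'))
        have h3 := dot_time v (solve xs (map (eliminate a v s) rest).val).val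
        rw [List.length_cons] at hr0
        have h4 : rest.length * (m + 1 + 1) ≤ (m - 1) * (m + 2) := Nat.mul_le_mul_right _ (by omega)
        obtain ⟨m, rfl⟩ : ∃ m', m = m' + 1 := ⟨m - 1, by omega⟩
        simp only [Nat.add_sub_cancel] at h4
        nlinarith

/-- Gaussian elimination is correct for square systems whose homogeneous system has only the
trivial solution. -/
theorem solve_spec (names : List α) (rows : List (List F × F)) (h : rows.length = names.length)
    (hr : ∀ r ∈ rows, r.1.length = names.length)
    (hker : ∀ z : List F, z.length = names.length → (∀ r ∈ rows, dotProd r.1 z = 0) →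
      ∀ a ∈ z, a = 0) :
    (solve names rows).val.map Prod.fst = names ∧
      ∀ r ∈ rows, dotProd r.1 ((solve names rows).val.map Prod.snd) = r.2 := by
  induction names generalizing rows with
  | nil =>
    have : rows = [] := List.length_eq_zero_iff.1 (by simpa using h)
    simp [solve, this]
  | cons x xs ih =>
    cases hp : (extract isPivot rows).val with
    | none =>
      -- without a pivot, the first unit vector would solve the homogeneous system
      exfalso
      refine one_ne_zero (hker (1 :: List.replicate xs.length 0) (by simp) ?_ 1 (by simp))
      intro r hrr
      have h1 := extract_eq_none hp r hrr
      obtain ⟨r, s⟩ := r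
      have h2 := hr _ hrr
      cases r with
      | nil => simp
      | cons c u =>
        have h3 : c = 0 := by simpa [isPivot] using h1
        rw [dotProd_cons, h3, dotProd_eq_zero fun a ha => List.eq_of_mem_replicate ha]
        simp
    | some q =>
      obtain ⟨⟨r, s⟩, rest⟩ := q
      obtain ⟨hpiv, hperm⟩ := extract_eq_some hp
      have hmem : ∀ q, q ∈ rows ↔ q = (r, s) ∨ q ∈ rest := fun q => by
        rw [hperm.mem_iff, List.mem_cons]
      cases r with
      | nil => simp [isPivot] at hpiv
      | cons a v =>
        have ha : a ≠ 0 := by simpa [isPivot] using hpiv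
        have hv : v.length = xs.length := by simpa using hr _ ((hmem _).2 (Or.inl rfl))
        -- a solution of the reduced system extends to the original system
        have hext : ∀ (q : List F × F), q ∈ rest → ∀ (z : List F) (z0 : F),
            dotProd q.1 (z0 :: z) - q.2 = dotProd (eliminate a v s q).val.1 z
              - (eliminate a v s q).val.2 + (q.1.headD 0 / a) * (a * z0 + dotProd v z - s) := by
          intro q hq z z0
          obtain ⟨q, t⟩ := q
          have hl := hr _ ((hmem _).2 (Or.inr hq))
          cases q with
          | nil => simp at hl
          | cons c u =>
            simp only [eliminate, val_bind, val_pure, List.headD_cons, dotProd_cons]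
            rw [dotProd_subRow _ _ _ _ (by simp at hl; omega)]
            field_simp
            ring
        have hext0 : ∀ (q : List F × F), q ∈ rest → ∀ (z : List F) (z0 : F),
            dotProd q.1 (z0 :: z) = dotProd (eliminate a v s q).val.1 z
              + (q.1.headD 0 / a) * (a * z0 + dotProd v z) := by
          intro q hq z z0
          obtain ⟨q, t⟩ := q
          have hl := hr _ ((hmem _).2 (Or.inr hq))
          cases q with
          | nil => simp at hl
          | cons c u =>
            simp only [eliminate, val_bind, val_pure, List.headD_cons, dotProd_cons]
            rw [dotProd_subRow _ _ _ _ (by simp at hl; omega)]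
            field_simp
            ring
        have hmv : (map (eliminate a v s) rest).val = rest.map fun q => (eliminate a v s q).val :=
          map_val _ _
        obtain ⟨ih1, ih2⟩ := ih (map (eliminate a v s) rest).val
          (by
            have := hperm.length_eq
            simp only [List.length_cons] at this h
            rw [hmv, List.length_map]; omega)
          (by
            intro q hq
            rw [hmv] at hq
            obtain ⟨q', hq', rfl⟩ := List.mem_map.1 hq
            have hl := hr _ ((hmem _).2 (Or.inr hq'))
            obtain ⟨q', t⟩ := q'
            cases q' with
            | nil => simp at hl
            | cons c u =>
              simp only [List.length_cons, Nat.add_right_cancel_iff] at hl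
              simp only [eliminate, val_bind, val_pure]
              rw [subRow_length _ _ _ (by omega), hl])
          (by
            intro z hz hz0 b hb
            refine hker ((-(dotProd v z) / a) :: z) (by simp [hz]) ?_ b (by simp [hb])
            intro q hq
            rcases (hmem q).1 hq with rfl | hq
            · rw [dotProd_cons]; field_simp; ring
            · rw [hext0 q hq, hz0 _ (by rw [hmv]; exact List.mem_map_of_mem hq)]
              field_simp; ring)
        have hval : (solve (x :: xs) rows).val =
            (x, (s - dotProd v ((solve xs (map (eliminate a v s) rest).val).val.map Prod.snd)) / a)
              :: (solve xs (map (eliminate a v s) rest).val).val := by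
          simp only [solve, val_bind, hp, val_pure, dot_val]
        rw [hval]
        refine ⟨by simp [ih1], ?_⟩
        intro q hq
        rw [List.map_cons]
        rcases (hmem q).1 hq with rfl | hq
        · rw [dotProd_cons]; field_simp; ring
        · have := hext q hq ((solve xs (map (eliminate a v s) rest).val).val.map Prod.snd)
            ((s - dotProd v ((solve xs (map (eliminate a v s) rest).val).val.map Prod.snd)) / a)
          rw [ih2 _ (by rw [hmv]; exact List.mem_map_of_mem hq)] at this
          rw [← sub_eq_zero, this]
          field_simp; ring

end Elimination

end Timed

namespace ADTNetwork

/-! ### Regular lists of edges and linear combinations of inputs -/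

section Regular

variable {F V X Y : Type} [Field F]

/-- The combination of inputs that is given by a list of inputs with coefficients. -/
def coeffs [DecidableEq X] (Λ : List (X × F)) : X → F := (Λ.map fun t => Pi.single t.1 t.2).sum

section Coeffs

variable [DecidableEq X]

@[simp] theorem coeffs_nil : coeffs ([] : List (X × F)) = 0 := rfl

@[simp] theorem coeffs_cons (t : X × F) (Λ : List (X × F)) :
    coeffs (t :: Λ) = Pi.single t.1 t.2 + coeffs Λ := by simp [coeffs]

theorem coeffs_of_notMem {Λ : List (X × F)} {x : X} (h : x ∉ Λ.map Prod.fst) :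
    coeffs Λ x = 0 := by
  induction Λ with
  | nil => rfl
  | cons t Λ ih =>
    simp only [List.map_cons, List.mem_cons, not_or] at h
    rw [coeffs_cons, Pi.add_apply, ih h.2, Pi.single_eq_of_ne h.1, add_zero]

theorem coeffs_of_mem {Λ : List (X × F)} (hΛ : (Λ.map Prod.fst).Nodup) {t : X × F} (h : t ∈ Λ) :
    coeffs Λ t.1 = t.2 := by
  induction Λ with
  | nil => simp at h
  | cons s Λ ih =>
    simp only [List.map_cons, List.nodup_cons] at hΛ
    rw [coeffs_cons, Pi.add_apply]
    rcases List.mem_cons.1 h with rfl | h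
    · rw [coeffs_of_notMem hΛ.1, Pi.single_eq_same, add_zero]
    · have : t.1 ≠ s.1 := fun he => hΛ.1 (he ▸ List.mem_map_of_mem h)
      rw [ih hΛ.2 h, Pi.single_eq_of_ne this, zero_add]

theorem coeffs_filter_ne_zero [DecidableEq F] (Λ : List (X × F)) :
    coeffs (Λ.filter fun t => decide (t.2 ≠ 0)) = coeffs Λ := by
  induction Λ with
  | nil => rfl
  | cons t Λ ih => by_cases h : t.2 = 0 <;> simp_all

theorem vecMul_coeffs [Fintype X] (T : Matrix X Y F) (Λ : List (X × F)) (y : Y) :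
    Matrix.vecMul (coeffs Λ) T y = (Λ.map fun t => t.2 * T t.1 y).sum := by
  induction Λ with
  | nil => simp
  | cons t Λ ih => simp [Matrix.add_vecMul, ih, Matrix.single_vecMul]

end Coeffs

variable [Fintype X] (G : ADTNetwork F V X Y)

/-- The rows of the inputs of the edges in `U`, restricted to the outputs of these edges, are
linearly independent. -/
def Independent (U : List (X × Y)) : Prop :=
  ∀ c : X → F, (∀ x, c x ≠ 0 → x ∈ U.map Prod.fst) →
    (∀ y ∈ U.map Prod.snd, Matrix.vecMul c G.T y = 0) → c = 0

/-- `U` is a matching in layer cut `l` whose adjacency matrix is regular. -/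
structure IsRegularCut (l : ℕ) (U : List (X × Y)) : Prop where
  edge : ∀ e ∈ U, G.T e.1 e.2 ≠ 0
  layer : ∀ e ∈ U, G.layer (G.nodeX e.1) = l
  nodup_fst : (U.map Prod.fst).Nodup
  nodup_snd : (U.map Prod.snd).Nodup
  indep : G.Independent U

variable {G}

theorem Independent.congr {U U' : List (X × Y)} (h : G.Independent U)
    (h1 : (U'.map Prod.fst).Perm (U.map Prod.fst)) (h2 : (U'.map Prod.snd).Perm (U.map Prod.snd)) :
    G.Independent U' := fun c hc hy =>
  h c (fun x hx => h1.mem_iff.1 (hc x hx)) fun y hyU => hy y (h2.mem_iff.2 hyU)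

variable [DecidableEq X]

/-- Adding an edge whose new row is not the same combination of the old rows on the new column as
on the old columns. -/
theorem Independent.cons {U : List (X × Y)} (h : G.Independent U) {x : X} {y : Y} {c : X → F}
    (hx : x ∉ U.map Prod.fst) (hc : ∀ u, c u ≠ 0 → u ∈ U.map Prod.fst)
    (hcU : ∀ v ∈ U.map Prod.snd, Matrix.vecMul c G.T v = G.T x v)
    (hcy : Matrix.vecMul c G.T y ≠ G.T x y) : G.Independent ((x, y) :: U) := by
  intro b hb hby
  simp only [List.map_cons, List.mem_cons] at hb hby
  have hcx : c x = 0 := by by_contra h0; exact hx (hc x h0)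
  have key : ∀ v, Matrix.vecMul (b - b x • (Pi.single x 1 - c)) G.T v =
      Matrix.vecMul b G.T v - b x * (G.T x v - Matrix.vecMul c G.T v) := by
    intro v
    simp [Matrix.sub_vecMul, Matrix.smul_vecMul, Matrix.single_vecMul]
  have h0 : b - b x • (Pi.single x 1 - c) = 0 := by
    refine h _ (fun u hu => ?_) fun v hv => ?_
    · by_contra hu'
      refine hu ?_
      have hcu : c u = 0 := by by_contra h0; exact hu' (hc u h0)
      by_cases hux : u = x
      · subst hux; simp [hcu]
      · have hbu : b u = 0 := by
          by_contra h0
          rcases hb u h0 with h1 | h1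
          · exact hux h1
          · exact hu' h1
        simp [hcu, hbu, hux]
    · rw [key, hby v (Or.inr hv), hcU v hv]; simp
  have h1 := key y
  rw [h0, hby y (Or.inl rfl)] at h1
  have hbx : b x = 0 := by
    have : b x * (G.T x y - Matrix.vecMul c G.T y) = 0 := by simpa using h1
    rcases mul_eq_zero.1 this with h2 | h2
    · exact h2
    · exact absurd (sub_eq_zero.1 h2).symm hcy
  simpa [hbx] using h0

/-- Replacing a row that occurs in the combination for the new row. -/
theorem Independent.exchange {U U' : List (X × Y)} (h : G.Independent U) {x x' : X} {c : X → F}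
    (hx : x ∉ U.map Prod.fst) (hc : ∀ u, c u ≠ 0 → u ∈ U.map Prod.fst)
    (hcU : ∀ v ∈ U.map Prod.snd, Matrix.vecMul c G.T v = G.T x v) (hcx' : c x' ≠ 0)
    (h1 : (x' :: U'.map Prod.fst).Perm (x :: U.map Prod.fst))
    (h2 : (U'.map Prod.snd).Perm (U.map Prod.snd)) (hnd : (U.map Prod.fst).Nodup) :
    G.Independent U' := by
  intro b hb hby
  have hcx : c x = 0 := by by_contra h0; exact hx (hc x h0)
  have hxx' : x' ≠ x := fun he => hcx' (he ▸ hcx)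
  have hx'U : x' ∉ U'.map Prod.fst := by
    have : (x :: U.map Prod.fst).Nodup := List.nodup_cons.2 ⟨hx, hnd⟩
    exact (List.nodup_cons.1 (h1.symm.nodup this)).1
  have key : ∀ v, Matrix.vecMul (b - b x • (Pi.single x 1 - c)) G.T v =
      Matrix.vecMul b G.T v - b x * (G.T x v - Matrix.vecMul c G.T v) := by
    intro v
    simp [Matrix.sub_vecMul, Matrix.smul_vecMul, Matrix.single_vecMul]
  have h0 : b - b x • (Pi.single x 1 - c) = 0 := by
    refine h _ (fun u hu => ?_) fun v hv => ?_
    · by_contra hu'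
      refine hu ?_
      have hcu : c u = 0 := by by_contra h0; exact hu' (hc u h0)
      by_cases hux : u = x
      · subst hux; simp [hcu]
      · have hbu : b u = 0 := by
          by_contra h0
          have := h1.subset (List.mem_cons_of_mem _ (hb u h0))
          rcases List.mem_cons.1 this with h3 | h3
          · exact hux h3
          · exact hu' h3
        simp [hcu, hbu, hux]
    · rw [key, hby v (h2.mem_iff.2 hv), hcU v hv]; simp
  have hbx' : b x' = 0 := by by_contra h3; exact hx'U (hb x' h3)
  have h3 := congrFun h0 x'
  have hbx : b x = 0 := by
    simp only [Pi.sub_apply, Pi.smul_apply, hbx', Pi.single_eq_of_ne hxx', smul_eq_mul,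
      Pi.zero_apply] at h3
    have : b x * c x' = 0 := by linear_combination h3
    exact (mul_eq_zero.1 this).resolve_right hcx'
  simpa [hbx] using h0

/-- Removing a row and a column with a nonzero entry in the inverse matrix. -/
theorem Independent.remove {U U' : List (X × Y)} (h : G.Independent U) {x : X} {y : Y} {c : X → F}
    (hc : ∀ u, c u ≠ 0 → u ∈ U.map Prod.fst)
    (hcU : ∀ v ∈ U.map Prod.snd, v ≠ y → Matrix.vecMul c G.T v = 0)
    (hcy : Matrix.vecMul c G.T y = 1) (hcx : c x ≠ 0)
    (h1 : (x :: U'.map Prod.fst).Perm (U.map Prod.fst))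
    (h2 : (y :: U'.map Prod.snd).Perm (U.map Prod.snd)) (hnd : (U.map Prod.fst).Nodup) :
    G.Independent U' := by
  intro b hb hby
  have hxU' : x ∉ U'.map Prod.fst := (List.nodup_cons.1 (h1.symm.nodup hnd)).1
  have hbx : b x = 0 := by by_contra h3; exact hxU' (hb x h3)
  have h0 : b - Matrix.vecMul b G.T y • c = 0 := by
    refine h _ (fun u hu => ?_) fun v hv => ?_
    · by_contra hu'
      refine hu ?_
      have hcu : c u = 0 := by by_contra h0; exact hu' (hc u h0)
      have hbu : b u = 0 := by
        by_contra h0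
        exact hu' (h1.subset (List.mem_cons_of_mem _ (hb u h0)))
      simp [hcu, hbu]
    · rw [Matrix.sub_vecMul, Matrix.smul_vecMul, Pi.sub_apply, Pi.smul_apply, smul_eq_mul]
      by_cases hvy : v = y
      · subst hvy; simp [hcy]
      · have hv' : v ∈ U'.map Prod.snd := by
          rcases List.mem_cons.1 (h2.symm.subset hv) with h3 | h3
          · exact absurd h3 hvy
          · exact h3
        simp [hby v hv', hcU v hv hvy]
  have h3 := congrFun h0 x
  have h4 : Matrix.vecMul b G.T y = 0 := by
    simp only [Pi.sub_apply, hbx, Pi.smul_apply, smul_eq_mul, Pi.zero_apply, zero_sub,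
      neg_eq_zero] at h3
    exact (mul_eq_zero.1 h3).resolve_right hcx
  simpa [h4] using h0

end Regular

/-! ### Solving for the coefficients of a combination -/

section Combine

variable {F V X Y : Type} [Field F]

theorem combination_time (G : ADTNetwork F V X Y) (y : Y) (Λ : List (X × F)) :
    (G.combination y Λ).time = Λ.length + 1 := by
  induction Λ with
  | nil => rfl
  | cons t Λ ih => simp [combination, ih]; omega

variable [Fintype X] [DecidableEq X] (G : ADTNetwork F V X Y)

theorem combination_val (y : Y) (Λ : List (X × F)) :
    (G.combination y Λ).val = Matrix.vecMul (coeffs Λ) G.T y := by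
  rw [vecMul_coeffs]
  induction Λ with
  | nil => rfl
  | cons t Λ ih => simp [combination, ih]

theorem dotProd_map_eq_vecMul (U : List (X × Y)) (z : List (X × F))
    (h : z.map Prod.fst = U.map Prod.fst) (v : Y) :
    Timed.dotProd (U.map fun e => G.T e.1 v) (z.map Prod.snd) =
      Matrix.vecMul (coeffs z) G.T v := by
  have h1 : (U.map fun e => G.T e.1 v) = z.map fun t => G.T t.1 v := by
    have := congrArg (List.map fun x => G.T x v) h
    simpa [List.map_map, Function.comp_def] using this.symm
  rw [h1, vecMul_coeffs]
  clear h h1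
  induction z with
  | nil => simp
  | cons t z ih => simp [ih, mul_comm]

variable {G}

/-- What `combine` returns when the adjacency matrix of the used edges is regular. -/
structure IsCombination (G : ADTNetwork F V X Y) (U : List (X × Y)) (b : Y → F)
    (Λ : List (X × F)) : Prop where
  nodup : (Λ.map Prod.fst).Nodup
  mem : ∀ t ∈ Λ, t.1 ∈ U.map Prod.fst
  ne_zero : ∀ t ∈ Λ, t.2 ≠ 0
  length_le : Λ.length ≤ U.length
  eq : ∀ v ∈ U.map Prod.snd, Matrix.vecMul (coeffs Λ) G.T v = b v

theorem IsCombination.mem_of_coeffs_ne_zero {U : List (X × Y)} {b : Y → F} {Λ : List (X × F)}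
    (h : G.IsCombination U b Λ) {x : X} (hx : coeffs Λ x ≠ 0) : x ∈ U.map Prod.fst := by
  have : x ∈ Λ.map Prod.fst := by by_contra h'; exact hx (coeffs_of_notMem h')
  obtain ⟨t, ht, rfl⟩ := List.mem_map.1 this
  exact h.mem t ht

variable [DecidableEq F]

/-- A bound for the running time of `combine` with `n` used edges. -/
def combineTime (n : ℕ) : ℕ := n ^ 3 + 6 * n ^ 2 + 9 * n + 4

/-- Since the adjacency matrix is regular, every row vector on the used outputs is a combination of
rows of used inputs, and Gaussian elimination finds it. -/
theorem combine_spec {U : List (X × Y)} (h1 : (U.map Prod.fst).Nodup) (h : G.Independent U)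
    (b : Y → F) :
    G.IsCombination U b (G.combine U b).val ∧ (G.combine U b).time ≤ combineTime U.length := by
  set names := U.map Prod.fst with hnames
  set rows : List (List F × F) := U.map fun e => (U.map fun e' => G.T e'.1 e.2, b e.2) with hrows
  have hv1 : (Timed.map (fun e : X × Y => (pure e.1 : Timed X)) U).val = names := by
    rw [Timed.map_val]; rfl
  have hv2 : (Timed.map (fun e : X × Y => (do
      let r ← Timed.map (fun e' => pure (G.T e'.1 e.2)) U
      pure (r, b e.2) : Timed (List F × F))) U).val = rows := by
    rw [Timed.map_val]
    refine List.map_congr_left fun e _ => ?_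
    simp only [Timed.val_bind, Timed.val_pure, Timed.map_val]
  have ht1 := Timed.map_time_le (fun e : X × Y => (pure e.1 : Timed X)) U 0 (by simp)
  have ht2 := Timed.map_time_le (fun e : X × Y => (do
      let r ← Timed.map (fun e' => pure (G.T e'.1 e.2)) U
      pure (r, b e.2) : Timed (List F × F))) U (U.length + 1) (by
        intro e _
        have := Timed.map_time_le (fun e' : X × Y => (pure (G.T e'.1 e.2) : Timed F)) U 0 (by simp)
        simp only [Timed.time_bind, Timed.time_pure]
        omega)
  have hrl : rows.length = names.length := by simp [hrows, hnames]
  have hrl' : ∀ r ∈ rows, r.1.length = names.length := by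
    intro r hr
    obtain ⟨e, _, rfl⟩ := List.mem_map.1 hr
    simp [hnames]
  have hlen : names.length = U.length := by simp [hnames]
  obtain ⟨hs1, hs2⟩ := Timed.solve_spec names rows hrl hrl' (by
    intro z hz hz0 a ha
    have hf : (names.zip z).map Prod.fst = U.map Prod.fst := List.map_fst_zip (by omega)
    have hs : (names.zip z).map Prod.snd = z := List.map_snd_zip (by omega)
    have hc : coeffs (names.zip z) = 0 := by
      refine h _ (fun x hx => ?_) fun y hy => ?_
      · by_contra hx'
        exact hx (coeffs_of_notMem (by rwa [hf]))
      · obtain ⟨e, he, rfl⟩ := List.mem_map.1 hy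
        rw [← dotProd_map_eq_vecMul G U _ hf, hs]
        exact hz0 _ (List.mem_map.2 ⟨e, he, rfl⟩)
    rw [← hs] at ha
    obtain ⟨t, ht, rfl⟩ := List.mem_map.1 ha
    rw [← coeffs_of_mem (by rwa [hf]) ht, hc]
    rfl)
  have ht3 := Timed.solve_time names rows U.length (by omega) fun r hr => by
    rw [hrl' r hr, hlen]
  have hval : (G.combine U b).val =
      (Timed.solve names rows).val.filter fun t => decide (t.2 ≠ 0) := by
    simp only [combine, Timed.val_bind, hv1, hv2, Timed.filter_val]
  have hzl : (Timed.solve names rows).val.length = U.length := by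
    have := congrArg List.length hs1
    simpa [hlen] using this
  refine ⟨⟨?_, ?_, ?_, ?_, ?_⟩, ?_⟩
  · rw [hval]
    refine List.Nodup.sublist (List.Sublist.map _ List.filter_sublist) ?_
    rw [hs1]; exact h1
  · intro t ht
    rw [hval] at ht
    have := List.mem_map_of_mem (f := Prod.fst) (List.mem_of_mem_filter ht)
    rwa [hs1] at this
  · intro t ht
    rw [hval] at ht
    simpa using List.of_mem_filter ht
  · rw [hval, ← hzl]
    exact List.length_filter_le _ _
  · intro v hv
    obtain ⟨e, he, rfl⟩ := List.mem_map.1 hv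
    rw [hval, coeffs_filter_ne_zero, ← dotProd_map_eq_vecMul G U _ hs1]
    exact hs2 _ (List.mem_map.2 ⟨e, he, rfl⟩)
  · simp only [combine, Timed.time_bind, hv1, hv2, Timed.filter_time, hzl, combineTime]
    rw [hlen] at ht3
    nlinarith

/-- Let the rows of the edges in `Ua` vanish on the columns of the edges in `Ub`.  Then the inputs
of `Ub` do not occur in a combination of rows that vanishes on the columns of `Ub`. -/
theorem Independent.eq_zero_of_block {Ua Ub : List (X × Y)} (h : G.Independent (Ua ++ Ub))
    (hnd : ((Ua ++ Ub).map Prod.fst).Nodup)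
    (h0 : ∀ e ∈ Ua, ∀ e' ∈ Ub, G.T e.1 e'.2 = 0) {c : X → F}
    (hc : ∀ x, c x ≠ 0 → x ∈ (Ua ++ Ub).map Prod.fst)
    (hcU : ∀ e ∈ Ub, Matrix.vecMul c G.T e.2 = 0) {e : X × Y} (he : e ∈ Ub) : c e.1 = 0 := by
  have hvan : ∀ a : X → F, (∀ x, a x ≠ 0 → x ∈ Ua.map Prod.fst) → ∀ e' ∈ Ub,
      Matrix.vecMul a G.T e'.2 = 0 := by
    intro a ha e' he'
    refine Finset.sum_eq_zero fun x _ => ?_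
    by_cases hx : a x = 0
    · simp [hx]
    · obtain ⟨e'', he'', rfl⟩ := List.mem_map.1 (ha x hx)
      simp [h0 e'' he'' e' he']
  have hUa : G.Independent Ua := by
    intro a ha hay
    refine h a (fun x hx => ?_) fun y hy => ?_
    · rw [List.map_append, List.mem_append]; exact Or.inl (ha x hx)
    · rw [List.map_append, List.mem_append] at hy
      rcases hy with hy | hy
      · exact hay y hy
      · obtain ⟨e', he', rfl⟩ := List.mem_map.1 hy
        exact hvan a ha e' he'
  rw [List.map_append, List.nodup_append] at hnd
  obtain ⟨hΛ, -⟩ := combine_spec hnd.1 hUa (Matrix.vecMul c G.T)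
  set Λ := (G.combine Ua (Matrix.vecMul c G.T)).val
  have hsupp : ∀ x, coeffs Λ x ≠ 0 → x ∈ Ua.map Prod.fst := by
    intro x hx
    have : x ∈ Λ.map Prod.fst := by by_contra h'; exact hx (coeffs_of_notMem h')
    obtain ⟨t, ht, rfl⟩ := List.mem_map.1 this
    exact hΛ.mem t ht
  have heq : c - coeffs Λ = 0 := by
    refine h _ (fun x hx => ?_) fun y hy => ?_
    · by_contra hx'
      have h1 : c x = 0 := by by_contra h'; exact hx' (hc x h')
      have h2 : coeffs Λ x = 0 := by
        by_contra h'
        exact hx' (by rw [List.map_append, List.mem_append]; exact Or.inl (hsupp x h'))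
      exact hx (by simp [h1, h2])
    · rw [Matrix.sub_vecMul, Pi.sub_apply]
      rw [List.map_append, List.mem_append] at hy
      rcases hy with hy | hy
      · rw [hΛ.eq y hy, sub_self]
      · obtain ⟨e', he', rfl⟩ := List.mem_map.1 hy
        rw [hcU e' he', hvan _ hsupp e' he', sub_self]
  rw [sub_eq_zero.1 heq]
  by_contra h'
  exact hnd.2.2 e.1 (hsupp e.1 h') e.1 (List.mem_map_of_mem he) rfl

end Combine

end ADTNetwork

namespace ADTNetwork

/-! ### Alternating paths and rematching -/

section Alternating

variable {F V X Y : Type} [Field F] {G : ADTNetwork F V X Y}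

/-- The list `π` (last part first) is an alternating path from `x₀` to `x`: each of its pairs is an
edge `(q, y)` to be used next, where `q` is the input reached before, and a used edge `(x, y)` to
be given up, and the latter are distinct. -/
inductive AltPath (G : ADTNetwork F V X Y) (x₀ : X) : List ((X × Y) × (X × Y)) → X → Prop
  | nil : AltPath G x₀ [] x₀
  | cons {π : List ((X × Y) × (X × Y))} {q x : X} {y : Y} (h : AltPath G x₀ π q)
      (hT : G.T q y ≠ 0) (hmem : (x, y) ∉ π.map Prod.snd) :
      AltPath G x₀ (((q, y), (x, y)) :: π) x

theorem AltPath.nodup {x₀ x : X} {π : List ((X × Y) × (X × Y))} (h : G.AltPath x₀ π x) :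
    (π.map Prod.snd).Nodup := by
  induction h with
  | nil => simp
  | cons h hT hmem ih => simpa using ⟨by simpa using hmem, by simpa using ih⟩

variable [DecidableEq F]

theorem prolong_val (x : X) (π : List ((X × Y) × (X × Y))) (U : List (X × Y)) :
    (G.prolong x π U).val =
      ((U.filter fun e => decide (G.T x e.2 ≠ 0)).map fun e => (e.1, ((x, e.2), e) :: π),
        U.filter fun e => decide (G.T x e.2 = 0)) := by
  induction U with
  | nil => rfl
  | cons e U ih => by_cases h : G.T x e.2 = 0 <;> simp [prolong, ih, h]

theorem prolong_time (x : X) (π : List ((X × Y) × (X × Y))) (U : List (X × Y)) :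
    (G.prolong x π U).time = U.length + 1 := by
  induction U with
  | nil => rfl
  | cons e U ih => by_cases h : G.T x e.2 = 0 <;> simp [prolong, ih, h] <;> omega

theorem length_filter_add_length_filter (U : List (X × Y)) (x : X) :
    (U.filter fun e => decide (G.T x e.2 ≠ 0)).length
      + (U.filter fun e => decide (G.T x e.2 = 0)).length = U.length := by
  induction U with
  | nil => rfl
  | cons e U ih => by_cases h : G.T x e.2 = 0 <;> simp_all <;> omega

theorem traverse_time (n : ℕ) (queue : List (Reached X Y)) (U : List (X × Y)) (u : ℕ)
    (hu : U.length ≤ u) : (G.traverse n queue U).time ≤ n * (2 * u + 3) + 1 := by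
  induction n generalizing queue U with
  | zero => cases queue <;> simp [traverse]
  | succ n ih =>
    cases queue with
    | nil => simp [traverse]
    | cons q queue =>
      have h1 := length_filter_add_length_filter (G := G) U q.1
      have h2 := ih ((U.filter fun e => decide (G.T q.1 e.2 ≠ 0)).map
        (fun e => (e.1, ((q.1, e.2), e) :: q.2)) ++ queue)
        (U.filter fun e => decide (G.T q.1 e.2 = 0)) (by omega)
      simp only [traverse, Timed.time_bind, Timed.time_step, prolong_time, prolong_val,
        Timed.append_time, Timed.append_val, List.length_map, Timed.time_pure]
      rw [Nat.add_mul]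
      omega

theorem traverse_length (n : ℕ) (queue : List (Reached X Y)) (U : List (X × Y)) :
    (G.traverse n queue U).val.length ≤ n := by
  induction n generalizing queue U with
  | zero => cases queue <;> simp [traverse]
  | succ n ih =>
    cases queue with
    | nil => simp [traverse]
    | cons q queue => simpa [traverse] using ih _ _

/-- Every path found by the traversal is alternating, and its used edges are in `U₀`. The used edges
of the paths in the queue are no longer in the list `U` of the unreached edges, and so no used edge
occurs twice in a path. -/
theorem traverse_sound (x₀ : X) (U₀ : List (X × Y)) (n : ℕ) (queue : List (Reached X Y))
    (U : List (X × Y)) (hU : U.Nodup) (hUU : U ⊆ U₀)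
    (hq : ∀ r ∈ queue, G.AltPath x₀ r.2 r.1 ∧ r.2.map Prod.snd ⊆ U₀ ∧
      ∀ e ∈ r.2.map Prod.snd, e ∉ U) :
    ∀ r ∈ (G.traverse n queue U).val, G.AltPath x₀ r.2 r.1 ∧ r.2.map Prod.snd ⊆ U₀ := by
  induction n generalizing queue U with
  | zero => cases queue <;> simp [traverse]
  | succ n ih =>
    cases queue with
    | nil => simp [traverse]
    | cons q queue =>
      obtain ⟨hq1, hq2, hq3⟩ := hq q (by simp)
      intro r hr
      simp only [traverse, Timed.val_bind, prolong_val, Timed.append_val, Timed.val_pure,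
        List.mem_cons] at hr
      rcases hr with rfl | hr
      · exact ⟨hq1, hq2⟩
      · refine ih _ _ (hU.filter _) (fun e he => hUU (List.mem_of_mem_filter he)) ?_ r hr
        intro r' hr'
        rcases List.mem_append.1 hr' with hr' | hr'
        · obtain ⟨e, he, rfl⟩ := List.mem_map.1 hr'
          have heU := List.mem_of_mem_filter he
          have heT : G.T q.1 e.2 ≠ 0 := by simpa using List.of_mem_filter he
          refine ⟨AltPath.cons hq1 heT fun h => hq3 e h heU, ?_, ?_⟩
          · intro e' he'
            rcases List.mem_cons.1 he' with rfl | he'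
            · exact hUU heU
            · exact hq2 he'
          · intro e' he' hf
            rcases List.mem_cons.1 he' with rfl | he'
            · exact heT (by simpa using List.of_mem_filter hf)
            · exact hq3 e' he' (List.mem_of_mem_filter hf)
        · obtain ⟨h1, h2, h3⟩ := hq r' (by simp [hr'])
          exact ⟨h1, h2, fun e he hf => h3 e he (List.mem_of_mem_filter hf)⟩

/-- The traversal misses nothing: no input that it reaches has an edge to an output of the set `R`
of the used edges that it does not reach. -/
theorem traverse_complete (n : ℕ) (queue : List (Reached X Y)) (U : List (X × Y))
    (hn : queue.length + U.length ≤ n) :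
    queue ⊆ (G.traverse n queue U).val ∧ ∃ R ⊆ U,
      (∀ e ∈ U, e ∈ R ∨ e.1 ∈ (G.traverse n queue U).val.map Prod.fst) ∧
      ∀ r ∈ (G.traverse n queue U).val, ∀ e ∈ R, G.T r.1 e.2 = 0 := by
  induction n generalizing queue U with
  | zero =>
    have h1 : queue = [] := List.length_eq_zero_iff.1 (by omega)
    subst h1
    exact ⟨by simp, U, by simp, fun e he => Or.inl he, by simp [traverse]⟩
  | succ n ih =>
    cases queue with
    | nil => exact ⟨by simp, U, by simp, fun e he => Or.inl he, by simp [traverse]⟩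
    | cons q queue =>
      have h1 := length_filter_add_length_filter (G := G) U q.1
      obtain ⟨ih1, R, hR, hR1, hR2⟩ := ih ((U.filter fun e => decide (G.T q.1 e.2 ≠ 0)).map
        (fun e => (e.1, ((q.1, e.2), e) :: q.2)) ++ queue)
        (U.filter fun e => decide (G.T q.1 e.2 = 0)) (by
          simp only [List.length_cons] at hn
          rw [List.length_append, List.length_map]; omega)
      have hval : (G.traverse (n + 1) (q :: queue) U).val = q :: (G.traverse n
        ((U.filter fun e => decide (G.T q.1 e.2 ≠ 0)).map
        (fun e => (e.1, ((q.1, e.2), e) :: q.2)) ++ queue)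
        (U.filter fun e => decide (G.T q.1 e.2 = 0))).val := by
        simp only [traverse, Timed.val_bind, prolong_val, Timed.append_val, Timed.val_pure]
      rw [hval]
      refine ⟨?_, R, fun e he => List.mem_of_mem_filter (hR he), ?_, ?_⟩
      · intro r hr
        rcases List.mem_cons.1 hr with rfl | hr
        · simp
        · exact List.mem_cons_of_mem _ (ih1 (List.mem_append_right _ hr))
      · intro e he
        by_cases hT : G.T q.1 e.2 = 0
        · rcases hR1 e (List.mem_filter.2 ⟨he, by simpa using hT⟩) with h | h
          · exact Or.inl h
          · exact Or.inr (by rw [List.map_cons]; exact List.mem_cons_of_mem _ h)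
        · right
          rw [List.map_cons]
          refine List.mem_cons_of_mem _ (List.mem_map.2 ⟨(e.1, ((q.1, e.2), e) :: q.2), ?_, rfl⟩)
          refine ih1 (List.mem_append_left _ (List.mem_map.2 ⟨e, ?_, rfl⟩))
          exact List.mem_filter.2 ⟨he, by simpa using hT⟩
      · intro r hr e he
        rcases List.mem_cons.1 hr with rfl | hr
        · simpa using List.of_mem_filter (hR he)
        · exact hR2 r hr e he

/-- A bound for the running time of `alternatingPaths` with `n` used edges. -/
def alternatingTime (n : ℕ) : ℕ := (n + 1) * (2 * n + 3) + n + 2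

theorem alternatingPaths_time (x : X) (U : List (X × Y)) :
    (G.alternatingPaths x U).time ≤ alternatingTime U.length := by
  have := traverse_time (G := G) (U.length + 1) [(x, [])] U U.length le_rfl
  simp only [alternatingPaths, Timed.time_bind, Timed.length_time, Timed.length_val,
    alternatingTime]
  omega

theorem alternatingPaths_length (x : X) (U : List (X × Y)) :
    (G.alternatingPaths x U).val.length ≤ U.length + 1 := by
  simpa [alternatingPaths, Timed.length_val] using traverse_length (G := G) _ _ _

theorem alternatingPaths_sound (x : X) {U : List (X × Y)} (hU : U.Nodup) :
    ∀ r ∈ (G.alternatingPaths x U).val, G.AltPath x r.2 r.1 ∧ r.2.map Prod.snd ⊆ U := by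
  simp only [alternatingPaths, Timed.val_bind, Timed.length_val]
  refine traverse_sound x U _ _ U hU (List.Subset.refl _) ?_
  intro r hr
  rw [List.mem_singleton] at hr
  subst hr
  exact ⟨AltPath.nil, by simp, by simp⟩

/-- The used edges fall into those whose inputs are reached and a set `R`, and no reached input has
an edge to an output of `R`. -/
theorem alternatingPaths_complete (x : X) (U : List (X × Y)) :
    x ∈ (G.alternatingPaths x U).val.map Prod.fst ∧ ∃ R ⊆ U,
      (∀ e ∈ U, e ∈ R ∨ e.1 ∈ (G.alternatingPaths x U).val.map Prod.fst) ∧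
      ∀ r ∈ (G.alternatingPaths x U).val, ∀ e ∈ R, G.T r.1 e.2 = 0 := by
  simp only [alternatingPaths, Timed.val_bind, Timed.length_val]
  have h := traverse_complete (G := G) (U.length + 1) [(x, [])] U (by simp; omega)
  exact ⟨List.mem_map.2 ⟨(x, []), h.1 (by simp), rfl⟩, h.2⟩

end Alternating

section Rematch

variable {F V X Y : Type} [Field F] {G : ADTNetwork F V X Y} [DecidableEq X] [DecidableEq Y]

/-- A bound for the running time of `rematch` with `n` used edges. -/
def rematchTime (n : ℕ) : ℕ := n * (n + 2) + 1

theorem rematch_time_aux (π : List ((X × Y) × (X × Y))) (U : List (X × Y)) (n : ℕ)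
    (hπ : (π.map Prod.snd).Nodup) (hU : π.map Prod.snd ⊆ U) (hn : U.length ≤ n) :
    (rematch π U).time ≤ π.length * (n + 2) + 1 := by
  induction π generalizing U with
  | nil => simp [rematch]
  | cons p π ih =>
    obtain ⟨e, e'⟩ := p
    rw [List.map_cons, List.nodup_cons] at hπ
    have he' : e' ∈ U := hU (by simp)
    have h1 := Timed.erase_time e' U
    have h2 := ih (e :: (Timed.erase e' U).val) hπ.2 (fun f hf => by
      have hfe : f ≠ e' := fun h => hπ.1 (h ▸ hf)
      exact List.mem_cons_of_mem _ ((Timed.mem_erase_of_ne hfe).2 (hU (by simp at hf ⊢; tauto))))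
      (by
        have := (Timed.perm_cons_erase he').length_eq
        simp only [List.length_cons] at this ⊢; omega)
    simp only [rematch, Timed.time_bind, Timed.time_step, List.length_cons,
      Nat.add_mul]
    omega

theorem rematch_time {x₀ x : X} {π : List ((X × Y) × (X × Y))} {U : List (X × Y)}
    (h : G.AltPath x₀ π x) (hU : π.map Prod.snd ⊆ U) :
    (rematch π U).time ≤ rematchTime U.length := by
  have h1 := rematch_time_aux π U U.length h.nodup hU le_rfl
  have h2 : π.length ≤ U.length := by
    simpa using (List.subperm_of_subset h.nodup hU).length_le
  have := Nat.mul_le_mul_right (U.length + 2) h2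
  unfold rematchTime
  omega

/-- Rematching along an alternating path from `x₀` to `x` replaces `x` by `x₀` among the used
inputs and keeps the used outputs. -/
theorem rematch_spec {x₀ x : X} {π : List ((X × Y) × (X × Y))} {U : List (X × Y)}
    (h : G.AltPath x₀ π x) (hU : π.map Prod.snd ⊆ U) (hT : ∀ e ∈ U, G.T e.1 e.2 ≠ 0) :
    (x :: (rematch π U).val.map Prod.fst).Perm (x₀ :: U.map Prod.fst) ∧
      ((rematch π U).val.map Prod.snd).Perm (U.map Prod.snd) ∧
      ∀ e ∈ (rematch π U).val, G.T e.1 e.2 ≠ 0 := by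
  induction h generalizing U with
  | nil => exact ⟨List.Perm.refl _, List.Perm.refl _, hT⟩
  | @cons π q x y h hTq hmem ih =>
    have he' : (x, y) ∈ U := hU (by simp)
    have hper : U.Perm ((x, y) :: (Timed.erase (x, y) U).val) := Timed.perm_cons_erase he'
    obtain ⟨ih1, ih2, ih3⟩ := ih (U := (q, y) :: (Timed.erase (x, y) U).val)
      (fun f hf => by
        have hfe : f ≠ (x, y) := fun h => hmem (h ▸ hf)
        exact List.mem_cons_of_mem _ ((Timed.mem_erase_of_ne hfe).2
          (hU (by rw [List.map_cons]; exact List.mem_cons_of_mem _ hf))))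
      (by
        intro e he
        rcases List.mem_cons.1 he with rfl | he
        · exact hTq
        · exact hT e (hper.symm.subset (List.mem_cons_of_mem _ he)))
    have hval : (rematch (((q, y), (x, y)) :: π) U).val =
        (rematch π ((q, y) :: (Timed.erase (x, y) U).val)).val := by
      simp only [rematch, Timed.val_bind]
    rw [hval]
    refine ⟨?_, ?_, ih3⟩
    · have h1 := (ih1.trans (List.Perm.swap _ _ _)).cons_inv
      refine (h1.cons x).trans ((List.Perm.swap _ _ _).trans (List.Perm.cons _ ?_))
      simpa using (hper.map Prod.fst).symm
    · refine ih2.trans ?_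
      simpa using (hper.map Prod.snd).symm

end Rematch

theorem perm_filter_append {X Y : Type} [DecidableEq X] [DecidableEq Y] (U R : List (X × Y)) :
    ((U.filter fun e => decide (e ∉ R)) ++ U.filter fun e => decide (e ∈ R)).Perm U := by
  have := List.filter_append_perm (fun e => decide (e ∉ R)) U
  simpa using this

section Release

variable {F V X Y : Type} [Field F] [DecidableEq F] [Fintype X] [DecidableEq X]
  {G : ADTNetwork F V X Y}

variable [DecidableEq Y]

/-- Every input in the combination for `x` is reached by an alternating path from `x`. -/
theorem IsCombination.mem_alternatingPaths {l : ℕ} {U : List (X × Y)} (hU : G.IsRegularCut l U)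
    {x : X} {Λ : List (X × F)} (h : G.IsCombination U (G.T x) Λ) {t : X × F} (ht : t ∈ Λ) :
    t.1 ∈ (G.alternatingPaths x U).val.map Prod.fst := by
  obtain ⟨hx, R, hR, hR1, hR2⟩ := alternatingPaths_complete (G := G) x U
  obtain ⟨e, he, het⟩ := List.mem_map.1 (h.mem t ht)
  rw [← het]
  refine (hR1 e he).resolve_left fun heR => ?_
  have hper := perm_filter_append U R
  have hz : coeffs Λ e.1 = 0 := by
    refine Independent.eq_zero_of_block (hU.indep.congr (hper.map _) (hper.map _))
      ((hper.map _).symm.nodup hU.nodup_fst) ?_ (c := coeffs Λ) ?_ ?_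
      (List.mem_filter.2 ⟨he, by simpa using heR⟩)
    · intro e₁ h₁ e₂ h₂
      have h3 : e₁ ∉ R := by simpa using List.of_mem_filter h₁
      obtain ⟨r, hr, hr1⟩ := List.mem_map.1
        ((hR1 e₁ (List.mem_of_mem_filter h₁)).resolve_left h3)
      rw [← hr1]
      exact hR2 r hr e₂ (by simpa using List.of_mem_filter h₂)
    · intro u hu
      exact (hper.map _).symm.subset (h.mem_of_coeffs_ne_zero hu)
    · intro e₂ h₂
      rw [h.eq _ (List.mem_map_of_mem (List.mem_of_mem_filter h₂))]
      obtain ⟨r, hr, hr1⟩ := List.mem_map.1 hx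
      rw [← hr1]
      exact hR2 r hr e₂ (by simpa using List.of_mem_filter h₂)
  rw [het, coeffs_of_mem h.nodup ht] at hz
  exact h.ne_zero t ht hz

/-- A bound for the running time of `release` with `n` used edges. -/
def releaseTime (n : ℕ) : ℕ := combineTime n + (n + 1) + alternatingTime n + (n + 2) + rematchTime n

theorem alternatingTime_mono {m n : ℕ} (h : m ≤ n) : alternatingTime m ≤ alternatingTime n := by
  unfold alternatingTime; gcongr

theorem rematchTime_mono {m n : ℕ} (h : m ≤ n) : rematchTime m ≤ rematchTime n := by
  unfold rematchTime; gcongr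

theorem combineTime_mono {m n : ℕ} (h : m ≤ n) : combineTime m ≤ combineTime n := by
  unfold combineTime; gcongr

theorem releaseTime_mono {m n : ℕ} (h : m ≤ n) : releaseTime m ≤ releaseTime n := by
  unfold releaseTime
  have h1 := alternatingTime_mono h
  have h2 := rematchTime_mono h
  have h3 := combineTime_mono h
  omega

/-- A used output can be released, together with some used input. -/
theorem release_spec {l : ℕ} {U : List (X × Y)} (hU : G.IsRegularCut l U) {y : Y}
    (hy : y ∈ U.map Prod.snd) :
    (G.release y U).time ≤ releaseTime U.length ∧ ∃ (x : X) (U' : List (X × Y)),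
      (G.release y U).val = some (x, U') ∧ (x :: U'.map Prod.fst).Perm (U.map Prod.fst) ∧
      (y :: U'.map Prod.snd).Perm (U.map Prod.snd) ∧ G.IsRegularCut l U' := by
  obtain ⟨hz, hzt⟩ := combine_spec hU.nodup_fst hU.indep (fun v => if v = y then (1 : F) else 0)
  set z := (G.combine U fun v => if v = y then (1 : F) else 0).val with hzdef
  have hxt := Timed.extract_time (fun e : X × Y => decide (e.2 = y)) U
  cases hz0 : z with
  | nil =>
    have := hz.eq y hy
    simp [hz0] at this
  | cons t z' =>
    obtain ⟨x, a⟩ := t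
    have hxz : (x, a) ∈ z := by simp [hz0]
    have hzx : coeffs z x ≠ 0 := by
      have := coeffs_of_mem hz.nodup hxz
      rw [this]
      exact hz.ne_zero _ hxz
    cases hex : (Timed.extract (fun e : X × Y => decide (e.2 = y)) U).val with
    | none =>
      obtain ⟨e, he, hey⟩ := List.mem_map.1 hy
      have := Timed.extract_eq_none hex e he
      simp [hey] at this
    | some q =>
      obtain ⟨e, U'⟩ := q
      obtain ⟨hey, hper⟩ := Timed.extract_eq_some hex
      have hey : e.2 = y := by simpa using hey
      have hlen : U'.length ≤ U.length := by have := hper.length_eq; simp at this; omega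
      have hU'nd : U'.Nodup := by
        have : U.Nodup := hU.nodup_fst.of_map
        exact (List.nodup_cons.1 (hper.nodup this)).2
      have hsub : U' ⊆ U := fun f hf => hper.symm.subset (List.mem_cons_of_mem _ hf)
      have hyU' : y ∉ U'.map Prod.snd := by
        have := (hper.map Prod.snd).nodup hU.nodup_snd
        rw [List.map_cons, List.nodup_cons, hey] at this
        exact this.1
      obtain ⟨hxe, R, hR, hR1, hR2⟩ := alternatingPaths_complete (G := G) e.1 U'
      have hxmem : x ∈ (G.alternatingPaths e.1 U').val.map Prod.fst := by
        have hxU := (hper.map Prod.fst).subset (hz.mem _ hxz)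
        rw [List.map_cons, List.mem_cons] at hxU
        rcases hxU with h | h
        · exact h ▸ hxe
        · obtain ⟨f, hf, rfl⟩ := List.mem_map.1 h
          refine (hR1 f hf).resolve_left fun hfR => hzx ?_
          have hper2 : (e :: (U'.filter fun e => decide (e ∉ R)) ++
              U'.filter fun e => decide (e ∈ R)).Perm U :=
            ((perm_filter_append U' R).cons e).trans hper.symm
          refine Independent.eq_zero_of_block (hU.indep.congr (hper2.map _) (hper2.map _))
            ((hper2.map _).symm.nodup hU.nodup_fst) ?_ (c := coeffs z) ?_ ?_
            (List.mem_filter.2 ⟨hf, by simpa using hfR⟩)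
          · intro e₁ h₁ e₂ h₂
            have h4 : e₂ ∈ R := by simpa using List.of_mem_filter h₂
            have h5 : e₁.1 ∈ (G.alternatingPaths e.1 U').val.map Prod.fst := by
              rcases List.mem_cons.1 h₁ with rfl | h₁
              · exact hxe
              · have h3 : e₁ ∉ R := by simpa using List.of_mem_filter h₁
                exact (hR1 e₁ (List.mem_of_mem_filter h₁)).resolve_left h3
            obtain ⟨r, hr, hr1⟩ := List.mem_map.1 h5
            rw [← hr1]
            exact hR2 r hr e₂ h4
          · intro u hu
            exact (hper2.map _).symm.subset (hz.mem_of_coeffs_ne_zero hu)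
          · intro e₂ h₂
            have h3 := List.mem_of_mem_filter h₂
            rw [hz.eq _ (List.mem_map_of_mem (hsub h3)), if_neg]
            rintro rfl
            exact hyU' (List.mem_map_of_mem h3)
      cases hfd : (G.alternatingPaths e.1 U').val.find? fun r => decide (r.1 = x) with
      | none =>
        obtain ⟨r, hr, hr1⟩ := List.mem_map.1 hxmem
        have := List.find?_eq_none.1 hfd r hr
        simp [hr1] at this
      | some r =>
        have hrx : r.1 = x := by simpa using List.find?_some hfd
        obtain ⟨hr1, hr2⟩ := alternatingPaths_sound (G := G) e.1 hU'nd r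
          (List.mem_of_find?_eq_some hfd)
        obtain ⟨hs1, hs2, hs3⟩ := rematch_spec hr1 hr2 fun f hf => hU.edge f (hsub hf)
        have hval : (G.release y U).val = some (x, (rematch r.2 U').val) := by
          simp only [release, Timed.val_bind, ← hzdef, hz0, hex, Timed.find_val, hfd,
            Timed.val_pure]
        have hp1 : (x :: (rematch r.2 U').val.map Prod.fst).Perm (U.map Prod.fst) := by
          rw [← hrx]
          exact hs1.trans (hper.map Prod.fst).symm
        have hp2 : (y :: (rematch r.2 U').val.map Prod.snd).Perm (U.map Prod.snd) := by
          rw [← hey]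
          exact (hs2.cons _).trans (hper.map Prod.snd).symm
        refine ⟨?_, x, _, hval, hp1, hp2, hs3, ?_, ?_, ?_, ?_⟩
        · have h1 := alternatingPaths_time (G := G) e.1 U'
          have h2 := alternatingTime_mono hlen
          have h3 := rematch_time hr1 hr2
          have h4 := rematchTime_mono hlen
          have h5 := Timed.find_time (fun r => decide (r.1 = x)) (G.alternatingPaths e.1 U').val
          have h6 := alternatingPaths_length (G := G) e.1 U'
          simp only [release, Timed.time_bind, ← hzdef, hz0, hex, Timed.find_val, hfd,
            Timed.time_pure, releaseTime]
          omega
        · intro f hf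
          have := hp1.subset (List.mem_cons_of_mem _ (List.mem_map_of_mem hf))
          obtain ⟨f', hf', hff⟩ := List.mem_map.1 this
          rw [← hff]
          exact hU.layer f' hf'
        · exact (List.nodup_cons.1 (hp1.symm.nodup hU.nodup_fst)).2
        · exact (List.nodup_cons.1 (hp2.symm.nodup hU.nodup_snd)).2
        · refine hU.indep.remove (c := coeffs z) (fun u hu => hz.mem_of_coeffs_ne_zero hu) ?_ ?_
            hzx hp1 hp2 hU.nodup_fst
          · intro v hv hvy
            rw [hz.eq v hv, if_neg hvy]
          · rw [hz.eq y hy, if_pos rfl]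

end Release

end ADTNetwork

namespace ADTNetwork

/-! ### Exchanging the coefficients -/

section Exchange

variable {F V X Y : Type} [Field F] [DecidableEq X]

theorem exchange_val (x x' : X) (a : F) (Λ : List (X × F)) :
    (exchange x x' a Λ).val = (x, 1 / a) ::
      (Λ.filter fun t => decide (t.1 ≠ x')).map fun t => (t.1, -(t.2 / a)) := by
  simp [exchange, Timed.filter_val, Timed.map_val]

theorem exchange_time (x x' : X) (a : F) (Λ : List (X × F)) :
    (exchange x x' a Λ).time ≤ 2 * Λ.length + 2 := by
  have h1 := Timed.map_time_le (fun t : X × F => (pure (t.1, -(t.2 / a)) : Timed (X × F)))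
    (Λ.filter fun t => decide (t.1 ≠ x')) 0 (by simp)
  have h2 := List.length_filter_le (fun t : X × F => decide (t.1 ≠ x')) Λ
  simp only [exchange, Timed.time_bind, Timed.filter_time, Timed.filter_val, Timed.time_pure]
  omega

theorem exchange_length (x : X) (Λ : List (X × F)) {t : X × F} (ht : t ∈ Λ) :
    (exchange x t.1 t.2 Λ).val.length ≤ Λ.length := by
  rw [exchange_val, List.length_cons, List.length_map]
  exact List.length_filter_lt_length_iff_exists.2 ⟨t, ht, by simp⟩

theorem coeffs_exchange (x : X) {Λ : List (X × F)} (hΛ : (Λ.map Prod.fst).Nodup) {t : X × F}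
    (ht : t ∈ Λ) (h0 : t.2 ≠ 0) : coeffs (exchange x t.1 t.2 Λ).val =
      t.2⁻¹ • (Pi.single x 1 - coeffs Λ) + Pi.single t.1 1 := by
  have key : ∀ Λ' : List (X × F), (Λ'.map Prod.fst).Nodup →
      coeffs ((Λ'.filter fun s => decide (s.1 ≠ t.1)).map fun s => (s.1, -(s.2 / t.2))) =
        -(t.2⁻¹ • (coeffs Λ' - Pi.single t.1 (coeffs Λ' t.1))) := by
    intro Λ' hnd
    induction Λ' with
    | nil => simp
    | cons s Λ' ih =>
      rw [List.map_cons, List.nodup_cons] at hnd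
      by_cases hs : s.1 = t.1
      · rw [List.filter_cons_of_neg (by simpa using hs), ih hnd.2, coeffs_cons,
          hs, Pi.add_apply, Pi.single_eq_same, Pi.single_add]
        have : coeffs Λ' t.1 = 0 := coeffs_of_notMem (hs ▸ hnd.1)
        rw [this]; simp
      · rw [List.filter_cons_of_pos (by simpa using hs), List.map_cons, coeffs_cons, ih hnd.2,
          coeffs_cons, Pi.add_apply, Pi.single_eq_of_ne (Ne.symm hs), zero_add]
        have : (Pi.single s.1 (-(s.2 / t.2)) : X → F) = -(t.2⁻¹ • Pi.single s.1 s.2) := by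
          rw [← Pi.single_smul, ← Pi.single_neg, smul_eq_mul, div_eq_inv_mul]
        rw [this, add_sub_assoc, smul_add, neg_add]
  rw [exchange_val, coeffs_cons, key Λ hΛ, coeffs_of_mem hΛ ht]
  have h1 : (Pi.single x (1 / t.2) : X → F) = t.2⁻¹ • Pi.single x 1 := by
    rw [← Pi.single_smul, smul_eq_mul, mul_one, one_div]
  have h2 : (Pi.single t.1 t.2 : X → F) = t.2 • Pi.single t.1 1 := by
    rw [← Pi.single_smul, smul_eq_mul, mul_one]
  simp only [h1, h2]
  rw [smul_sub, smul_smul, inv_mul_cancel₀ h0, one_smul, smul_sub]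
  abel

end Exchange

/-! ### Closure of a set of nodes under the moves -/

/-- In a combination `b` of rows of used inputs, the row of `x` can be replaced by a combination `c`
of rows of formerly used inputs in `Ω`. -/
theorem reduce_support {F V X Y : Type} [Field F] {G : ADTNetwork F V X Y} [DecidableEq X]
    {Ω : Set V} {U U' : List (X × Y)} {x : X} {b c : X → F}
    (hc : ∀ u, c u ≠ 0 → u ∈ U.map Prod.fst ∧ G.nodeX u ∈ Ω)
    (hsub : U'.map Prod.fst ⊆ x :: U.map Prod.fst)
    (hb : ∀ u, b u ≠ 0 → u ∈ U'.map Prod.fst ∧ G.nodeX u ∈ Ω) (u : X)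
    (hu : (b - b x • (Pi.single x 1 - c) : X → F) u ≠ 0) : u ∈ U.map Prod.fst ∧ G.nodeX u ∈ Ω := by
  by_cases hcu : c u = 0
  · by_cases hux : u = x
    · subst hux
      simp [hcu] at hu
    · have hbu : b u ≠ 0 := by
        intro h0
        simp [hcu, hux, h0] at hu
      refine ⟨?_, (hb u hbu).2⟩
      exact (List.mem_cons.1 (hsub (hb u hbu).1)).resolve_left hux
  · exact hc u hcu

section Closure

variable {F V X Y : Type} [Field F] [Fintype X] {G : ADTNetwork F V X Y}

/-- Outside `Ω`, the row of `x` is a combination of the rows of the used inputs in `Ω`. -/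
def RowIn (G : ADTNetwork F V X Y) (Ω : Set V) (U : List (X × Y)) (x : X) : Prop :=
  ∃ c : X → F, (∀ u, c u ≠ 0 → u ∈ U.map Prod.fst ∧ G.nodeX u ∈ Ω) ∧
    ∀ v, G.nodeY v ∉ Ω → Matrix.vecMul c G.T v = G.T x v

/-- The set `Ω` is closed under the moves from the unused input `x`: it contains the nodes of the
inputs in `Λ x` and of the outputs to which forward moves are possible. -/
def XClosed (G : ADTNetwork F V X Y) (Ω : Set V) (U : List (X × Y)) (x : X) : Prop :=
  G.nodeX x ∈ Ω ∧ ∃ c : X → F, (∀ u, c u ≠ 0 → u ∈ U.map Prod.fst ∧ G.nodeX u ∈ Ω) ∧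
    ∀ v, G.nodeY v ∉ Ω ∨ v ∈ U.map Prod.snd → Matrix.vecMul c G.T v = G.T x v

/-- The set `Ω` is closed under the moves that the release of the used output `y` makes possible.
Equivalently, some combination of the rows of used inputs in `Ω` vanishes outside `Ω` and, among
the used outputs, is nonzero in `y` only. -/
def YClosed (G : ADTNetwork F V X Y) (Ω : Set V) (U : List (X × Y)) (y : Y) : Prop :=
  ∃ c : X → F, (∀ u, c u ≠ 0 → u ∈ U.map Prod.fst ∧ G.nodeX u ∈ Ω) ∧
    (∀ v, G.nodeY v ∉ Ω → Matrix.vecMul c G.T v = 0) ∧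
    (∀ v ∈ U.map Prod.snd, v ≠ y → Matrix.vecMul c G.T v = 0) ∧ Matrix.vecMul c G.T y ≠ 0

/-- Closure properties with respect to the used edges `U` carry over to `U₀`. -/
structure Transfers (G : ADTNetwork F V X Y) (Ω : Set V) (U₀ U : List (X × Y)) : Prop where
  row : ∀ x, G.RowIn Ω U x → G.RowIn Ω U₀ x
  closed : ∀ y ∈ U₀.map Prod.snd, y ∈ U.map Prod.snd → G.YClosed Ω U y → G.YClosed Ω U₀ y

theorem Transfers.refl (Ω : Set V) (U : List (X × Y)) : G.Transfers Ω U U :=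
  ⟨fun _ h => h, fun _ _ _ h => h⟩

theorem Transfers.trans {Ω : Set V} {U₀ U U' : List (X × Y)} (h : G.Transfers Ω U₀ U)
    (h1 : ∀ x, G.RowIn Ω U' x → G.RowIn Ω U x)
    (h2 : ∀ y ∈ U₀.map Prod.snd, y ∈ U'.map Prod.snd → y ∈ U.map Prod.snd)
    (h3 : ∀ y ∈ U.map Prod.snd, y ∈ U'.map Prod.snd → G.YClosed Ω U' y → G.YClosed Ω U y) :
    G.Transfers Ω U₀ U' :=
  ⟨fun x hx => h.row x (h1 x hx), fun y hy hy' hc =>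
    h.closed y hy (h2 y hy hy') (h3 y (h2 y hy hy') hy' hc)⟩

theorem XClosed.rowIn {Ω : Set V} {U : List (X × Y)} {x : X} (h : G.XClosed Ω U x) :
    G.RowIn Ω U x := by
  obtain ⟨-, c, h1, h2⟩ := h
  exact ⟨c, h1, fun v hv => h2 v (Or.inl hv)⟩

/-- Releasing `x` and `y` transfers closure. -/
theorem Transfers.of_yClosed {Ω : Set V} {U₀ U U' : List (X × Y)} {x : X} {y : Y}
    (h : G.Transfers Ω U₀ U) (hY : G.YClosed Ω U y)
    (h1 : (x :: U'.map Prod.fst).Perm (U.map Prod.fst))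
    (h2 : (y :: U'.map Prod.snd).Perm (U.map Prod.snd)) (hnd : (U.map Prod.snd).Nodup) :
    G.Transfers Ω U₀ U' := by
  have hsub : U'.map Prod.fst ⊆ U.map Prod.fst := fun u hu =>
    h1.subset (List.mem_cons_of_mem _ hu)
  have hyU' : y ∉ U'.map Prod.snd := (List.nodup_cons.1 (h2.symm.nodup hnd)).1
  refine h.trans ?_ (fun v _ hv => h2.subset (List.mem_cons_of_mem _ hv)) ?_
  · rintro z ⟨c, hc, hcz⟩
    exact ⟨c, fun u hu => ⟨hsub (hc u hu).1, (hc u hu).2⟩, hcz⟩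
  · rintro z hzU hz ⟨b, hb1, hb2, hb3, hb4⟩
    have hzy : z ≠ y := fun he => hyU' (he ▸ hz)
    obtain ⟨g, hg1, hg2, hg3, hg4⟩ := hY
    have key : ∀ v, Matrix.vecMul (b - (Matrix.vecMul b G.T y / Matrix.vecMul g G.T y) • g) G.T v =
        Matrix.vecMul b G.T v
          - Matrix.vecMul b G.T y / Matrix.vecMul g G.T y * Matrix.vecMul g G.T v := by
      intro v
      rw [Matrix.sub_vecMul, Matrix.smul_vecMul, Pi.sub_apply, Pi.smul_apply, smul_eq_mul]
    refine ⟨b - (Matrix.vecMul b G.T y / Matrix.vecMul g G.T y) • g, fun u hu => ?_,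
      fun v hv => ?_, fun v hv hvz => ?_, ?_⟩
    · by_cases hgu : g u = 0
      · have hbu : b u ≠ 0 := by
          intro h0
          simp [hgu, h0] at hu
        exact ⟨hsub (hb1 u hbu).1, (hb1 u hbu).2⟩
      · exact hg1 u hgu
    · rw [key, hb2 v hv, hg2 v hv, mul_zero, sub_zero]
    · rw [key]
      rcases List.mem_cons.1 (h2.symm.subset hv) with rfl | hv'
      · field_simp; ring
      · have hvy : v ≠ y := fun he => hyU' (he ▸ hv')
        rw [hb3 v hv' hvz, hg3 v hv hvy, mul_zero, sub_zero]
    · rwa [key, hg3 z hzU hzy, mul_zero, sub_zero]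

variable [DecidableEq X]

theorem vecMul_reduce (b c : X → F) (x : X) (v : Y) :
    Matrix.vecMul (b - b x • (Pi.single x 1 - c)) G.T v =
      Matrix.vecMul b G.T v - b x * (G.T x v - Matrix.vecMul c G.T v) := by
  simp [Matrix.sub_vecMul, Matrix.smul_vecMul, Matrix.single_vecMul]

theorem RowIn.of_mem {Ω : Set V} {U : List (X × Y)} {x : X} (h : x ∈ U.map Prod.fst)
    (hx : G.nodeX x ∈ Ω) : G.RowIn Ω U x := by
  refine ⟨Pi.single x 1, fun u hu => ?_, fun v _ => by simp [Matrix.single_vecMul]⟩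
  have : u = x := by by_contra h'; exact hu (Pi.single_eq_of_ne h' _)
  exact this ▸ ⟨h, hx⟩

theorem RowIn.of_xClosed {Ω : Set V} {U U' : List (X × Y)} {x : X} (h : G.XClosed Ω U x)
    (hsub : U'.map Prod.fst ⊆ x :: U.map Prod.fst) {z : X}
    (hz : G.RowIn Ω U' z) : G.RowIn Ω U z := by
  obtain ⟨-, c, h1, h2⟩ := h
  obtain ⟨b, h3, h4⟩ := hz
  refine ⟨b - b x • (Pi.single x 1 - c), reduce_support h1 hsub h3, fun v hv => ?_⟩
  rw [vecMul_reduce, h4 v hv, h2 v (Or.inl hv), sub_self, mul_zero, sub_zero]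

theorem YClosed.of_xClosed {Ω : Set V} {U U' : List (X × Y)} {x : X} (h : G.XClosed Ω U x)
    (hsub : U'.map Prod.fst ⊆ x :: U.map Prod.fst)
    (hsub2 : U.map Prod.snd ⊆ U'.map Prod.snd) {y : Y} (hy : y ∈ U.map Prod.snd)
    (hz : G.YClosed Ω U' y) : G.YClosed Ω U y := by
  obtain ⟨-, c, h1, h2⟩ := h
  obtain ⟨b, h3, h4, h5, h6⟩ := hz
  refine ⟨b - b x • (Pi.single x 1 - c), reduce_support h1 hsub h3, fun v hv => ?_,
    fun v hv hvy => ?_,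
    ?_⟩
  · rw [vecMul_reduce, h4 v hv, h2 v (Or.inl hv), sub_self, mul_zero, sub_zero]
  · rw [vecMul_reduce, h5 v (hsub2 hv) hvy, h2 v (Or.inr hv), sub_self, mul_zero, sub_zero]
  · rwa [vecMul_reduce, h2 y (Or.inr hy), sub_self, mul_zero, sub_zero]

/-- Adding `x` to the used inputs, or exchanging it for another one, transfers closure. -/
theorem Transfers.of_xClosed {Ω : Set V} {U₀ U U' : List (X × Y)} {x : X}
    (h : G.Transfers Ω U₀ U) (hX : G.XClosed Ω U x)
    (hsub : U'.map Prod.fst ⊆ x :: U.map Prod.fst) (hsub2 : U.map Prod.snd ⊆ U'.map Prod.snd)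
    (hy : ∀ y ∈ U₀.map Prod.snd, y ∈ U'.map Prod.snd → y ∈ U.map Prod.snd) :
    G.Transfers Ω U₀ U' :=
  h.trans (fun _ hz => hz.of_xClosed hX hsub) hy
    fun _ hyU _ hz => hz.of_xClosed hX hsub hsub2 hyU

/-- If `Ω` is closed under the moves from the released input, it is closed for the released
output. -/
theorem XClosed.yClosed {Ω : Set V} {U U' : List (X × Y)} {x : X} {y : Y}
    (hX : G.XClosed Ω U' x) (hU : G.Independent U)
    (h1 : (x :: U'.map Prod.fst).Perm (U.map Prod.fst))
    (h2 : (y :: U'.map Prod.snd).Perm (U.map Prod.snd)) (hnd : (U.map Prod.fst).Nodup) :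
    G.YClosed Ω U y := by
  obtain ⟨hxΩ, c, hc1, hc2⟩ := hX
  have hxU' : x ∉ U'.map Prod.fst := (List.nodup_cons.1 (h1.symm.nodup hnd)).1
  have hcx : c x = 0 := by by_contra h0; exact hxU' (hc1 x h0).1
  have key : ∀ v, Matrix.vecMul (Pi.single x 1 - c) G.T v = G.T x v - Matrix.vecMul c G.T v := by
    intro v
    simp [Matrix.sub_vecMul, Matrix.single_vecMul]
  have hsupp : ∀ u, (Pi.single x 1 - c : X → F) u ≠ 0 → u ∈ U.map Prod.fst ∧ G.nodeX u ∈ Ω := by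
    intro u hu
    by_cases hux : u = x
    · rw [hux]; exact ⟨h1.subset (by simp), hxΩ⟩
    · have hcu : c u ≠ 0 := by
        intro h0
        simp [hux, h0] at hu
      exact ⟨h1.subset (List.mem_cons_of_mem _ (hc1 u hcu).1), (hc1 u hcu).2⟩
  have hvan : ∀ v ∈ U.map Prod.snd, v ≠ y → Matrix.vecMul (Pi.single x 1 - c) G.T v = 0 := by
    intro v hv hvy
    rw [key, hc2 v (Or.inr ((List.mem_cons.1 (h2.symm.subset hv)).resolve_left hvy)), sub_self]
  refine ⟨Pi.single x 1 - c, hsupp, fun v hv => ?_, hvan, fun h0 => ?_⟩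
  · rw [key, hc2 v (Or.inl hv), sub_self]
  · have := hU _ (fun u hu => (hsupp u hu).1) fun v hv => by
      by_cases hvy : v = y
      · rw [hvy, h0]
      · exact hvan v hv hvy
    have h3 := congrFun this x
    simp [hcx] at h3

/-- If `Ω` is closed under the moves from `x`, then it is closed under the moves from `x'` after
the rewiring that replaces `x'` by `x`. -/
theorem XClosed.exchange {Ω : Set V} {U U' : List (X × Y)} {x : X} {Λ : List (X × F)}
    (hX : G.XClosed Ω U x) (hU : G.Independent U) (hΛ : G.IsCombination U (G.T x) Λ)
    (hx : x ∉ U.map Prod.fst) {t : X × F} (ht : t ∈ Λ)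
    (h1 : (t.1 :: U'.map Prod.fst).Perm (x :: U.map Prod.fst))
    (h2 : (U'.map Prod.snd).Perm (U.map Prod.snd)) : G.XClosed Ω U' t.1 := by
  obtain ⟨hxΩ, c, hc1, hc2⟩ := hX
  have hcΛ : c = coeffs Λ := by
    rw [← sub_eq_zero]
    refine hU _ (fun u hu => ?_) fun v hv => ?_
    · by_contra hu'
      have h3 : c u = 0 := by by_contra h0; exact hu' (hc1 u h0).1
      have h4 : coeffs Λ u = 0 := by by_contra h0; exact hu' (hΛ.mem_of_coeffs_ne_zero h0)
      simp [h3, h4] at hu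
    · rw [Matrix.sub_vecMul, Pi.sub_apply, hc2 v (Or.inr hv), hΛ.eq v hv, sub_self]
  have hct : c t.1 = t.2 := by rw [hcΛ]; exact coeffs_of_mem hΛ.nodup ht
  have ht0 := hΛ.ne_zero t ht
  have hcx : c x = 0 := by by_contra h0; exact hx (hc1 x h0).1
  have htx : t.1 ≠ x := fun he => ht0 (by rw [← hct, he, hcx])
  refine ⟨(hc1 t.1 (by rwa [hct])).2, t.2⁻¹ • (Pi.single x 1 - c) + Pi.single t.1 1, ?_, ?_⟩
  · intro u hu
    have hut : u ≠ t.1 := by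
      rintro rfl
      simp [hct, htx, ht0] at hu
    have : u ∈ x :: U.map Prod.fst ∧ G.nodeX u ∈ Ω := by
      by_cases hux : u = x
      · rw [hux]; exact ⟨by simp, hxΩ⟩
      · have hcu : c u ≠ 0 := by
          intro h0
          simp [hux, hut, h0] at hu
        exact ⟨List.mem_cons_of_mem _ (hc1 u hcu).1, (hc1 u hcu).2⟩
    exact ⟨(List.mem_cons.1 (h1.symm.subset this.1)).resolve_left hut, this.2⟩
  · intro v hv
    have hv' : G.nodeY v ∉ Ω ∨ v ∈ U.map Prod.snd := hv.imp id fun h => h2.subset h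
    simp [Matrix.add_vecMul, Matrix.smul_vecMul, Matrix.sub_vecMul, Matrix.single_vecMul,
      hc2 v hv']

/-- The coefficients computed by `exchange` represent the row of the exchanged input. -/
theorem vecMul_coeffs_exchange {U : List (X × Y)} {x : X} {Λ : List (X × F)}
    (hΛ : G.IsCombination U (G.T x) Λ) {t : X × F} (ht : t ∈ Λ) (v : Y) :
    Matrix.vecMul (coeffs (exchange x t.1 t.2 Λ).val) G.T v =
      t.2⁻¹ * (G.T x v - Matrix.vecMul (coeffs Λ) G.T v) + G.T t.1 v := by
  rw [coeffs_exchange x hΛ.nodup ht (hΛ.ne_zero t ht)]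
  simp [Matrix.add_vecMul, Matrix.smul_vecMul, Matrix.sub_vecMul, Matrix.single_vecMul]

end Closure

end ADTNetwork

namespace ADTNetwork

/-! ### Flows with an excess -/

section Flow

variable {F V X Y : Type} [Field F]

variable {G : ADTNetwork F V X Y}

theorem one_lt_layer {B : V} (h : B ≠ G.S) : 1 < G.layer B := by
  have h1 := G.one_le_layer B
  have h2 := mt (G.layer_eq_one B).1 h
  omega

theorem nodeX_ne_D {x : X} {y : Y} (h : G.T x y ≠ 0) : G.nodeX x ≠ G.D := by
  intro h1
  have h2 := G.layer_edge x y h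
  have h3 := G.layer_le (G.nodeY y)
  have h4 := (G.layer_eq_L _).2 h1
  omega

theorem S_ne_D : G.S ≠ G.D := by
  intro h
  have h1 := (G.layer_eq_one _).2 rfl
  have h2 := (G.layer_eq_L _).2 rfl
  have h3 := G.two_le_L
  rw [h] at h1
  omega

variable [Fintype X]

theorem IsRegularCut.layerY {l : ℕ} {U : List (X × Y)} (h : G.IsRegularCut l U) {y : Y}
    (hy : y ∈ U.map Prod.snd) : G.layer (G.nodeY y) = l + 1 := by
  obtain ⟨e, he, rfl⟩ := List.mem_map.1 hy
  rw [G.layer_edge _ _ (h.edge e he), h.layer e he]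

theorem IsRegularCut.layerX {l : ℕ} {U : List (X × Y)} (h : G.IsRegularCut l U) {x : X}
    (hx : x ∈ U.map Prod.fst) : G.layer (G.nodeX x) = l := by
  obtain ⟨e, he, rfl⟩ := List.mem_map.1 hx
  exact h.layer e he

theorem IsRegularCut.ne_D {l : ℕ} {U : List (X × Y)} (h : G.IsRegularCut l U) {x : X}
    (hx : x ∈ U.map Prod.fst) : G.nodeX x ≠ G.D := by
  obtain ⟨e, he, rfl⟩ := List.mem_map.1 hx
  exact nodeX_ne_D (h.edge e he)

theorem IsRegularCut.eq_nil {l : ℕ} {U : List (X × Y)} (h : G.IsRegularCut l U)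
    (hl : l = 0 ∨ G.L ≤ l) : U = [] := by
  rw [List.eq_nil_iff_forall_not_mem]
  intro e he
  have h1 := h.layer e he
  have h2 := G.layer_edge _ _ (h.edge e he)
  have h3 := G.layer_le (G.nodeY e.2)
  have h4 := G.one_le_layer (G.nodeX e.1)
  omega

variable [DecidableEq V]

/-- The used edges form `k` linearly independent paths and, in addition, a partial path that ends in
node `A`: the adjacency matrices of all layer cuts are regular, and every inner node has as many
used inputs as used outputs, except that `A` has one more used output. For `A = S` these are `k`
paths, and for `A = D` these are `k + 1` paths. -/
structure Excess (G : ADTNetwork F V X Y) (k : ℕ) (A : V) (used : ℕ → List (X × Y)) : Prop where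
  cut : ∀ l, G.IsRegularCut l (used l)
  length : ∀ l, 1 ≤ l → l < G.L → (used l).length = if l < G.layer A then k + 1 else k
  conserve : ∀ B, B ≠ G.S → B ≠ G.D →
    (((used (G.layer B - 1)).map Prod.snd).map G.nodeY).count B =
      (((used (G.layer B)).map Prod.fst).map G.nodeX).count B + if B = A then 1 else 0

variable {k : ℕ} {A : V} {used : ℕ → List (X × Y)}

theorem Excess.length_le (h : G.Excess k A used) (l : ℕ) : (used l).length ≤ k + 1 := by
  by_cases hl : l = 0 ∨ G.L ≤ l
  · simp [(h.cut l).eq_nil hl]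
  · rw [h.length l (by omega) (by omega)]
    split_ifs <;> omega

theorem Excess.length_layer_le (h : G.Excess k A used) : (used (G.layer A)).length ≤ k := by
  by_cases hl : G.L ≤ G.layer A
  · simp [(h.cut _).eq_nil (Or.inr hl)]
  · rw [h.length _ (G.one_le_layer A) (by omega), if_neg (lt_irrefl _)]

/-- A forward move. -/
theorem Excess.forward [DecidableEq X] (h : G.Excess k A used) {x : X} {y : Y} (hxA : G.nodeX x = A)
    (hT : G.T x y ≠ 0) (hx : x ∉ (used (G.layer A)).map Prod.fst)
    (hy : y ∉ (used (G.layer A)).map Prod.snd)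
    (hind : G.Independent ((x, y) :: used (G.layer A))) :
    G.Excess k (G.nodeY y) (Function.update used (G.layer A) ((x, y) :: used (G.layer A))) := by
  have hly : G.layer (G.nodeY y) = G.layer A + 1 := by rw [G.layer_edge x y hT, hxA]
  have hc := h.cut (G.layer A)
  have hA1 := G.one_le_layer A
  refine ⟨fun l => ?_, fun l hl1 hl2 => ?_, fun B hS hD => ?_⟩
  · by_cases hl : l = G.layer A
    · subst hl
      rw [Function.update_self]
      refine ⟨?_, ?_, ?_, ?_, hind⟩
      · intro e he
        rcases List.mem_cons.1 he with rfl | he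
        · exact hT
        · exact hc.edge e he
      · intro e he
        rcases List.mem_cons.1 he with rfl | he
        · rw [hxA]
        · exact hc.layer e he
      · exact List.nodup_cons.2 ⟨hx, hc.nodup_fst⟩
      · exact List.nodup_cons.2 ⟨hy, hc.nodup_snd⟩
    · rw [Function.update_of_ne hl]
      exact h.cut l
  · have h1 := h.length l hl1 hl2
    rw [hly]
    by_cases hl : l = G.layer A
    · subst hl
      rw [Function.update_self, List.length_cons, h1, if_neg (lt_irrefl _), if_pos (by omega)]
    · rw [Function.update_of_ne hl, h1]
      exact if_congr (by omega) rfl rfl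
  · have h1 := h.conserve B hS hD
    have hB := one_lt_layer hS
    by_cases hBA : G.layer B = G.layer A
    · have h2 : B ≠ G.nodeY y := by rintro rfl; omega
      rw [if_neg h2, hBA, Function.update_self, Function.update_of_ne (by omega)]
      rw [hBA] at h1
      rw [List.map_cons, List.map_cons, List.count_cons, h1, hxA]
      simp only [beq_iff_eq, add_zero, eq_comm (a := B)]
    · have h2 : B ≠ A := by rintro rfl; exact hBA rfl
      rw [if_neg h2] at h1
      rw [Function.update_of_ne hBA]
      by_cases hBA' : G.layer B - 1 = G.layer A
      · rw [hBA'] at h1 ⊢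
        rw [Function.update_self, List.map_cons, List.map_cons, List.count_cons, h1]
        simp only [beq_iff_eq, add_zero, eq_comm (a := B)]
      · have h3 : B ≠ G.nodeY y := by rintro rfl; omega
        rw [Function.update_of_ne hBA', h1, if_neg h3]

/-- A same-layer rewiring. -/
theorem Excess.sameLayer (h : G.Excess k A used) {x x' : X} {U' : List (X × Y)}
    (hxA : G.nodeX x = A) (hx'A : G.layer (G.nodeX x') = G.layer A)
    (h1 : (x' :: U'.map Prod.fst).Perm (x :: (used (G.layer A)).map Prod.fst))
    (h2 : (U'.map Prod.snd).Perm ((used (G.layer A)).map Prod.snd))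
    (hU' : G.IsRegularCut (G.layer A) U') :
    G.Excess k (G.nodeX x') (Function.update used (G.layer A) U') := by
  refine ⟨fun l => ?_, fun l hl1 hl2 => ?_, fun B hS hD => ?_⟩
  · by_cases hl : l = G.layer A
    · subst hl
      rwa [Function.update_self]
    · rw [Function.update_of_ne hl]
      exact h.cut l
  · have h3 := h.length l hl1 hl2
    rw [hx'A]
    by_cases hl : l = G.layer A
    · subst hl
      have := h2.length_eq
      rw [List.length_map, List.length_map] at this
      rw [Function.update_self, this, h3]
    · rw [Function.update_of_ne hl, h3]
  · have h3 := h.conserve B hS hD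
    have hB := one_lt_layer hS
    by_cases hBA : G.layer B = G.layer A
    · have h4 := (h1.map G.nodeX).count_eq B
      rw [List.map_cons, List.map_cons, List.count_cons, List.count_cons, hxA] at h4
      simp only [beq_iff_eq] at h4
      rw [hBA] at h3 ⊢
      rw [Function.update_self, Function.update_of_ne (by omega), h3]
      simp only [eq_comm (a := B)]
      omega
    · have h4 : B ≠ A := by rintro rfl; exact hBA rfl
      have h5 : B ≠ G.nodeX x' := by rintro rfl; exact hBA hx'A
      rw [if_neg h4] at h3
      rw [Function.update_of_ne hBA, if_neg h5]
      by_cases hBA' : G.layer B - 1 = G.layer A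
      · rw [hBA'] at h3 ⊢
        rw [Function.update_self, (h2.map G.nodeY).count_eq B, h3]
      · rw [Function.update_of_ne hBA', h3]

/-- A backward rewiring. -/
theorem Excess.backward (h : G.Excess k A used) {x : X} {y : Y} {U' : List (X × Y)}
    (hyA : G.nodeY y = A) (h1 : (x :: U'.map Prod.fst).Perm ((used (G.layer A - 1)).map Prod.fst))
    (h2 : (y :: U'.map Prod.snd).Perm ((used (G.layer A - 1)).map Prod.snd))
    (hU' : G.IsRegularCut (G.layer A - 1) U') :
    G.Excess k (G.nodeX x) (Function.update used (G.layer A - 1) U') := by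
  have hx : x ∈ (used (G.layer A - 1)).map Prod.fst := h1.subset (by simp)
  have hlx := (h.cut _).layerX hx
  have hly : G.layer (G.nodeY y) = _ := (h.cut (G.layer A - 1)).layerY (h2.subset (by simp))
  have hx1 := G.one_le_layer (G.nodeX x)
  rw [hyA] at hly
  refine ⟨fun l => ?_, fun l hl1 hl2 => ?_, fun B hS hD => ?_⟩
  · by_cases hl : l = G.layer A - 1
    · subst hl
      rwa [Function.update_self]
    · rw [Function.update_of_ne hl]
      exact h.cut l
  · have h3 := h.length l hl1 hl2
    rw [hlx]
    by_cases hl : l = G.layer A - 1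
    · have := h2.length_eq
      rw [List.length_cons, List.length_map, List.length_map, ← hl, h3, if_pos (by omega)] at this
      rw [← hl, Function.update_self, if_neg (lt_irrefl _)]
      omega
    · rw [Function.update_of_ne hl, h3]
      exact if_congr (by omega) rfl rfl
  · have h3 := h.conserve B hS hD
    have hB := one_lt_layer hS
    by_cases hBA : G.layer B = G.layer A - 1
    · have h4 := (h1.map G.nodeX).count_eq B
      rw [List.map_cons, List.count_cons] at h4
      simp only [beq_iff_eq] at h4
      have h5 : B ≠ A := by rintro rfl; omega
      rw [if_neg h5, hBA] at h3
      rw [hBA, Function.update_self, Function.update_of_ne (by omega), h3, ← h4]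
      simp only [eq_comm (a := B), add_zero]
    · have h5 : B ≠ G.nodeX x := by rintro rfl; omega
      rw [Function.update_of_ne hBA, if_neg h5]
      by_cases hBA' : G.layer B - 1 = G.layer A - 1
      · have h4 := (h2.map G.nodeY).count_eq B
        rw [List.map_cons, List.count_cons, hyA] at h4
        simp only [beq_iff_eq] at h4
        rw [hBA'] at h3 ⊢
        rw [Function.update_self]
        rw [h3] at h4
        simp only [eq_comm (a := B)] at h4
        omega
      · have h6 : B ≠ A := by rintro rfl; exact hBA' rfl
        rw [Function.update_of_ne hBA', h3, if_neg h6]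

/-- A partial path that ends in the destination is a path. -/
theorem Excess.complete (h : G.Excess k G.D used) : G.Excess (k + 1) G.S used := by
  refine ⟨h.cut, fun l hl1 hl2 => ?_, fun B hS hD => ?_⟩
  · rw [h.length l hl1 hl2, (G.layer_eq_L _).2 rfl, (G.layer_eq_one _).2 rfl, if_pos hl2,
      if_neg (by omega)]
  · rw [h.conserve B hS hD, if_neg hD, if_neg hS]

end Flow

end ADTNetwork

/-! ### Terminating runs of programs -/

namespace UnicastProg

variable {F V X Y α β : Type}

/-- The program `p`, started with memory `m`, terminates, and its result and the final memory
satisfy `Q`. -/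
def Runs (p : UnicastProg F V X Y α) (m : UnicastMemory F V X Y)
    (Q : α → UnicastMemory F V X Y → Prop) : Prop :=
  ∃ a m', p.run m = some (a, m') ∧ Q a m'

theorem Runs.mono {p : UnicastProg F V X Y α} {m : UnicastMemory F V X Y}
    {P Q : α → UnicastMemory F V X Y → Prop} (h : Runs p m P) (hPQ : ∀ a m', P a m' → Q a m') :
    Runs p m Q := by
  obtain ⟨a, m', h1, h2⟩ := h
  exact ⟨a, m', h1, hPQ a m' h2⟩

theorem runs_bind {p : UnicastProg F V X Y α} {f : α → UnicastProg F V X Y β}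
    {m : UnicastMemory F V X Y} {Q : β → UnicastMemory F V X Y → Prop} :
    Runs (p >>= f) m Q ↔ Runs p m fun a m' => Runs (f a) m' Q := by
  simp only [Runs, StateT.run_bind, Option.bind_eq_bind]
  constructor
  · rintro ⟨b, m'', h, hQ⟩
    obtain ⟨⟨a, m'⟩, h1, h2⟩ := Option.bind_eq_some_iff.1 h
    exact ⟨a, m', h1, b, m'', h2, hQ⟩
  · rintro ⟨a, m', h1, b, m'', h2, hQ⟩
    exact ⟨b, m'', Option.bind_eq_some_iff.2 ⟨(a, m'), h1, h2⟩, hQ⟩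

theorem runs_pure {a : α} {m : UnicastMemory F V X Y} {Q : α → UnicastMemory F V X Y → Prop} :
    Runs (pure a) m Q ↔ Q a m := by
  constructor
  · rintro ⟨b, m', h, hQ⟩
    obtain ⟨rfl, rfl⟩ : a = b ∧ m = m' := by simpa using h
    exact hQ
  · intro h
    exact ⟨a, m, rfl, h⟩

theorem runs_modify {f : UnicastMemory F V X Y → UnicastMemory F V X Y}
    {m : UnicastMemory F V X Y} {Q : PUnit → UnicastMemory F V X Y → Prop} :
    Runs (modify f : UnicastProg F V X Y PUnit) m Q ↔ Q PUnit.unit (f m) := by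
  constructor
  · rintro ⟨b, m', h, hQ⟩
    obtain rfl : f m = m' := by
      have : some (PUnit.unit, f m) = some (b, m') := h
      simpa using this
    exact hQ
  · intro h
    exact ⟨PUnit.unit, f m, rfl, h⟩

theorem runs_get {m : UnicastMemory F V X Y}
    {Q : UnicastMemory F V X Y → UnicastMemory F V X Y → Prop} :
    Runs (get : UnicastProg F V X Y (UnicastMemory F V X Y)) m Q ↔ Q m m := by
  constructor
  · rintro ⟨b, m', h, hQ⟩
    obtain ⟨rfl, rfl⟩ : m = b ∧ m = m' := by
      have : some (m, m) = some (b, m') := h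
      simpa using this
    exact hQ
  · intro h
    exact ⟨m, m, rfl, h⟩

theorem runs_step {m : UnicastMemory F V X Y} {Q : PUnit → UnicastMemory F V X Y → Prop} :
    Runs step m Q ↔ Q PUnit.unit { m with clock := m.clock + 1 } := runs_modify

theorem runs_look {f : UnicastMemory F V X Y → α} {m : UnicastMemory F V X Y}
    {Q : α → UnicastMemory F V X Y → Prop} :
    Runs (look f) m Q ↔ Q (f { m with clock := m.clock + 1 }) { m with clock := m.clock + 1 } := by
  simp only [look, runs_bind, runs_step, runs_get, runs_pure]

theorem runs_write {f : UnicastMemory F V X Y → UnicastMemory F V X Y}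
    {m : UnicastMemory F V X Y} {Q : PUnit → UnicastMemory F V X Y → Prop} :
    Runs (write f) m Q ↔ Q PUnit.unit (f { m with clock := m.clock + 1 }) := by
  simp only [write, runs_bind, runs_step, runs_modify]

theorem runs_call {c : Timed α} {m : UnicastMemory F V X Y}
    {Q : α → UnicastMemory F V X Y → Prop} :
    Runs (call c) m Q ↔ Q c.val { m with clock := m.clock + c.time } := by
  simp only [call, runs_bind, runs_modify, runs_pure]

section Cells

variable [DecidableEq V] {m : UnicastMemory F V X Y}

theorem runs_pushPending {t : ℕ} {A : V} {x : X} {Q : PUnit → UnicastMemory F V X Y → Prop} :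
    Runs (pushPending t A x) m Q ↔ Q PUnit.unit { m with
      pending := Function.update m.pending t
        (Function.update (m.pending t) A (x :: m.pending t A))
      clock := m.clock + 2 } := by
  simp only [pushPending, setPending, runs_bind, runs_look, runs_write]

theorem runs_popPending_nil {t : ℕ} {A : V} {Q : Option X → UnicastMemory F V X Y → Prop}
    (h : m.pending t A = []) :
    Runs (popPending t A) m Q ↔ Q none { m with clock := m.clock + 1 } := by
  simp only [popPending, runs_bind, runs_look, h, runs_pure]

theorem runs_popPending_cons {t : ℕ} {A : V} {Q : Option X → UnicastMemory F V X Y → Prop}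
    {x : X} {xs : List X} (h : m.pending t A = x :: xs) :
    Runs (popPending t A) m Q ↔ Q (some x) { m with
      pending := Function.update m.pending t (Function.update (m.pending t) A xs)
      clock := m.clock + 2 } := by
  simp only [popPending, setPending, runs_bind, runs_look, runs_write, h, runs_pure]

end Cells

end UnicastProg

namespace ADTNetwork

open UnicastProg

section IsOpen

variable {F V X Y : Type} [Field F] [DecidableEq X] {G : ADTNetwork F V X Y}
  {m : UnicastMemory F V X Y}

/-- The value of `isOpen`. -/
def openValue (G : ADTNetwork F V X Y) (m : UnicastMemory F V X Y) (x : X) (t : ℕ) : Bool :=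
  !((m.used (G.layer (G.nodeX x))).any fun e => decide (e.1 = x)) && !m.exploredX x &&
    decide (m.type x = t)

theorem openValue_eq_true {x : X} {t : ℕ} : G.openValue m x t = true ↔
    x ∉ (m.used (G.layer (G.nodeX x))).map Prod.fst ∧ m.exploredX x = false ∧ m.type x = t := by
  simp only [openValue, Bool.and_eq_true, Bool.not_eq_true', List.any_eq_false, decide_eq_true_eq,
    List.mem_map, not_exists, not_and, and_assoc]

theorem runs_isOpen {x : X} {t : ℕ} {Q : Bool → UnicastMemory F V X Y → Prop} :
    Runs (G.isOpen x t) m Q ↔ Q (G.openValue m x t) { m with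
      clock := m.clock + 3 +
        (Timed.any (fun e => decide (e.1 = x)) (m.used (G.layer (G.nodeX x)))).time } := by
  simp only [isOpen, runs_bind, runs_look, runs_call, runs_pure, Timed.any_val, openValue]
  rw [show m.clock + 1 + (Timed.any (fun e => decide (e.1 = x))
    (m.used (G.layer (G.nodeX x)))).time + 1 + 1 = m.clock + 3 + (Timed.any
    (fun e => decide (e.1 = x)) (m.used (G.layer (G.nodeX x)))).time by omega]

end IsOpen

/-! ### The potential -/

theorem sum_update_length {V X : Type} [Fintype V] [DecidableEq V] (f : V → List X) (A : V)
    (l : List X) :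
    (∑ B, (Function.update f A l B).length) + (f A).length = (∑ B, (f B).length) + l.length := by
  have h := Finset.sum_update_of_mem (Finset.mem_univ A) (fun B => (f B).length) l.length
  have h2 := Finset.add_sum_erase Finset.univ (fun B => (f B).length) (Finset.mem_univ A)
  have h3 : ∀ B, (Function.update f A l B).length =
      Function.update (fun B => (f B).length) A l.length B := by
    intro B
    by_cases hB : B = A
    · subst hB; simp
    · simp [hB]
  simp only [h3, h]
  rw [Finset.sdiff_singleton_eq_erase]
  omega

section Potential

/-- The credit for trying one forward move. -/
def forwardCost (N : ℕ) : ℕ := 2 * N + 7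

/-- The credit for exploring an input of type 2, with at most `d` edges leaving it. -/
def typeTwoCost (N d : ℕ) : ℕ := N + 9 + d * forwardCost N

/-- The credit for the steps that a call of `exploreNode` takes by itself. -/
def enterCost (N : ℕ) : ℕ := N * (N + 5) + N + 6

/-- The credit for one same-layer rewiring. -/
def sameLayerCost (N d : ℕ) : ℕ := 3 * N + 11 + rematchTime N + typeTwoCost N d + enterCost N

/-- The credit for exploring an input of type 1. -/
def typeOneCost (N d : ℕ) : ℕ :=
  N + 8 + combineTime N + (d * forwardCost N + 1) + alternatingTime N + (N * sameLayerCost N d + 1)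

/-- The credit for a backward rewiring. -/
def backwardCost (N d : ℕ) : ℕ := 7 + releaseTime N + typeOneCost N d + enterCost N

variable {F V X Y : Type} [Field F] [DecidableEq F] [Fintype V] [Fintype X] [Fintype Y]
  {G : ADTNetwork F V X Y}

/-- The potential of the memory: the credit for all the exploration that can still take place in
the iteration.  Its decrease pays for the steps. -/
def potential (G : ADTNetwork F V X Y) (N d : ℕ) (eV : V → Bool) (eY ini : Y → Bool)
    (pend : ℕ → V → List X) : ℕ :=
  enterCost N * (Finset.univ.filter fun e : X × Y =>
      G.T e.1 e.2 ≠ 0 ∧ eV (G.nodeY e.2) = false).card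
    + backwardCost N d * (Finset.univ.filter fun y : Y => ini y = true ∧ eY y = false).card
    + typeOneCost N d * ∑ B, (pend 1 B).length + typeTwoCost N d * ∑ B, (pend 2 B).length

variable {N d : ℕ} {eV : V → Bool} {eY ini : Y → Bool} {pend : ℕ → V → List X}

theorem potential_exploreV_le [DecidableEq V] (A : V) :
    G.potential N d (Function.update eV A true) eY ini pend ≤ G.potential N d eV eY ini pend := by
  have h : (Finset.univ.filter fun e : X × Y => G.T e.1 e.2 ≠ 0 ∧
      Function.update eV A true (G.nodeY e.2) = false).card ≤
      (Finset.univ.filter fun e : X × Y => G.T e.1 e.2 ≠ 0 ∧ eV (G.nodeY e.2) = false).card := by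
    refine Finset.card_le_card fun e he => ?_
    simp only [Finset.mem_filter, Finset.mem_univ, true_and] at he ⊢
    refine ⟨he.1, ?_⟩
    by_cases hA : G.nodeY e.2 = A
    · have := he.2
      rw [hA, Function.update_self] at this
      simp at this
    · rw [← he.2, Function.update_of_ne hA]
  have h2 := Nat.mul_le_mul_left (enterCost N) h
  unfold potential
  omega

theorem potential_exploreV_add [DecidableEq V] {x : X} {y : Y} (hT : G.T x y ≠ 0)
    (hy : eV (G.nodeY y) = false) :
    G.potential N d (Function.update eV (G.nodeY y) true) eY ini pend + enterCost N ≤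
      G.potential N d eV eY ini pend := by
  have h : (Finset.univ.filter fun e : X × Y => G.T e.1 e.2 ≠ 0 ∧
      Function.update eV (G.nodeY y) true (G.nodeY e.2) = false).card + 1 ≤
      (Finset.univ.filter fun e : X × Y => G.T e.1 e.2 ≠ 0 ∧ eV (G.nodeY e.2) = false).card := by
    refine Finset.card_lt_card (Finset.ssubset_iff_of_subset ?_ |>.2 ⟨(x, y), ?_, ?_⟩)
    · intro e he
      simp only [Finset.mem_filter, Finset.mem_univ, true_and] at he ⊢
      refine ⟨he.1, ?_⟩
      by_cases hA : G.nodeY e.2 = G.nodeY y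
      · rw [hA]; exact hy
      · rw [← he.2, Function.update_of_ne hA]
    · simp [hT, hy]
    · simp
  have h2 := Nat.mul_le_mul_left (enterCost N) h
  unfold potential
  rw [Nat.mul_add, Nat.mul_one] at h2
  omega

theorem potential_exploreY [DecidableEq Y] {y : Y} (hi : ini y = true) (hy : eY y = false) :
    G.potential N d eV (Function.update eY y true) ini pend + backwardCost N d ≤
      G.potential N d eV eY ini pend := by
  have h : (Finset.univ.filter fun z : Y => ini z = true ∧
      Function.update eY y true z = false).card + 1 ≤
      (Finset.univ.filter fun z : Y => ini z = true ∧ eY z = false).card := by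
    refine Finset.card_lt_card (Finset.ssubset_iff_of_subset ?_ |>.2 ⟨y, ?_, ?_⟩)
    · intro z hz
      simp only [Finset.mem_filter, Finset.mem_univ, true_and] at hz ⊢
      refine ⟨hz.1, ?_⟩
      by_cases hA : z = y
      · rw [hA]; exact hy
      · rw [← hz.2, Function.update_of_ne hA]
    · simp [hi, hy]
    · simp
  have h2 := Nat.mul_le_mul_left (backwardCost N d) h
  unfold potential
  rw [Nat.mul_add, Nat.mul_one] at h2
  omega

theorem potential_push_one [DecidableEq V] (A : V) (x : X) :
    G.potential N d eV eY ini (Function.update pend 1 (Function.update (pend 1) A (x :: pend 1 A)))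
      = G.potential N d eV eY ini pend + typeOneCost N d := by
  have h := sum_update_length (pend 1) A (x :: pend 1 A)
  rw [List.length_cons] at h
  have h' : (∑ B, (Function.update (pend 1) A (x :: pend 1 A) B).length) =
    (∑ B, (pend 1 B).length) + 1 := by omega
  unfold potential
  rw [Function.update_self, Function.update_of_ne (by decide), h']
  ring

theorem potential_push_two [DecidableEq V] (A : V) (x : X) :
    G.potential N d eV eY ini (Function.update pend 2 (Function.update (pend 2) A (x :: pend 2 A)))
      = G.potential N d eV eY ini pend + typeTwoCost N d := by
  have h := sum_update_length (pend 2) A (x :: pend 2 A)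
  rw [List.length_cons] at h
  have h' : (∑ B, (Function.update (pend 2) A (x :: pend 2 A) B).length) =
    (∑ B, (pend 2 B).length) + 1 := by omega
  unfold potential
  rw [Function.update_self, Function.update_of_ne (by decide), h']
  ring

theorem potential_pop_one [DecidableEq V] {A : V} {x : X} {xs : List X}
    (hp : pend 1 A = x :: xs) :
    G.potential N d eV eY ini (Function.update pend 1 (Function.update (pend 1) A xs))
      + typeOneCost N d = G.potential N d eV eY ini pend := by
  have h := sum_update_length (pend 1) A xs
  rw [hp, List.length_cons] at h
  have h' : (∑ B, (Function.update (pend 1) A xs B).length) + 1 =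
    (∑ B, (pend 1 B).length) := by omega
  unfold potential
  rw [Function.update_self, Function.update_of_ne (by decide), ← h']
  ring

theorem potential_pop_two [DecidableEq V] {A : V} {x : X} {xs : List X}
    (hp : pend 2 A = x :: xs) :
    G.potential N d eV eY ini (Function.update pend 2 (Function.update (pend 2) A xs))
      + typeTwoCost N d = G.potential N d eV eY ini pend := by
  have h := sum_update_length (pend 2) A xs
  rw [hp, List.length_cons] at h
  have h' : (∑ B, (Function.update (pend 2) A xs B).length) + 1 =
    (∑ B, (pend 2 B).length) := by omega
  unfold potential
  rw [Function.update_self, Function.update_of_ne (by decide), ← h']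
  ring

end Potential

end ADTNetwork

namespace ADTNetwork

open UnicastProg

/-! ### The invariants of an iteration -/

section Invariants

variable {F V X Y : Type} [Field F]

/-- `Ω` contains all explored nodes and satisfies the assumptions `H`.  These assumptions say that
`Ω` is closed under the moves that are in progress, and are discharged when these have failed. -/
def Hyp (H : Set V → Prop) (eV : V → Bool) (Ω : Set V) : Prop :=
  (∀ B, eV B = true → B ∈ Ω) ∧ H Ω

/-- How the labels develop: the clock does not go back, explored nodes and outputs remain explored,
nodes without pending inputs of type 1 do not get any, and the nodes that become explored have no
such inputs and no unexplored initially used outputs. -/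
structure Progress (G : ADTNetwork F V X Y) (m m' : UnicastMemory F V X Y) : Prop where
  clock : m.clock ≤ m'.clock
  initial : m'.initial = m.initial
  exploredV : ∀ B, m.exploredV B = true → m'.exploredV B = true
  exploredY : ∀ y, m.exploredY y = true → m'.exploredY y = true
  pending : ∀ B, m.pending 1 B = [] → m'.pending 1 B = []
  finished : ∀ B, m'.exploredV B = true → m.exploredV B = true ∨ (m'.pending 1 B = [] ∧
    ∀ y, G.nodeY y = B → m'.initial y = true → m'.exploredY y = true)

/-- The relation `Progress` without its claims on the pending inputs of `A` and on the outputs of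
`A`, which fail while `A` is being explored. -/
structure ProgressExcept (G : ADTNetwork F V X Y) (A : V) (m m' : UnicastMemory F V X Y) :
    Prop where
  clock : m.clock ≤ m'.clock
  initial : m'.initial = m.initial
  exploredV : ∀ B, m.exploredV B = true → m'.exploredV B = true
  exploredY : ∀ y, m.exploredY y = true → m'.exploredY y = true
  pending : ∀ B, B ≠ A → m.pending 1 B = [] → m'.pending 1 B = []
  finished : ∀ B, B ≠ A → m'.exploredV B = true → m.exploredV B = true ∨ (m'.pending 1 B = [] ∧
    ∀ y, G.nodeY y = B → m'.initial y = true → m'.exploredY y = true)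

variable {G : ADTNetwork F V X Y} {U₀ : ℕ → List (X × Y)} {H H' : Set V → Prop}
  {m m₁ m' m'' m₂ : UnicastMemory F V X Y}

theorem Hyp.mono {eV eV' : V → Bool} {Ω : Set V} (h : Hyp H eV' Ω)
    (hV : ∀ B, eV B = true → eV' B = true) : Hyp H eV Ω := ⟨fun B hB => h.1 B (hV B hB), h.2⟩

theorem Progress.of_labels_eq (h0 : m.clock ≤ m'.clock) (h1 : m'.initial = m.initial)
    (h2 : m'.exploredV = m.exploredV) (h3 : m'.exploredY = m.exploredY)
    (h4 : ∀ B, m.pending 1 B = [] → m'.pending 1 B = []) :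
    G.Progress m m' :=
  ⟨h0, h1, by simp [h2], by simp [h3], h4, by rw [h2]; exact fun B hB => Or.inl hB⟩

theorem Progress.trans (h : G.Progress m m') (h' : G.Progress m' m'') : G.Progress m m'' := by
  refine ⟨h.clock.trans h'.clock, h'.initial.trans h.initial,
    fun B hB => h'.exploredV B (h.exploredV B hB),
    fun y hy => h'.exploredY y (h.exploredY y hy), fun B hB => h'.pending B (h.pending B hB), ?_⟩
  intro B hB
  rcases h'.finished B hB with h1 | h1
  · rcases h.finished B h1 with h2 | ⟨h2, h3⟩
    · exact Or.inl h2
    · exact Or.inr ⟨h'.pending B h2, fun y hy hi => h'.exploredY y (h3 y hy (h'.initial ▸ hi))⟩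
  · exact Or.inr h1

theorem Progress.before (h : G.Progress m' m'') (h0 : m.clock ≤ m'.clock)
    (h1 : m'.initial = m.initial) (h2 : m'.exploredV = m.exploredV)
    (h3 : m'.exploredY = m.exploredY) (h4 : ∀ B, m.pending 1 B = [] → m'.pending 1 B = []) :
    G.Progress m m'' := (Progress.of_labels_eq h0 h1 h2 h3 h4).trans h

theorem Progress.after (h : G.Progress m m') (h0 : m'.clock ≤ m''.clock)
    (h1 : m''.initial = m'.initial) (h2 : m''.exploredV = m'.exploredV)
    (h3 : m''.exploredY = m'.exploredY) (h4 : ∀ B, m'.pending 1 B = [] → m''.pending 1 B = []) :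
    G.Progress m m'' := h.trans (Progress.of_labels_eq h0 h1 h2 h3 h4)

theorem ProgressExcept.trans {A : V} (h : G.ProgressExcept A m m') (h' : G.Progress m' m'') :
    G.ProgressExcept A m m'' := by
  refine ⟨h.clock.trans h'.clock, h'.initial.trans h.initial,
    fun B hB => h'.exploredV B (h.exploredV B hB), fun y hy => h'.exploredY y (h.exploredY y hy),
    fun B hA hB => h'.pending B (h.pending B hA hB), ?_⟩
  intro B hA hB
  rcases h'.finished B hB with h1 | h1
  · rcases h.finished B hA h1 with h2 | ⟨h2, h3⟩
    · exact Or.inl h2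
    · exact Or.inr ⟨h'.pending B h2, fun y hy hi => h'.exploredY y (h3 y hy (h'.initial ▸ hi))⟩
  · exact Or.inr h1

theorem ProgressExcept.progress {A : V} (h : G.ProgressExcept A m m') (h1 : m'.pending 1 A = [])
    (h2 : ∀ y, G.nodeY y = A → m'.initial y = true → m'.exploredY y = true) : G.Progress m m' := by
  refine ⟨h.clock, h.initial, h.exploredV, h.exploredY, fun B hB => ?_, fun B hB => ?_⟩
  · by_cases hA : B = A
    · rw [hA, h1]
    · exact h.pending B hA hB
  · by_cases hA : B = A
    · rw [hA]; exact Or.inr ⟨h1, h2⟩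
    · exact h.finished B hA hB

variable [Fintype X]

/-- The meaning of the labels, where `U₀` are the used edges at the beginning of the iteration:
every set `Ω` that contains the explored nodes and satisfies the assumptions `H` is closed with
respect to `U₀` for the explored outputs used initially (`closed`) and for all its inputs (`row`),
except for those that are pending with type 1. -/
structure Labels (G : ADTNetwork F V X Y) (U₀ : ℕ → List (X × Y)) (H : Set V → Prop)
    (m : UnicastMemory F V X Y) : Prop where
  transfers : ∀ Ω, Hyp H m.exploredV Ω → ∀ l, G.Transfers Ω (U₀ l) (m.used l)
  row : ∀ x, (x ∈ m.pending 1 (G.nodeX x) ∧ m.exploredX x = false ∧ m.type x = 1) ∨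
    ∀ Ω, Hyp H m.exploredV Ω → G.nodeX x ∈ Ω → G.RowIn Ω (U₀ (G.layer (G.nodeX x))) x
  closed : ∀ y, m.initial y = true → m.exploredY y = true → m.exploredV (G.nodeY y) = true ∧
    ∀ Ω, Hyp H m.exploredV Ω → G.YClosed Ω (U₀ (G.layer (G.nodeY y) - 1)) y
  kept : ∀ y, m.initial y = true → m.exploredY y = false →
    y ∈ (m.used (G.layer (G.nodeY y) - 1)).map Prod.snd
  initial : ∀ y, m.initial y = true ↔ y ∈ (U₀ (G.layer (G.nodeY y) - 1)).map Prod.snd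
  node : ∀ t B x, x ∈ m.pending t B → G.nodeX x = B
  dest : m.exploredV G.D = false

/-- The assumptions may be strengthened. -/
theorem Labels.strengthen (h : G.Labels U₀ H m) (hH : ∀ Ω, H' Ω → H Ω) : G.Labels U₀ H' m := by
  have hH' : ∀ Ω, Hyp H' m.exploredV Ω → Hyp H m.exploredV Ω := fun Ω hΩ => ⟨hΩ.1, hH Ω hΩ.2⟩
  exact ⟨fun Ω hΩ => h.transfers Ω (hH' Ω hΩ),
    fun x => (h.row x).imp id fun h1 Ω hΩ => h1 Ω (hH' Ω hΩ),
    fun y hi hy => ⟨(h.closed y hi hy).1, fun Ω hΩ => (h.closed y hi hy).2 Ω (hH' Ω hΩ)⟩,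
    h.kept, h.initial, h.node, h.dest⟩

/-- Assumptions may be discharged if they hold for all sets that contain the explored nodes. -/
theorem Labels.discharge (h : G.Labels U₀ H' m)
    (hH : ∀ Ω, Hyp H m.exploredV Ω → H' Ω) : G.Labels U₀ H m := by
  have hH' : ∀ Ω, Hyp H m.exploredV Ω → Hyp H' m.exploredV Ω := fun Ω hΩ => ⟨hΩ.1, hH Ω hΩ⟩
  exact ⟨fun Ω hΩ => h.transfers Ω (hH' Ω hΩ),
    fun x => (h.row x).imp id fun h1 Ω hΩ => h1 Ω (hH' Ω hΩ),
    fun y hi hy => ⟨(h.closed y hi hy).1, fun Ω hΩ => (h.closed y hi hy).2 Ω (hH' Ω hΩ)⟩,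
    h.kept, h.initial, h.node, h.dest⟩

/-- A change of the labels, the types and the pending lists of inputs. -/
theorem Labels.change_inputs (h : G.Labels U₀ H m) (hu : m'.used = m.used)
    (hV : m'.exploredV = m.exploredV) (hY : m'.exploredY = m.exploredY)
    (hi : m'.initial = m.initial) (hn : ∀ t B x, x ∈ m'.pending t B → G.nodeX x = B)
    (hrow : ∀ x, (x ∈ m.pending 1 (G.nodeX x) ∧ m.exploredX x = false ∧ m.type x = 1) →
      (x ∈ m'.pending 1 (G.nodeX x) ∧ m'.exploredX x = false ∧ m'.type x = 1) ∨
      ∀ Ω, Hyp H m.exploredV Ω → G.nodeX x ∈ Ω → G.RowIn Ω (U₀ (G.layer (G.nodeX x))) x) :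
    G.Labels U₀ H m' := by
  refine ⟨?_, ?_, ?_, ?_, ?_, hn, ?_⟩
  · rw [hV, hu]; exact h.transfers
  · intro x
    rw [hV]
    rcases h.row x with h1 | h1
    · exact hrow x h1
    · exact Or.inr h1
  · rw [hV, hY, hi]; exact h.closed
  · rw [hY, hi, hu]; exact h.kept
  · rw [hi]; exact h.initial
  · rw [hV]; exact h.dest

theorem Labels.congr (h : G.Labels U₀ H m) (hu : m'.used = m.used)
    (hV : m'.exploredV = m.exploredV) (hX : m'.exploredX = m.exploredX)
    (hY : m'.exploredY = m.exploredY) (ht : m'.type = m.type)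
    (hi : m'.initial = m.initial) (hp : m'.pending = m.pending) : G.Labels U₀ H m' :=
  h.change_inputs hu hV hY hi (by rw [hp]; exact h.node)
    (by rw [hp, hX, ht]; exact fun x hx => Or.inl hx)

/-- A node becomes explored. -/
theorem Labels.explore [DecidableEq V] (h : G.Labels U₀ H m) {A : V} (hA : A ≠ G.D) :
    G.Labels U₀ H { m with
      exploredV := Function.update m.exploredV A true, clock := m.clock + 1 } := by
  have hV : ∀ B, m.exploredV B = true → Function.update m.exploredV A true B = true := by
    intro B hB
    by_cases hBA : B = A
    · rw [hBA, Function.update_self]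
    · rwa [Function.update_of_ne hBA]
  exact ⟨fun Ω hΩ => h.transfers Ω (hΩ.mono hV),
    fun x => (h.row x).imp id fun h1 Ω hΩ => h1 Ω (hΩ.mono hV),
    fun y hi hy => ⟨hV _ (h.closed y hi hy).1, fun Ω hΩ => (h.closed y hi hy).2 Ω (hΩ.mono hV)⟩,
    h.kept, h.initial, h.node, by simpa [Function.update_of_ne hA.symm] using h.dest⟩

/-- The used edges change. -/
theorem Labels.change_used (h : G.Labels U₀ H m) (hV : m'.exploredV = m.exploredV)
    (hX : m'.exploredX = m.exploredX) (hY : m'.exploredY = m.exploredY) (ht : m'.type = m.type)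
    (hi : m'.initial = m.initial) (hp : m'.pending = m.pending)
    (htr : ∀ Ω, Hyp H m.exploredV Ω → ∀ l, G.Transfers Ω (U₀ l) (m'.used l))
    (hk : ∀ y, m.initial y = true → m.exploredY y = false →
      y ∈ (m'.used (G.layer (G.nodeY y) - 1)).map Prod.snd) : G.Labels U₀ H m' := by
  refine ⟨?_, ?_, ?_, ?_, ?_, ?_, ?_⟩
  · rw [hV]; exact htr
  · rw [hV, hX, ht, hp]; exact h.row
  · rw [hV, hY, hi]; exact h.closed
  · rw [hY, hi]; exact hk
  · rw [hi]; exact h.initial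
  · rw [hp]; exact h.node
  · rw [hV]; exact h.dest

/-- Used inputs are accounted for. -/
theorem Labels.row_of_used (h : G.Labels U₀ H m) {x : X}
    (hx : x ∈ (m.used (G.layer (G.nodeX x))).map Prod.fst) (Ω : Set V)
    (hΩ : Hyp H m.exploredV Ω) (hxΩ : G.nodeX x ∈ Ω) :
    G.RowIn Ω (U₀ (G.layer (G.nodeX x))) x := by
  classical
  exact (h.transfers Ω hΩ _).row x (RowIn.of_mem hx hxΩ)

/-- A pending input that is passed over, because it is used or explored or of type 2, is accounted
for. -/
theorem Labels.row_of_not_open [DecidableEq X] (h : G.Labels U₀ H m) {x : X}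
    (hx : ¬G.openValue m x 1 = true) (Ω : Set V)
    (hΩ : Hyp H m.exploredV Ω) (hxΩ : G.nodeX x ∈ Ω) :
    G.RowIn Ω (U₀ (G.layer (G.nodeX x))) x := by
  rw [openValue_eq_true] at hx
  by_cases hu : x ∈ (m.used (G.layer (G.nodeX x))).map Prod.fst
  · exact h.row_of_used hu Ω hΩ hxΩ
  · rcases h.row x with h1 | h1
    · exact absurd ⟨hu, h1.2⟩ hx
    · exact h1 Ω hΩ hxΩ

/-- An output of an unexplored node that is not used now was not used initially. -/
theorem Labels.notMem_initial (h : G.Labels U₀ H m) {y : Y}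
    (hV : m.exploredV (G.nodeY y) = false)
    (hy : y ∉ (m.used (G.layer (G.nodeY y) - 1)).map Prod.snd) :
    y ∉ (U₀ (G.layer (G.nodeY y) - 1)).map Prod.snd := by
  intro h0
  have hi := (h.initial y).2 h0
  cases he : m.exploredY y with
  | false => exact hy (h.kept y hi he)
  | true => have := (h.closed y hi he).1; rw [hV] at this; simp at this

/-- What holds after a failed attempt. -/
structure Failure (G : ADTNetwork F V X Y) (U₀ : ℕ → List (X × Y)) (H : Set V → Prop)
    (m m' : UnicastMemory F V X Y) : Prop where
  used : m'.used = m.used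
  progress : G.Progress m m'
  pending_two : ∀ B, m'.pending 2 B = []
  labels : G.Labels U₀ H m'

theorem Failure.of_progress (hp : G.Progress m m₁) (hu : m₁.used = m.used)
    (h : G.Failure U₀ H m₁ m') : G.Failure U₀ H m m' :=
  ⟨h.used.trans hu, hp.trans h.progress, h.pending_two, h.labels⟩

/-- Restoring the used edges after a failed attempt. -/
theorem Labels.restore (h : G.Labels U₀ H m) (h' : G.Labels U₀ H m') (hp : G.Progress m m')
    (hu : m₂.used = m.used) (hV : m₂.exploredV = m'.exploredV)
    (hX : m₂.exploredX = m'.exploredX) (hY : m₂.exploredY = m'.exploredY)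
    (ht : m₂.type = m'.type) (hi : m₂.initial = m'.initial) (hq : m₂.pending = m'.pending) :
    G.Labels U₀ H m₂ := by
  refine h'.change_used hV hX hY ht hi hq (fun Ω hΩ l => ?_) fun y hy he => ?_
  · rw [hu]
    exact h.transfers Ω (hΩ.mono hp.exploredV) l
  · rw [hu]
    refine h.kept y (hp.initial ▸ hy) ?_
    cases hm : m.exploredY y with
    | false => rfl
    | true => rw [hp.exploredY y hm] at he; simp at he

variable [DecidableEq V]

/-- What holds when the destination has been reached. -/
structure Success (G : ADTNetwork F V X Y) (k : ℕ) (m m' : UnicastMemory F V X Y) : Prop where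
  flow : G.Excess (k + 1) G.S m'.used
  initial : m'.initial = m.initial
  node : ∀ t B x, x ∈ m'.pending t B → G.nodeX x = B
  dest : m'.exploredV G.D = false

variable {k : ℕ}

theorem Success.of_initial (hi : m''.initial = m.initial) (h : G.Success k m'' m') :
    G.Success k m m' := ⟨h.flow, h.initial.trans hi, h.node, h.dest⟩

end Invariants

/-! ### Specifications of the recursive functions -/

section Specification

variable {F V X Y : Type} [Field F] [DecidableEq F] [Fintype V] [DecidableEq V] [Fintype X]
  [DecidableEq X] [Fintype Y] [DecidableEq Y]

/-- The number of steps so far, plus the potential. -/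
def totalCost (G : ADTNetwork F V X Y) (N d : ℕ) (m : UnicastMemory F V X Y) : ℕ :=
  m.clock + G.potential N d m.exploredV m.exploredY m.initial m.pending

/-- The postcondition of a recursive function: its total cost is at most `c`, and either the
destination has been reached, or the attempt has failed and `R` holds in addition. -/
def Post (G : ADTNetwork F V X Y) (k d : ℕ) (U₀ : ℕ → List (X × Y)) (H : Set V → Prop)
    (m : UnicastMemory F V X Y) (c : ℕ) (R : UnicastMemory F V X Y → Prop) (r : Bool)
    (m' : UnicastMemory F V X Y) : Prop :=
  G.totalCost (k + 1) d m' ≤ c ∧ (r = true → G.Success k m m') ∧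
    (r = false → G.Failure U₀ H m m' ∧ R m')

/-- The list `Λ` represents the row of `x` on the used outputs. -/
structure Represents (G : ADTNetwork F V X Y) (U : List (X × Y)) (x : X) (Λ : List (X × F)) :
    Prop where
  mem : ∀ u, coeffs Λ u ≠ 0 → u ∈ U.map Prod.fst
  eq : ∀ v ∈ U.map Prod.snd, Matrix.vecMul (coeffs Λ) G.T v = G.T x v

/-- Every forward move from `x` to an output in `ys` leads to an explored node. -/
def ForwardDone (G : ADTNetwork F V X Y) (U : List (X × Y)) (x : X) (Λ : List (X × F))
    (ys : List Y) (eV : V → Bool) : Prop :=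
  ∀ v ∈ ys, v ∉ U.map Prod.snd →
    eV (G.nodeY v) = true ∨ Matrix.vecMul (coeffs Λ) G.T v = G.T x v

/-- The state of the pending inputs of type 2 when `exploreNode` is called for `A`: there are none,
or exactly one, which has just been given up in a same-layer rewiring. -/
def PendingTwo (G : ADTNetwork F V X Y) (k : ℕ) (H : Set V → Prop) (A : V)
    (m : UnicastMemory F V X Y) : Prop :=
  (∀ B, B ≠ A → m.pending 2 B = []) ∧ (m.pending 2 A = [] ∨ ∃ x, m.pending 2 A = [x] ∧
    G.nodeX x = A ∧ x ∉ (m.used (G.layer A)).map Prod.fst ∧ m.exploredX x = false ∧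
    m.type x = 2 ∧ (m.lam x).length ≤ k + 1 ∧ G.Represents (m.used (G.layer A)) x (m.lam x) ∧
    ∀ Ω, Hyp H m.exploredV Ω → G.XClosed Ω (m.used (G.layer A)) x)

/-- After exploring the pending input `x` of type 2 of `A`, its forward moves are done. -/
def TwoDone (G : ADTNetwork F V X Y) (I : G.Listing) (A : V) (m m' : UnicastMemory F V X Y) :
    Prop :=
  ∀ x, m.pending 2 A = [x] →
    G.ForwardDone (m.used (G.layer A)) x (m.lam x) (I.succ x) m'.exploredV

/-- If the first pending input `x` of type 1 of `A` was open, the set of explored nodes is closed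
under the moves from `x`. -/
def HeadClosed (G : ADTNetwork F V X Y) (A : V) (m m' : UnicastMemory F V X Y) : Prop :=
  ∀ x xs, m.pending 1 A = x :: xs → G.openValue m x 1 = true →
    ∀ Ω : Set V, (∀ B, m'.exploredV B = true → B ∈ Ω) → G.XClosed Ω (m.used (G.layer A)) x

/-- The specification of `exploreNode`, for calls with a total credit of at most `n`. -/
def NodeSpec (G : ADTNetwork F V X Y) (I : G.Listing) (k d : ℕ) (U₀ : ℕ → List (X × Y))
    (n : ℕ) : Prop :=
  ∀ (H : Set V → Prop) (A : V) (m : UnicastMemory F V X Y),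
  G.Excess k A m.used → G.Labels U₀ H m → A ≠ G.D → G.PendingTwo k H A m →
  G.potential (k + 1) d (Function.update m.exploredV A true) m.exploredY m.initial m.pending
    + enterCost (k + 1) ≤ n →
  Runs (exploreNode I A) m (G.Post k d U₀ H m (m.clock + G.potential (k + 1) d
    (Function.update m.exploredV A true) m.exploredY m.initial m.pending + enterCost (k + 1))
    fun m' => m'.exploredV A = true ∧ m'.pending 1 A = [] ∧
      (∀ y, G.nodeY y = A → m'.initial y = true → m'.exploredY y = true) ∧
      G.TwoDone I A m m' ∧ (m.pending 2 A = [] → G.HeadClosed A m m'))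

/-- The specification of `exploreType₂`, for calls with a total credit of at most `n`. -/
def TypeTwoSpec (G : ADTNetwork F V X Y) (I : G.Listing) (k d : ℕ) (U₀ : ℕ → List (X × Y))
    (n : ℕ) : Prop :=
  ∀ (H : Set V → Prop) (A : V) (m : UnicastMemory F V X Y),
  G.Excess k A m.used → G.Labels U₀ H m → m.exploredV A = true → G.PendingTwo k H A m →
  G.potential (k + 1) d m.exploredV m.exploredY m.initial m.pending + 1 ≤ n →
  Runs (exploreType₂ I A) m (G.Post k d U₀ H m (G.totalCost (k + 1) d m + 1)
    fun m' => G.TwoDone I A m m' ∧ (m.pending 2 A = [] →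
      m'.pending = m.pending ∧ m'.exploredX = m.exploredX ∧ m'.type = m.type))

/-- The specification of `exploreType₁`, for calls with a total credit of at most `n`. -/
def TypeOneSpec (G : ADTNetwork F V X Y) (I : G.Listing) (k d : ℕ) (U₀ : ℕ → List (X × Y))
    (n : ℕ) : Prop :=
  ∀ (H : Set V → Prop) (A : V) (m : UnicastMemory F V X Y),
  G.Excess k A m.used → G.Labels U₀ H m → m.exploredV A = true → (∀ B, m.pending 2 B = []) →
  G.potential (k + 1) d m.exploredV m.exploredY m.initial m.pending + 1 ≤ n →
  Runs (exploreType₁ I A) m (G.Post k d U₀ H m (G.totalCost (k + 1) d m + 1)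
    fun m' => m'.pending 1 A = [] ∧ G.HeadClosed A m m')

/-- The specification of `forward`, for calls with a total credit of at most `n`. -/
def ForwardSpec (G : ADTNetwork F V X Y) (I : G.Listing) (k d : ℕ) (U₀ : ℕ → List (X × Y))
    (n : ℕ) : Prop :=
  ∀ (H : Set V → Prop) (x : X) (Λ : List (X × F)) (ys : List Y)
  (m : UnicastMemory F V X Y),
  G.Excess k (G.nodeX x) m.used → G.Labels U₀ H m → m.exploredV (G.nodeX x) = true →
  (∀ B, m.pending 2 B = []) → x ∉ (m.used (G.layer (G.nodeX x))).map Prod.fst →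
  Λ.length ≤ k + 1 → G.Represents (m.used (G.layer (G.nodeX x))) x Λ →
  (∀ Ω, Hyp H m.exploredV Ω → G.XClosed Ω (m.used (G.layer (G.nodeX x))) x) →
  (∀ y ∈ ys, G.T x y ≠ 0) →
  G.potential (k + 1) d m.exploredV m.exploredY m.initial m.pending
    + (ys.length * forwardCost (k + 1) + 1) ≤ n →
  Runs (forward I x Λ ys) m (G.Post k d U₀ H m
    (G.totalCost (k + 1) d m + (ys.length * forwardCost (k + 1) + 1))
    fun m' => G.ForwardDone (m.used (G.layer (G.nodeX x))) x Λ ys m'.exploredV)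

/-- The specification of `sameLayer`, for calls with a total credit of at most `n`.  The forward
moves from the inputs `t.1` that are given up take place with used edges in which `x` replaces
`t.1`.  The condition for such a move to an output `v` is equivalent to that for `x` and `v`, and
the conclusion is stated in terms of `x`. -/
def SameLayerSpec (G : ADTNetwork F V X Y) (I : G.Listing) (k d : ℕ) (U₀ : ℕ → List (X × Y))
    (n : ℕ) : Prop :=
  ∀ (H : Set V → Prop) (x : X) (Λ Λ' : List (X × F)) (paths : List (Reached X Y))
    (m : UnicastMemory F V X Y),
    paths = (G.alternatingPaths x (m.used (G.layer (G.nodeX x)))).val →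
  G.Excess k (G.nodeX x) m.used → G.Labels U₀ H m → m.exploredV (G.nodeX x) = true →
  (∀ B, m.pending 2 B = []) → x ∉ (m.used (G.layer (G.nodeX x))).map Prod.fst →
  G.IsCombination (m.used (G.layer (G.nodeX x))) (G.T x) Λ → Λ' ⊆ Λ →
  (∀ Ω, Hyp H m.exploredV Ω → G.XClosed Ω (m.used (G.layer (G.nodeX x))) x) →
  G.potential (k + 1) d m.exploredV m.exploredY m.initial m.pending
    + (Λ'.length * sameLayerCost (k + 1) d + 1) ≤ n →
  Runs (sameLayer I x Λ paths Λ') m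
    (G.Post k d U₀ H m
      (G.totalCost (k + 1) d m + (Λ'.length * sameLayerCost (k + 1) d + 1))
      fun m' => ∀ t ∈ Λ', m'.exploredV (G.nodeX t.1) = true ∧
        ∀ v ∈ I.succ t.1, v ∉ (m.used (G.layer (G.nodeX x))).map Prod.snd →
          m'.exploredV (G.nodeY v) = true ∨ Matrix.vecMul (coeffs Λ) G.T v = G.T x v)

/-- The specification of `backward`, for calls with a total credit of at most `n`. -/
def BackwardSpec (G : ADTNetwork F V X Y) (I : G.Listing) (k d : ℕ) (U₀ : ℕ → List (X × Y))
    (n : ℕ) : Prop :=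
  ∀ (H : Set V → Prop) (A : V) (es : List (X × Y)) (m : UnicastMemory F V X Y),
  G.Excess k A m.used → G.Labels U₀ H m → m.exploredV A = true → (∀ B, m.pending 2 B = []) →
  (∀ e ∈ es, e ∈ m.used (G.layer A - 1) ∧ G.nodeY e.2 = A) →
  G.potential (k + 1) d m.exploredV m.exploredY m.initial m.pending
    + (es.length * (k + 6) + 1) ≤ n →
  Runs (backward I A es) m (G.Post k d U₀ H m
    (G.totalCost (k + 1) d m + (es.length * (k + 6) + 1))
    fun m' => ∀ e ∈ es, m'.initial e.2 = true → m'.exploredY e.2 = true)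

/-- The specifications of the six recursive functions, for calls with a total credit of at
most `n`. -/
structure Specification (G : ADTNetwork F V X Y) (I : G.Listing) (k d : ℕ)
    (U₀ : ℕ → List (X × Y)) (n : ℕ) : Prop where
  node : G.NodeSpec I k d U₀ n
  typeTwo : G.TypeTwoSpec I k d U₀ n
  typeOne : G.TypeOneSpec I k d U₀ n
  forward : G.ForwardSpec I k d U₀ n
  sameLayer : G.SameLayerSpec I k d U₀ n
  backward : G.BackwardSpec I k d U₀ n

set_option linter.unusedSectionVars false

variable {G : ADTNetwork F V X Y} {U₀ : ℕ → List (X × Y)} {H H' : Set V → Prop}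
  {m m₁ m' : UnicastMemory F V X Y} {k d : ℕ}

/-- Steps before a call. -/
theorem Post.of_progress {c c₁ : ℕ} {R R₁ : UnicastMemory F V X Y → Prop} {r : Bool}
    (h : G.Post k d U₀ H m₁ c₁ R₁ r m') (hp : G.Progress m m₁) (hu : m₁.used = m.used)
    (hc : c₁ ≤ c) (hR : G.Failure U₀ H m₁ m' → R₁ m' → R m') : G.Post k d U₀ H m c R r m' :=
  ⟨h.1.trans hc, fun hr => (h.2.1 hr).of_initial hp.initial,
    fun hr => ⟨(h.2.2 hr).1.of_progress hp hu, hR (h.2.2 hr).1 (h.2.2 hr).2⟩⟩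

theorem Post.success {c c₁ : ℕ} {R R₁ : UnicastMemory F V X Y → Prop}
    (h : G.Post k d U₀ H' m₁ c₁ R₁ true m') (hi : m₁.initial = m.initial) (hc : c₁ ≤ c) :
    G.Post k d U₀ H m c R true m' :=
  ⟨h.1.trans hc, fun hr => (h.2.1 hr).of_initial hi, fun hr => by simp at hr⟩

end Specification

end ADTNetwork

/-! ### Forward moves -/

namespace ADTNetwork

open UnicastProg

section Forward

variable {F V X Y : Type} [Field F] [DecidableEq F] [Fintype V] [DecidableEq V] [Fintype X]
  [DecidableEq X] [Fintype Y] [DecidableEq Y] {G : ADTNetwork F V X Y} {I : G.Listing}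
  {k d : ℕ} {U₀ : ℕ → List (X × Y)} {n : ℕ}

/-- A forward move to the output `y` is paid for by the edge from `x` to the node of `y`, which
becomes explored. The change of the used edges transfers closure, since the closure under the moves
from `x` is among the assumptions. -/
theorem forwardSpec (IH : ∀ n' < n, G.Specification I k d U₀ n') : G.ForwardSpec I k d U₀ n := by
  intro H x Λ ys m hE hL hA h2 hx hΛl hΛ hX hys hn
  rw [ADTNetwork.forward.eq_def]
  simp only [runs_bind, runs_step]
  cases ys with
  | nil =>
    simp only [runs_pure]
    refine ⟨?_, fun h => by simp at h, fun _ => ⟨⟨rfl, Progress.of_labels_eq (by simp)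
      rfl rfl rfl fun _ h => h, h2, hL.congr rfl rfl rfl rfl rfl rfl rfl⟩, by simp [ForwardDone]⟩⟩
    simp only [totalCost]
    omega
  | cons y ys =>
    simp only [runs_bind, runs_look, runs_call, Timed.any_val]
    set l := G.layer (G.nodeX x) with hl
    have hany := Timed.any_time (fun e : X × Y => decide (e.2 = y)) (m.used l)
    have hUl := hE.length_layer_le
    rw [← hl] at hUl
    have hTy : G.T x y ≠ 0 := hys y (by simp)
    have hly : G.layer (G.nodeY y) = l + 1 := G.layer_edge x y hTy
    rw [List.length_cons, Nat.add_mul, Nat.one_mul] at hn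
    have hfc : forwardCost (k + 1) = 2 * k + 9 := by unfold forwardCost; omega
    -- the remaining outputs, when `y` has been dealt with
    have hrest : ∀ m₁ : UnicastMemory F V X Y, m₁.used = m.used → G.Progress m m₁ →
        (∀ B, m₁.pending 2 B = []) → G.Labels U₀ H m₁ →
        G.totalCost (k + 1) d m₁ ≤ G.totalCost (k + 1) d m + forwardCost (k + 1) →
        m.clock < m₁.clock →
        (y ∈ (m.used l).map Prod.snd ∨ m₁.exploredV (G.nodeY y) = true ∨
          Matrix.vecMul (coeffs Λ) G.T y = G.T x y) →
        Runs (forward I x Λ ys) m₁ (G.Post k d U₀ H m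
          (G.totalCost (k + 1) d m + ((ys.length + 1) * forwardCost (k + 1) + 1))
          fun m' => G.ForwardDone (m.used l) x Λ (y :: ys) m'.exploredV) := by
      intro m₁ hu hp h2' hL' hc hclock hy
      simp only [totalCost] at hc
      refine ((IH _ ?_).forward H x Λ ys m₁ (hu ▸ hE) hL' (hp.exploredV _ hA) h2'
        (by rwa [hu]) hΛl (by rwa [hu]) (fun Ω hΩ => hu ▸ hX Ω (hΩ.mono hp.exploredV))
        (fun z hz => hys z (by simp [hz])) le_rfl).mono fun r m' hpost => ?_
      · omega
      · refine hpost.of_progress hp hu ?_ ?_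
        · rw [Nat.add_mul, Nat.one_mul]
          simp only [totalCost]
          omega
        · intro hf hd v hv hvU
          rcases List.mem_cons.1 hv with rfl | hv
          · rcases hy with h | h | h
            · exact absurd h hvU
            · exact Or.inl (hf.progress.exploredV _ h)
            · exact Or.inr h
          · rw [hu] at hd
            exact hd v hv hvU
    by_cases hskip : (((m.used l).any fun e => decide (e.2 = y)) || m.exploredV (G.nodeY y)) = true
    · rw [if_pos hskip]
      -- `y` is used, or its node is explored
      refine hrest _ rfl (Progress.of_labels_eq (by simp only; omega) rfl rfl rfl fun _ h => h) h2
        (hL.congr rfl rfl rfl rfl rfl rfl rfl) ?_ ?_ ?_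
      · simp only [totalCost]; omega
      · simp only; omega
      · rcases Bool.or_eq_true_iff.1 hskip with h | h
        · left
          obtain ⟨e, he, hey⟩ := List.any_eq_true.1 h
          exact List.mem_map.2 ⟨e, he, by simpa using hey⟩
        · exact Or.inr (Or.inl h)
    · rw [if_neg hskip]
      simp only [runs_bind, runs_call]
      rw [combination_val]
      have hct := G.combination_time y Λ
      simp only [Bool.or_eq_true, not_or, Bool.not_eq_true, List.any_eq_false,
        decide_eq_true_eq] at hskip
      obtain ⟨hyU, hyV⟩ := hskip
      have hyU : y ∉ (m.used l).map Prod.snd := by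
        intro h
        obtain ⟨e, he, hey⟩ := List.mem_map.1 h
        exact hyU e he hey
      by_cases hne : G.T x y ≠ Matrix.vecMul (coeffs Λ) G.T y
      · rw [if_pos hne]
        simp only [setUsed, runs_bind, runs_write]
        have hcut := hE.cut l
        have hE' := hE.forward rfl hTy hx hyU
          (hcut.indep.cons hx hΛ.mem hΛ.eq (Ne.symm hne))
        rw [← hl] at hE'
        by_cases hD : G.nodeY y = G.D
        · -- the destination is reached
          rw [if_pos hD, runs_pure]
          rw [hD] at hE'
          refine ⟨?_, fun _ => ⟨hE'.complete, rfl, hL.node, hL.dest⟩, fun h => by simp at h⟩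
          rw [List.length_cons, Nat.add_mul, Nat.one_mul]
          simp only [totalCost]
          omega
        · rw [if_neg hD]
          simp only [runs_bind]
          have hpot := potential_exploreV_add (N := k + 1) (d := d) (eV := m.exploredV)
            (eY := m.exploredY) (ini := m.initial) (pend := m.pending) hTy hyV
          have hyU₀ : y ∉ (U₀ l).map Prod.snd := by
            have := hL.notMem_initial hyV (by rwa [hly, Nat.add_sub_cancel])
            rwa [hly, Nat.add_sub_cancel] at this
          refine Runs.mono ((IH _ ?_).node H (G.nodeY y) _ hE' ?_ hD
            ⟨fun B _ => h2 B, Or.inl (h2 _)⟩ le_rfl) fun r m' hpost => ?_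
          · simp only
            omega
          · refine hL.change_used rfl rfl rfl rfl rfl rfl (fun Ω hΩ l' => ?_) fun z hz hze => ?_
            · by_cases hll : l' = l
              · subst hll
                simp only [Function.update_self]
                refine (hL.transfers Ω hΩ l).of_xClosed (hX Ω hΩ) (by simp)
                  (List.subset_cons_self _ _) fun z hz hz' => ?_
                rcases List.mem_cons.1 hz' with rfl | hz'
                · exact absurd hz hyU₀
                · exact hz'
              · simp only [Function.update_of_ne hll]
                exact hL.transfers Ω hΩ l'
            · have := hL.kept z hz hze
              by_cases hll : G.layer (G.nodeY z) - 1 = l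
              · rw [hll] at this ⊢
                simp only [Function.update_self]
                exact List.mem_cons_of_mem _ this
              · simp only [Function.update_of_ne hll]
                exact this
          · cases r with
            | true =>
              rw [if_pos rfl, runs_pure]
              refine hpost.success rfl ?_
              rw [List.length_cons, Nat.add_mul, Nat.one_mul]
              simp only [totalCost]
              omega
            | false =>
              obtain ⟨hf, hfy, -⟩ := hpost.2.2 rfl
              simp only [Bool.false_eq_true, if_false, runs_bind, runs_write]
              have hused : Function.update m'.used l (m.used l) = m.used := by
                rw [hf.used]
                simp
              have hp : G.Progress m m' :=
                hf.progress.before (by simp only; omega) rfl rfl rfl fun _ h => h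
              have hclock := hf.progress.clock
              have hcost := hpost.1
              simp only [totalCost] at hcost
              refine hrest _ hused (hp.after (by simp) rfl rfl rfl fun _ h => h) hf.pending_two
                (hL.restore hf.labels hp hused rfl rfl rfl rfl rfl rfl) ?_ ?_ (Or.inr (Or.inl hfy))
              · simp only [totalCost]
                omega
              · simp only at hclock ⊢
                omega
      · rw [if_neg hne]
        rw [not_ne_iff] at hne
        refine hrest _ rfl (Progress.of_labels_eq (by simp only; omega) rfl rfl rfl fun _ h => h) h2
          (hL.congr rfl rfl rfl rfl rfl rfl rfl) ?_ ?_ (Or.inr (Or.inr hne.symm))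
        · simp only [totalCost]; omega
        · simp only; omega

end Forward

end ADTNetwork

/-! ### Inputs of type 2 and nodes -/

namespace ADTNetwork

open UnicastProg

section Nodes

variable {F V X Y : Type} [Field F] [DecidableEq F] [Fintype V] [DecidableEq V] [Fintype X]
  [DecidableEq X] [Fintype Y] [DecidableEq Y] {G : ADTNetwork F V X Y} {I : G.Listing}
  {k d : ℕ} {U₀ : ℕ → List (X × Y)} {n : ℕ}

/-- The only move from an input of type 2 is forward; the closure under the moves from it follows
from that for the input which replaced it. -/
theorem typeTwoSpec (hd : ∀ x, (I.succ x).length ≤ d)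
    (IH : ∀ n' < n, G.Specification I k d U₀ n') : G.TypeTwoSpec I k d U₀ n := by
  intro H A m hE hL hA h2 hn
  rw [exploreType₂.eq_1]
  obtain ⟨h2, h2A⟩ := h2
  rcases h2A with h2A | ⟨x, h2A, hxA, hx, hxe, hxt, hΛl, hΛ, hX⟩
  · simp only [runs_bind, runs_popPending_nil h2A, runs_pure]
    refine ⟨by simp only [totalCost]; omega, fun h => by simp at h, fun _ => ⟨⟨rfl,
      Progress.of_labels_eq (by simp) rfl rfl rfl fun _ h => h, fun B => ?_,
      hL.congr rfl rfl rfl rfl rfl rfl rfl⟩, fun x hx => ?_, fun _ => ⟨rfl, rfl, rfl⟩⟩⟩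
    · by_cases hB : B = A
      · rw [hB]; exact h2A
      · exact h2 B hB
    · rw [h2A] at hx; simp at hx
  · subst hxA
    have hopen : G.openValue { m with
        pending := Function.update m.pending 2 (Function.update (m.pending 2) (G.nodeX x) [])
        clock := m.clock + 2 } x 2 = true := openValue_eq_true.2 ⟨hx, hxe, hxt⟩
    have hpop := potential_pop_two (G := G) (N := k + 1) (d := d) (eV := m.exploredV)
      (eY := m.exploredY) (ini := m.initial) h2A
    have hany := Timed.any_time (fun e : X × Y => decide (e.1 = x))
      (m.used (G.layer (G.nodeX x)))
    have hUl := hE.length_layer_le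
    have hdl : (I.succ x).length * forwardCost (k + 1) ≤ d * forwardCost (k + 1) :=
      Nat.mul_le_mul_right _ (hd x)
    simp only [runs_bind, runs_popPending_cons h2A, runs_isOpen, hopen, if_true, setExploredX,
      runs_write, runs_look]
    have htc : typeTwoCost (k + 1) d = k + 10 + d * forwardCost (k + 1) := by
      unfold typeTwoCost; omega
    have hp2 : ∀ B, Function.update m.pending 2 (Function.update (m.pending 2) (G.nodeX x) []) 2 B
        = [] := by
      intro B
      rw [Function.update_self]
      by_cases hB : B = G.nodeX x
      · rw [hB, Function.update_self]
      · rw [Function.update_of_ne hB]; exact h2 B hB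
    refine Runs.mono ((IH _ ?_).forward H x (m.lam x) (I.succ x) _ hE ?_ hA hp2 hx hΛl hΛ hX
      (fun y hy => (I.mem_succ x y).1 hy) le_rfl) fun r m' hpost => ?_
    · simp only
      omega
    · refine hL.change_inputs rfl rfl rfl rfl ?_ fun z hz => Or.inl ?_
      · intro t B z hz
        simp only at hz
        by_cases ht : t = 2
        · subst ht
          rw [hp2 B] at hz
          simp at hz
        · rw [Function.update_of_ne ht] at hz
          exact hL.node t B z hz
      · have hzx : z ≠ x := by
          rintro rfl
          rw [hxt] at hz
          simp at hz
        simpa [Function.update_of_ne hzx] using hz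
    · have hc := hpost.1
      simp only [totalCost] at hc
      cases r with
      | true =>
        rw [if_pos rfl, runs_pure]
        refine hpost.success rfl ?_
        simp only [totalCost]
        omega
      | false =>
        obtain ⟨hf, hdone⟩ := hpost.2.2 rfl
        simp only [Bool.false_eq_true, if_false]
        have hclock := hf.progress.clock
        simp only at hclock
        have hp : G.Progress m m' := hf.progress.before (by simp only; omega) rfl rfl rfl
          fun B hB => by simpa using hB
        have hu : m'.used = m.used := hf.used
        refine Runs.mono ((IH _ ?_).typeTwo H (G.nodeX x) m' (hu ▸ hE) hf.labels
          (hp.exploredV _ hA) ⟨fun B _ => hf.pending_two B, Or.inl (hf.pending_two _)⟩ le_rfl)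
          fun r m'' hpost' => ?_
        · omega
        · refine hpost'.of_progress hp hu ?_ fun hf' _ => ⟨fun z hz => ?_, fun h => ?_⟩
          · simp only [totalCost]
            omega
          · rw [h2A] at hz
            obtain rfl : x = z := by simpa using hz
            intro v hv hvU
            exact (hdone v hv hvU).imp (hf'.progress.exploredV _) id
          · rw [h2A] at h; simp at h

/-- When all of its three parts have failed, the exploration of `A` leaves no pending input and no
unexplored initially used output of `A`. -/
theorem nodeSpec (IH : ∀ n' < n, G.Specification I k d U₀ n') : G.NodeSpec I k d U₀ n := by
  intro H A m hE hL hAD h2 hn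
  rw [exploreNode.eq_1]
  simp only [setExploredV, runs_bind, runs_write]
  have hec : enterCost (k + 1) = (k + 1) * (k + 6) + k + 7 := by unfold enterCost; ring
  have hV : ∀ B, m.exploredV B = true → Function.update m.exploredV A true B = true := by
    intro B hB
    by_cases hBA : B = A
    · rw [hBA, Function.update_self]
    · rwa [Function.update_of_ne hBA]
  refine Runs.mono ((IH _ ?_).typeTwo H A _ hE (hL.explore hAD) (by simp) ?_ le_rfl)
    fun r m₂ hpost₂ => ?_
  · simp only
    omega
  · refine ⟨h2.1, h2.2.imp id ?_⟩
    rintro ⟨x, hx1, hx2, hx3, hx4, hx5, hx6, hx7, hx8⟩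
    exact ⟨x, hx1, hx2, hx3, hx4, hx5, hx6, hx7, fun Ω hΩ => hx8 Ω (hΩ.mono hV)⟩
  have hc₂ := hpost₂.1
  simp only [totalCost] at hc₂
  cases r with
  | true =>
    rw [if_pos rfl, runs_pure]
    refine hpost₂.success rfl ?_
    simp only [totalCost]
    omega
  | false =>
    obtain ⟨hf₂, htwo, hsame⟩ := hpost₂.2.2 rfl
    have hu₂ : m₂.used = m.used := hf₂.used
    have hclock₂ := hf₂.progress.clock
    simp only at hclock₂
    have hA₂ : m₂.exploredV A = true := hf₂.progress.exploredV A (by simp)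
    simp only [Bool.false_eq_true, if_false, runs_bind]
    refine Runs.mono ((IH _ ?_).typeOne H A m₂ (hu₂ ▸ hE) hf₂.labels hA₂ hf₂.pending_two le_rfl)
      fun r m₃ hpost₃ => ?_
    · omega
    have hc₃ := hpost₃.1
    simp only [totalCost] at hc₃
    cases r with
    | true =>
      rw [if_pos rfl, runs_pure]
      refine hpost₃.success hf₂.progress.initial ?_
      simp only [totalCost]
      omega
    | false =>
      obtain ⟨hf₃, hp₃, hhead⟩ := hpost₃.2.2 rfl
      have hu₃ : m₃.used = m.used := hf₃.used.trans hu₂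
      have hclock₃ := hf₃.progress.clock
      simp only [Bool.false_eq_true, if_false, runs_bind, runs_look, runs_call, Timed.filter_val]
      have hA₃ : m₃.exploredV A = true := hf₃.progress.exploredV A hA₂
      have hft := Timed.filter_time (fun e : X × Y => decide (G.nodeY e.2 = A))
        (m₃.used (G.layer A - 1))
      have hlen := List.length_filter_le (fun e : X × Y => decide (G.nodeY e.2 = A))
        (m₃.used (G.layer A - 1))
      have hUl := hE.length_le (G.layer A - 1)
      rw [← hu₃] at hUl
      have hmul := Nat.mul_le_mul_right (k + 6) (hlen.trans hUl)
      refine Runs.mono ((IH _ ?_).backward H A _ _ (hu₃ ▸ hE)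
        (hf₃.labels.congr rfl rfl rfl rfl rfl rfl rfl) hA₃ hf₃.pending_two ?_ le_rfl)
        fun r m₄ hpost₄ => ?_
      · simp only
        omega
      · intro e he
        exact ⟨List.mem_of_mem_filter he, by simpa using List.of_mem_filter he⟩
      refine ⟨?_, fun hr => ?_, fun hr => ?_⟩
      · have hc₄ := hpost₄.1
        simp only [totalCost] at hc₄ ⊢
        omega
      · have hs := hpost₄.2.1 hr
        exact ⟨hs.flow, hs.initial.trans (hf₃.progress.initial.trans hf₂.progress.initial),
          hs.node, hs.dest⟩
      · obtain ⟨hf₄, hdone⟩ := hpost₄.2.2 hr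
        have hp₄ : G.Progress m₃ m₄ := hf₄.progress.before (by simp only; omega) rfl rfl rfl
          fun _ h => h
        have hp₄' : m₄.pending 1 A = [] := hp₄.pending A hp₃
        have hY : ∀ y, G.nodeY y = A → m₄.initial y = true → m₄.exploredY y = true := by
          intro y hy hi
          cases hye : m₃.exploredY y with
          | true => exact hp₄.exploredY y hye
          | false =>
            have hk := hf₃.labels.kept y (hp₄.initial ▸ hi) hye
            rw [hy] at hk
            obtain ⟨e, he, rfl⟩ := List.mem_map.1 hk
            exact hdone e (List.mem_filter.2 ⟨he, by simpa using hy⟩) hi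
        have hexc : G.ProgressExcept A m { m with
            exploredV := Function.update m.exploredV A true, clock := m.clock + 1 } := by
          refine ⟨by simp, rfl, hV, fun _ h => h, fun _ _ h => h, fun B hB h => Or.inl ?_⟩
          simpa [Function.update_of_ne hB] using h
        refine ⟨⟨hf₄.used.trans hu₃,
          (hexc.trans (hf₂.progress.trans (hf₃.progress.trans hp₄))).progress hp₄' hY,
          hf₄.pending_two, hf₄.labels⟩, hp₄.exploredV A hA₃, hp₄', hY, ?_, ?_⟩
        · intro x hx v hv hvU
          exact (htwo x hx v hv hvU).imp
            (fun h => hp₄.exploredV _ (hf₃.progress.exploredV _ h)) id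
        · intro h2A x xs hx hopen Ω hΩ
          obtain ⟨h1, h3, h4⟩ := hsame h2A
          have := hhead x xs (by rw [h1]; exact hx) (by
            rw [openValue_eq_true] at hopen ⊢
            rw [hu₂, h3, h4]
            exact hopen) Ω (fun B hB => hΩ B (hp₄.exploredV B hB))
          rwa [hu₂] at this

end Nodes

end ADTNetwork

/-! ### Backward rewirings -/

namespace ADTNetwork

open UnicastProg

section BackwardLabels

variable {F V X Y : Type} [Field F] [DecidableEq V] [Fintype X] [DecidableEq X] [DecidableEq Y]
  {G : ADTNetwork F V X Y} {U₀ : ℕ → List (X × Y)}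

/-- The labels after a backward rewiring, under the assumption that `Ω` is closed under the moves
from the released input. -/
theorem Labels.backward {H : Set V → Prop} {m : UnicastMemory F V X Y} (hL : G.Labels U₀ H m)
    {l : ℕ} {x : X} {y : Y} {U' : List (X × Y)} (hU : G.IsRegularCut l (m.used l))
    (hV : m.exploredV (G.nodeY y) = true) (hi : m.initial y = true)
    (h1 : (x :: U'.map Prod.fst).Perm ((m.used l).map Prod.fst))
    (h2 : (y :: U'.map Prod.snd).Perm ((m.used l).map Prod.snd)) (c : ℕ) :
    G.Labels U₀ (fun Ω => H Ω ∧ G.XClosed Ω U' x)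
      { m with
        used := Function.update m.used l U'
        exploredX := Function.update m.exploredX x false
        exploredY := Function.update m.exploredY y true
        type := Function.update m.type x 1
        pending := Function.update m.pending 1
          (Function.update (m.pending 1) (G.nodeX x) (x :: m.pending 1 (G.nodeX x)))
        clock := c } := by
  have hH : ∀ Ω, Hyp (fun Ω => H Ω ∧ G.XClosed Ω U' x) m.exploredV Ω → Hyp H m.exploredV Ω :=
    fun Ω hΩ => ⟨hΩ.1, hΩ.2.1⟩
  have hyU : y ∈ (m.used l).map Prod.snd := h2.subset (by simp)
  have hly := hU.layerY hyU
  have hY : ∀ Ω, Hyp (fun Ω => H Ω ∧ G.XClosed Ω U' x) m.exploredV Ω →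
      G.YClosed Ω (m.used l) y := fun Ω hΩ => hΩ.2.2.yClosed hU.indep h1 h2 hU.nodup_fst
  refine ⟨fun Ω hΩ l' => ?_, fun z => ?_, fun z hz hze => ?_, fun z hz hze => ?_, hL.initial,
    fun t B z hz => ?_, hL.dest⟩
  · by_cases hl : l' = l
    · subst hl
      simp only [Function.update_self]
      exact (hL.transfers Ω (hH Ω hΩ) l').of_yClosed (hY Ω hΩ) h1 h2 hU.nodup_snd
    · simp only [Function.update_of_ne hl]
      exact hL.transfers Ω (hH Ω hΩ) l'
  · by_cases hzx : z = x
    · subst hzx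
      left
      simp
    · refine (hL.row z).imp (fun h => ?_) fun h Ω hΩ => h Ω (hH Ω hΩ)
      simp only [Function.update_self, Function.update_of_ne hzx]
      refine ⟨?_, h.2⟩
      by_cases hzB : G.nodeX z = G.nodeX x
      · rw [hzB] at h ⊢
        rw [Function.update_self]
        exact List.mem_cons_of_mem _ h.1
      · rw [Function.update_of_ne hzB]
        exact h.1
  · by_cases hzy : z = y
    · subst hzy
      refine ⟨hV, fun Ω hΩ => ?_⟩
      have h0 := (hL.initial z).1 hi
      rw [hly, Nat.add_sub_cancel] at h0 ⊢
      exact (hL.transfers Ω (hH Ω hΩ) l).closed z h0 hyU (hY Ω hΩ)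
    · simp only [Function.update_of_ne hzy] at hze
      exact ⟨(hL.closed z hz hze).1, fun Ω hΩ => (hL.closed z hz hze).2 Ω (hH Ω hΩ)⟩
  · have hzy : z ≠ y := by
      rintro rfl
      simp at hze
    simp only [Function.update_of_ne hzy] at hze
    have := hL.kept z hz hze
    by_cases hl : G.layer (G.nodeY z) - 1 = l
    · rw [hl] at this ⊢
      simp only [Function.update_self]
      exact (List.mem_cons.1 (h2.symm.subset this)).resolve_left hzy
    · simp only [Function.update_of_ne hl]
      exact this
  · simp only at hz
    by_cases ht : t = 1
    · subst ht
      rw [Function.update_self] at hz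
      by_cases hB : B = G.nodeX x
      · subst hB
        rw [Function.update_self] at hz
        rcases List.mem_cons.1 hz with rfl | hz
        · rfl
        · exact hL.node 1 _ z hz
      · rw [Function.update_of_ne hB] at hz
        exact hL.node 1 B z hz
    · rw [Function.update_of_ne ht] at hz
      exact hL.node t B z hz

end BackwardLabels

section Backward

variable {F V X Y : Type} [Field F] [DecidableEq F] [Fintype V] [DecidableEq V] [Fintype X]
  [DecidableEq X] [Fintype Y] [DecidableEq Y] {G : ADTNetwork F V X Y} {I : G.Listing}
  {k d : ℕ} {U₀ : ℕ → List (X × Y)} {n : ℕ}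

/-- After a backward rewiring, the node of the released input `x` is explored under the assumption
that the sets in question are closed under the moves from `x`. The input `x` is the first that this
call takes out of the pending list, and so the assumption is discharged when the call has failed. -/
theorem backwardSpec (IH : ∀ n' < n, G.Specification I k d U₀ n') : G.BackwardSpec I k d U₀ n := by
  intro H A es m hE hL hA h2 hes hn
  rw [ADTNetwork.backward.eq_def]
  simp only [runs_bind, runs_step]
  cases es with
  | nil =>
    simp only [runs_pure]
    refine ⟨?_, fun h => by simp at h, fun _ => ⟨⟨rfl, Progress.of_labels_eq (by simp)
      rfl rfl rfl fun _ h => h, h2, hL.congr rfl rfl rfl rfl rfl rfl rfl⟩, by simp⟩⟩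
    simp only [totalCost]
    omega
  | cons e es =>
    obtain ⟨z, y⟩ := e
    simp only [runs_bind, runs_look, runs_call, Timed.any_val]
    set l := G.layer A - 1 with hl
    obtain ⟨heU, hyA⟩ := hes (z, y) (by simp)
    simp only at hyA
    have hyU : y ∈ (m.used l).map Prod.snd := List.mem_map.2 ⟨_, heU, rfl⟩
    have hany := Timed.any_time (fun e : X × Y => decide (e.2 = y)) (m.used l)
    have hUl := hE.length_le l
    rw [List.length_cons, Nat.add_mul, Nat.one_mul] at hn
    -- the remaining outputs, when `y` has been dealt with
    have hrest : ∀ m₁ : UnicastMemory F V X Y, m₁.used = m.used → G.Progress m m₁ →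
        (∀ B, m₁.pending 2 B = []) → G.Labels U₀ H m₁ →
        G.totalCost (k + 1) d m₁ ≤ G.totalCost (k + 1) d m + (k + 6) →
        m.clock < m₁.clock →
        (m₁.initial y = true → m₁.exploredY y = true) →
        Runs (backward I A es) m₁ (G.Post k d U₀ H m
          (G.totalCost (k + 1) d m + ((es.length + 1) * (k + 6) + 1))
          fun m' => ∀ e ∈ (z, y) :: es, m'.initial e.2 = true → m'.exploredY e.2 = true) := by
      intro m₁ hu hp h2' hL' hc hclock hy
      simp only [totalCost] at hc
      refine ((IH _ ?_).backward H A es m₁ (hu ▸ hE) hL' (hp.exploredV _ hA) h2'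
        (fun e he => by rw [hu]; exact hes e (by simp [he])) le_rfl).mono fun r m' hpost => ?_
      · omega
      · refine hpost.of_progress hp hu ?_ ?_
        · rw [Nat.add_mul, Nat.one_mul]
          simp only [totalCost]
          omega
        · intro hf hd v hv hvi
          rcases List.mem_cons.1 hv with rfl | hv
          · rw [hf.progress.initial] at hvi
            exact hf.progress.exploredY _ (hy hvi)
          · exact hd v hv hvi
    have hanyU : ((m.used l).any fun e => decide (e.2 = y)) = true :=
      List.any_eq_true.2 ⟨_, heU, by simp⟩
    by_cases hgo : ((((m.used l).any fun e => decide (e.2 = y)) && !m.exploredY y) &&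
        m.initial y) = true
    · rw [if_pos hgo]
      simp only [hanyU, Bool.true_and, Bool.and_eq_true, Bool.not_eq_true'] at hgo
      obtain ⟨hye, hyi⟩ := hgo
      have hcut := hE.cut l
      obtain ⟨hrt, x, U', hrel, h1, h2', hU'⟩ := release_spec hcut hyU
      have hrt' := hrt.trans (releaseTime_mono hUl)
      have hxU : x ∈ (m.used l).map Prod.fst := h1.subset (by simp)
      have hlx := hcut.layerX hxU
      simp only [runs_bind, runs_call, setExploredY, setExploredX, setType, setUsed, runs_write,
        hrel, runs_pushPending]
      have hpot1 := potential_exploreY (G := G) (N := k + 1) (d := d) (eV := m.exploredV)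
        (pend := m.pending) hyi hye
      have hpot2 := potential_push_one (G := G) (N := k + 1) (d := d) (eV := m.exploredV)
        (eY := Function.update m.exploredY y true) (ini := m.initial) (pend := m.pending)
        (G.nodeX x) x
      have hpot3 := potential_exploreV_le (G := G) (N := k + 1) (d := d) (eV := m.exploredV)
        (eY := Function.update m.exploredY y true) (ini := m.initial)
        (pend := Function.update m.pending 1
          (Function.update (m.pending 1) (G.nodeX x) (x :: m.pending 1 (G.nodeX x)))) (G.nodeX x)
      have hbc : backwardCost (k + 1) d = 7 + releaseTime (k + 1) + typeOneCost (k + 1) d +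
        enterCost (k + 1) := rfl
      have hL' := hL.backward hcut (by rw [hyA]; exact hA) hyi h1 h2'
      refine Runs.mono ((IH _ ?_).node _ (G.nodeX x) _ (hE.backward hyA h1 h2' hU') (hL' _)
        (hcut.ne_D hxU) ⟨fun B _ => ?_, Or.inl ?_⟩ le_rfl) fun r m' hpost => ?_
      · simp only
        omega
      · simpa using h2 B
      · simpa using h2 _
      cases r with
      | true =>
        rw [if_pos rfl, runs_pure]
        refine hpost.success rfl ?_
        rw [List.length_cons, Nat.add_mul, Nat.one_mul]
        simp only [totalCost]
        omega
      | false =>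
        obtain ⟨hf, hfx, hfp, hfy, -, hhead⟩ := hpost.2.2 rfl
        simp only [Bool.false_eq_true, if_false, runs_bind, runs_write]
        have hclosed := hhead (by simpa using h2 _) x (m.pending 1 (G.nodeX x)) (by simp) (by
          rw [openValue_eq_true]
          simp only [hlx, Function.update_self]
          exact ⟨(List.nodup_cons.1 (h1.symm.nodup hcut.nodup_fst)).1, by simp⟩)
        simp only [hlx, Function.update_self] at hclosed
        have hlab : G.Labels U₀ H m' := hf.labels.discharge fun Ω hΩ => ⟨hΩ.2, hclosed Ω hΩ.1⟩
        have hused : Function.update m'.used l (m.used l) = m.used := by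
          rw [hf.used]
          simp
        have hclock := hf.progress.clock
        simp only at hclock
        have hp : G.Progress m m' := by
          refine ProgressExcept.progress (A := G.nodeX x) (ProgressExcept.trans ?_ hf.progress)
            hfp hfy
          refine ⟨by simp only; omega, rfl, fun _ h => h, fun w hw => ?_, fun B hB h => ?_,
            fun B _ h => Or.inl h⟩
          · by_cases hwy : w = y
            · simp [hwy]
            · simpa [Function.update_of_ne hwy] using hw
          · simpa [Function.update_of_ne hB] using h
        have hcost := hpost.1
        simp only [totalCost] at hcost
        refine hrest _ hused (hp.after (by simp) rfl rfl rfl fun _ h => h) hf.pending_two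
          (hL.restore hlab hp hused rfl rfl rfl rfl rfl rfl) ?_ ?_ fun _ => ?_
        · simp only [totalCost]
          omega
        · simp only
          omega
        · exact hf.progress.exploredY y (by simp)
    · rw [if_neg hgo]
      refine hrest _ rfl (Progress.of_labels_eq (by simp only; omega) rfl rfl rfl fun _ h => h) h2
        (hL.congr rfl rfl rfl rfl rfl rfl rfl) ?_ ?_ fun hi => ?_
      · simp only [totalCost]; omega
      · simp only; omega
      · simp only at hi ⊢
        simpa [hanyU, hi] using hgo

end Backward

end ADTNetwork

/-! ### Same-layer rewirings -/

namespace ADTNetwork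

open UnicastProg

section Represents

variable {F V X Y : Type} [Field F] [Fintype X] [DecidableEq X] {G : ADTNetwork F V X Y}

/-- After `x` has replaced `t.1`, the exchanged coefficients represent the row of `t.1`. -/
theorem IsCombination.represents_exchange {U U' : List (X × Y)} {x : X} {Λ : List (X × F)}
    (hΛ : G.IsCombination U (G.T x) Λ) (hx : x ∉ U.map Prod.fst) {t : X × F} (ht : t ∈ Λ)
    (h1 : (t.1 :: U'.map Prod.fst).Perm (x :: U.map Prod.fst))
    (h2 : (U'.map Prod.snd).Perm (U.map Prod.snd)) :
    G.Represents U' t.1 (exchange x t.1 t.2 Λ).val := by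
  refine ⟨fun u hu => ?_, fun v hv => ?_⟩
  · have hmem : u ∈ (exchange x t.1 t.2 Λ).val.map Prod.fst := by
      by_contra h
      exact hu (coeffs_of_notMem h)
    have hut : u ≠ t.1 ∧ u ∈ x :: U.map Prod.fst := by
      rw [exchange_val, List.map_cons, List.mem_cons] at hmem
      rcases hmem with rfl | hmem
      · exact ⟨fun h => hx (h ▸ hΛ.mem t ht), by simp⟩
      · simp only [List.mem_map, List.mem_filter, decide_eq_true_eq] at hmem
        obtain ⟨_, ⟨s, ⟨hs, hst⟩, rfl⟩, rfl⟩ := hmem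
        exact ⟨hst, List.mem_cons_of_mem _ (hΛ.mem s hs)⟩
    exact (List.mem_cons.1 (h1.symm.subset hut.2)).resolve_left hut.1
  · rw [vecMul_coeffs_exchange hΛ ht, hΛ.eq v (h2.subset hv), sub_self, mul_zero, zero_add]

end Represents

section SameLayer

variable {F V X Y : Type} [Field F] [DecidableEq F] [Fintype V] [DecidableEq V] [Fintype X]
  [DecidableEq X] [Fintype Y] [DecidableEq Y] {G : ADTNetwork F V X Y} {I : G.Listing}
  {k d : ℕ} {U₀ : ℕ → List (X × Y)} {n : ℕ}

/-- A same-layer rewiring that replaces `t.1` by `x` is paid for by the credit of the call.  Closure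
under the moves from `t.1` follows from closure under the moves from `x`, and no new assumption is
needed. -/
theorem sameLayerSpec (IH : ∀ n' < n, G.Specification I k d U₀ n') :
    G.SameLayerSpec I k d U₀ n := by
  intro H x Λ Λ' paths m hpaths hE hL hA h2 hx hΛ hsub hX hn
  rw [ADTNetwork.sameLayer.eq_def]
  simp only [runs_bind, runs_step]
  cases Λ' with
  | nil =>
    simp only [runs_pure]
    refine ⟨?_, fun h => by simp at h, fun _ => ⟨⟨rfl, Progress.of_labels_eq (by simp)
      rfl rfl rfl fun _ h => h, h2, hL.congr rfl rfl rfl rfl rfl rfl rfl⟩, by simp⟩⟩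
    simp only [totalCost]
    omega
  | cons t Λ' =>
    have ht : t ∈ Λ := hsub (by simp)
    have htU := hΛ.mem t ht
    set l := G.layer (G.nodeX x) with hl
    have hcut := hE.cut l
    have hlt := hcut.layerX htU
    have hUl := hE.length_layer_le
    rw [← hl] at hUl
    have hΛl := hΛ.length_le
    rw [List.length_cons, Nat.add_mul, Nat.one_mul] at hn
    have hsc : sameLayerCost (k + 1) d = 3 * k + 14 + rematchTime (k + 1) + typeTwoCost (k + 1) d
      + enterCost (k + 1) := by unfold sameLayerCost; omega
    -- the remaining inputs, when `t.1` has been dealt with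
    have hrest : ∀ m₁ : UnicastMemory F V X Y, m₁.used = m.used → G.Progress m m₁ →
        (∀ B, m₁.pending 2 B = []) → G.Labels U₀ H m₁ →
        G.totalCost (k + 1) d m₁ ≤ G.totalCost (k + 1) d m + sameLayerCost (k + 1) d →
        m.clock < m₁.clock → m₁.exploredV (G.nodeX t.1) = true →
        (∀ v ∈ I.succ t.1, v ∉ (m.used l).map Prod.snd →
          m₁.exploredV (G.nodeY v) = true ∨ Matrix.vecMul (coeffs Λ) G.T v = G.T x v) →
        Runs (sameLayer I x Λ paths Λ') m₁ (G.Post k d U₀ H m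
          (G.totalCost (k + 1) d m + ((Λ'.length + 1) * sameLayerCost (k + 1) d + 1))
          fun m' => ∀ s ∈ t :: Λ', m'.exploredV (G.nodeX s.1) = true ∧
            ∀ v ∈ I.succ s.1, v ∉ (m.used l).map Prod.snd →
              m'.exploredV (G.nodeY v) = true ∨ Matrix.vecMul (coeffs Λ) G.T v = G.T x v) := by
      intro m₁ hu hp h2' hL' hc hclock h1 hv
      simp only [totalCost] at hc
      refine ((IH _ ?_).sameLayer H x Λ Λ' paths m₁ (hu ▸ hpaths) (hu ▸ hE) hL'
        (hp.exploredV _ hA) h2' (hu ▸ hx) (hu ▸ hΛ) (List.subset_of_cons_subset hsub)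
        (fun Ω hΩ => hu ▸ hX Ω (hΩ.mono hp.exploredV)) le_rfl).mono fun r m'' hpost => ?_
      · omega
      · refine hpost.of_progress hp hu ?_ ?_
        · rw [Nat.add_mul, Nat.one_mul]
          simp only [totalCost]
          omega
        · intro hf hd s hs
          rw [hu] at hd
          rcases List.mem_cons.1 hs with rfl | hs
          · exact ⟨hf.progress.exploredV _ h1, fun v hvs hvU =>
              (hv v hvs hvU).imp (hf.progress.exploredV _) id⟩
          · exact hd s hs
    -- the alternating path to the input to be given up
    obtain ⟨r, hr⟩ : ∃ r, paths.find? (fun r => decide (r.1 = t.1)) = some r := by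
      rw [← Option.isSome_iff_exists, List.find?_isSome]
      obtain ⟨r, hr, hrt⟩ := List.mem_map.1 (hΛ.mem_alternatingPaths hcut ht)
      exact ⟨r, hpaths ▸ hr, by simpa using hrt⟩
    have hrt : r.1 = t.1 := by simpa using List.find?_some hr
    have hrp := hpaths ▸ List.mem_of_find?_eq_some hr
    obtain ⟨hπ, hπU⟩ := alternatingPaths_sound x hcut.nodup_fst.of_map r hrp
    rw [hrt] at hπ
    obtain ⟨h1, h2', hT⟩ := rematch_spec hπ hπU hcut.edge
    have hrmt := (rematch_time hπ hπU).trans (rematchTime_mono (show _ ≤ k + 1 by omega))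
    set U' := (rematch r.2 (m.used l)).val with hU'
    have hnd' : (t.1 :: U'.map Prod.fst).Nodup :=
      h1.symm.nodup (List.nodup_cons.2 ⟨hx, hcut.nodup_fst⟩)
    have hU'cut : G.IsRegularCut l U' := by
      refine ⟨hT, fun e he => ?_, (List.nodup_cons.1 hnd').2, h2'.symm.nodup hcut.nodup_snd,
        hcut.indep.exchange hx (fun u hu => hΛ.mem_of_coeffs_ne_zero hu) hΛ.eq
          (by rw [coeffs_of_mem hΛ.nodup ht]; exact hΛ.ne_zero t ht) h1 h2' hcut.nodup_fst⟩
      have : e.1 ∈ x :: (m.used l).map Prod.fst :=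
        h1.subset (List.mem_cons_of_mem _ (List.mem_map_of_mem he))
      rcases List.mem_cons.1 this with h | h
      · rw [h]
      · exact hcut.layerX h
    have hft := Timed.find_time (fun r : Reached X Y => decide (r.1 = t.1)) paths
    have hpl := G.alternatingPaths_length x (m.used l)
    rw [← hpaths] at hpl
    have het := exchange_time x t.1 t.2 Λ
    have hel := exchange_length x Λ ht
    simp only [runs_bind, runs_call, Timed.find_val, hr, setExploredX, setType, setLam, setUsed,
      runs_write, runs_look, runs_pushPending]
    have hpot1 := potential_push_two (G := G) (N := k + 1) (d := d) (eV := m.exploredV)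
      (eY := m.exploredY) (ini := m.initial) (pend := m.pending) (G.nodeX t.1) t.1
    have hpot2 := potential_exploreV_le (G := G) (N := k + 1) (d := d) (eV := m.exploredV)
      (eY := m.exploredY) (ini := m.initial)
      (pend := Function.update m.pending 2
        (Function.update (m.pending 2) (G.nodeX t.1) (t.1 :: m.pending 2 (G.nodeX t.1))))
      (G.nodeX t.1)
    have hE' := hE.sameLayer rfl hlt h1 h2' hU'cut
    rw [← hl] at hE'
    refine Runs.mono ((IH _ ?_).node H (G.nodeX t.1) _ hE' ?_
      (hcut.ne_D htU) ⟨fun B hB => ?_, Or.inr ⟨t.1, ?_, rfl, ?_, ?_, ?_, ?_, ?_, ?_⟩⟩ le_rfl)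
      fun r m' hpost => ?_
    · simp only
      omega
    · -- the labels
      have hL1 : G.Labels U₀ H { m with
          exploredX := Function.update m.exploredX t.1 false
          type := Function.update m.type t.1 2
          pending := Function.update m.pending 2
            (Function.update (m.pending 2) (G.nodeX t.1) (t.1 :: m.pending 2 (G.nodeX t.1))) } := by
        refine hL.change_inputs rfl rfl rfl rfl (fun s B z hz => ?_) fun z hz => ?_
        · simp only at hz
          by_cases hs : s = 2
          · subst hs
            rw [Function.update_self] at hz
            by_cases hB : B = G.nodeX t.1
            · subst hB
              rw [Function.update_self, h2] at hz
              rw [List.mem_singleton.1 hz]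
            · rw [Function.update_of_ne hB] at hz
              exact hL.node 2 B z hz
          · rw [Function.update_of_ne hs] at hz
            exact hL.node s B z hz
        · by_cases hzt : z = t.1
          · subst hzt
            exact Or.inr fun Ω hΩ hzΩ => hL.row_of_used (by rwa [hlt]) Ω hΩ hzΩ
          · left
            simpa [Function.update_of_ne hzt] using hz
      refine hL1.change_used rfl rfl rfl rfl rfl rfl (fun Ω hΩ l' => ?_) fun z hz hze => ?_
      · by_cases hll : l' = l
        · subst hll
          simp only [Function.update_self]
          exact (hL.transfers Ω hΩ l).of_xClosed (hX Ω hΩ)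
            (fun u hu => h1.subset (List.mem_cons_of_mem _ hu)) h2'.symm.subset
            fun z _ hz' => h2'.subset hz'
        · simp only [Function.update_of_ne hll]
          exact hL.transfers Ω hΩ l'
      · have := hL.kept z hz hze
        by_cases hll : G.layer (G.nodeY z) - 1 = l
        · rw [hll] at this ⊢
          simp only [Function.update_self]
          exact h2'.symm.subset this
        · simp only [Function.update_of_ne hll]
          exact this
    · simpa [Function.update_of_ne hB] using h2 B
    · simp [h2]
    · simp only [hlt, Function.update_self]
      exact (List.nodup_cons.1 hnd').1
    · simp
    · simp
    · simp only [Function.update_self]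
      omega
    · simp only [hlt, Function.update_self]
      exact hΛ.represents_exchange hx ht h1 h2'
    · intro Ω hΩ
      simp only [hlt, Function.update_self]
      exact (hX Ω hΩ).exchange hcut.indep hΛ hx ht h1 h2'
    · cases r with
      | true =>
        rw [if_pos rfl, runs_pure]
        refine hpost.success rfl ?_
        rw [List.length_cons, Nat.add_mul, Nat.one_mul]
        simp only [totalCost]
        omega
      | false =>
        obtain ⟨hf, hfx, -, -, htwo, -⟩ := hpost.2.2 rfl
        simp only [Bool.false_eq_true, if_false, runs_bind, runs_write]
        have hused : Function.update m'.used l (m.used l) = m.used := by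
          rw [hf.used]
          simp
        have hclock := hf.progress.clock
        simp only at hclock
        have hp : G.Progress m m' := hf.progress.before (by simp only; omega) rfl rfl rfl
          fun B hB => by simpa using hB
        have hcost := hpost.1
        simp only [totalCost] at hcost
        -- the forward moves from the input given up
        have hdone : ∀ v ∈ I.succ t.1, v ∉ (m.used l).map Prod.snd →
            m'.exploredV (G.nodeY v) = true ∨ Matrix.vecMul (coeffs Λ) G.T v = G.T x v := by
          intro v hv hvU
          refine (htwo t.1 (by simp [h2]) v hv ?_).imp id fun h => ?_
          · simp only [hlt, Function.update_self]
            exact fun h => hvU (h2'.subset h)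
          · simp only [Function.update_self] at h
            rw [vecMul_coeffs_exchange hΛ ht, add_eq_right, mul_eq_zero, inv_eq_zero, sub_eq_zero]
              at h
            exact (h.resolve_left (hΛ.ne_zero t ht)).symm
        refine hrest _ hused (hp.after (by simp) rfl rfl rfl fun _ h => h) hf.pending_two
          (hL.restore hf.labels hp hused rfl rfl rfl rfl rfl rfl) ?_ ?_ hfx hdone
        · simp only [totalCost]
          omega
        · simp only
          omega

end SameLayer

end ADTNetwork

/-! ### Inputs of type 1 and the recursion -/

namespace ADTNetwork

open UnicastProg

section Closed

variable {F V X Y : Type} [Field F] [Fintype X] [DecidableEq X] {G : ADTNetwork F V X Y}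

/-- If all moves from `x` lead to nodes in `Ω`, then `Ω` is closed under the moves from `x`.  An
output outside `Ω` that is a successor of neither `x` nor an input in `Λ` is no obstacle, since the
rows of these inputs vanish there. -/
theorem IsCombination.xClosed {I : G.Listing} {Ω : Set V} {U : List (X × Y)} {x : X}
    {Λ : List (X × F)} (hΛ : G.IsCombination U (G.T x) Λ) (hx : G.nodeX x ∈ Ω)
    (hΛΩ : ∀ t ∈ Λ, G.nodeX t.1 ∈ Ω)
    (hx' : ∀ v ∈ I.succ x, v ∉ U.map Prod.snd → G.nodeY v ∉ Ω →
      Matrix.vecMul (coeffs Λ) G.T v = G.T x v)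
    (hΛ' : ∀ t ∈ Λ, ∀ v ∈ I.succ t.1, v ∉ U.map Prod.snd → G.nodeY v ∉ Ω →
      Matrix.vecMul (coeffs Λ) G.T v = G.T x v) : G.XClosed Ω U x := by
  refine ⟨hx, coeffs Λ, fun u hu => ⟨hΛ.mem_of_coeffs_ne_zero hu, ?_⟩, fun v hv => ?_⟩
  · have : u ∈ Λ.map Prod.fst := by by_contra h; exact hu (coeffs_of_notMem h)
    obtain ⟨t, ht, rfl⟩ := List.mem_map.1 this
    exact hΛΩ t ht
  · by_cases hvU : v ∈ U.map Prod.snd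
    · exact hΛ.eq v hvU
    have hvΩ := hv.resolve_right hvU
    by_cases h0 : G.T x v = 0
    · by_cases h1 : ∃ t ∈ Λ, G.T t.1 v ≠ 0
      · obtain ⟨t, ht, htv⟩ := h1
        exact hΛ' t ht v ((I.mem_succ _ _).2 htv) hvU hvΩ
      · push Not at h1
        rw [h0, vecMul_coeffs]
        refine List.sum_eq_zero fun a ha => ?_
        obtain ⟨t, ht, rfl⟩ := List.mem_map.1 ha
        rw [h1 t ht, mul_zero]
    · exact hx' v ((I.mem_succ _ _).2 h0) hvU hvΩ

end Closed

section PopLabels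

variable {F V X Y : Type} [Field F] [DecidableEq V] [Fintype X] [DecidableEq X]
  {G : ADTNetwork F V X Y} {U₀ : ℕ → List (X × Y)}

/-- The labels after taking a pending input `x` of type 1 out of its list, if `x` is accounted for
in another way. -/
theorem Labels.pop {H : Set V → Prop} {m m' : UnicastMemory F V X Y} (hL : G.Labels U₀ H m) {A : V}
    {x : X} {xs : List X} (hp : m.pending 1 A = x :: xs)
    (hx : ∀ Ω, Hyp H m.exploredV Ω → G.nodeX x ∈ Ω → G.RowIn Ω (U₀ (G.layer (G.nodeX x))) x)
    (hu : m'.used = m.used) (hV : m'.exploredV = m.exploredV)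
    (hX : ∀ z, z ≠ x → m'.exploredX z = m.exploredX z) (hY : m'.exploredY = m.exploredY)
    (ht : m'.type = m.type) (hi : m'.initial = m.initial)
    (hp' : m'.pending = Function.update m.pending 1 (Function.update (m.pending 1) A xs)) :
    G.Labels U₀ H m' := by
  refine hL.change_inputs hu hV hY hi (fun s B z hz => ?_) fun z hz => ?_
  · rw [hp'] at hz
    by_cases hs : s = 1
    · subst hs
      rw [Function.update_self] at hz
      by_cases hB : B = A
      · subst hB
        rw [Function.update_self] at hz
        exact hL.node 1 _ z (by rw [hp]; exact List.mem_cons_of_mem _ hz)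
      · rw [Function.update_of_ne hB] at hz
        exact hL.node 1 B z hz
    · rw [Function.update_of_ne hs] at hz
      exact hL.node s B z hz
  · by_cases hzx : z = x
    · subst hzx
      exact Or.inr hx
    · left
      rw [hX z hzx, ht, hp', Function.update_self]
      refine ⟨?_, hz.2⟩
      by_cases hB : G.nodeX z = A
      · subst hB
        have := hz.1
        rw [hp] at this
        rw [Function.update_self]
        exact (List.mem_cons.1 this).resolve_left hzx
      · rw [Function.update_of_ne hB]
        exact hz.1

end PopLabels

section TypeOne

variable {F V X Y : Type} [Field F] [DecidableEq F] [Fintype V] [DecidableEq V] [Fintype X]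
  [DecidableEq X] [Fintype Y] [DecidableEq Y] {G : ADTNetwork F V X Y} {I : G.Listing}
  {k d : ℕ} {U₀ : ℕ → List (X × Y)} {n : ℕ}

/-- The moves from a pending input `x` are explored under the assumption that the sets in question
are closed under them. When they have failed, their targets are explored, and so every set that
contains the explored nodes is closed under them. -/
theorem typeOneSpec (hd : ∀ x, (I.succ x).length ≤ d)
    (IH : ∀ n' < n, G.Specification I k d U₀ n') : G.TypeOneSpec I k d U₀ n := by
  intro H A m hE hL hA h2 hn
  rw [exploreType₁.eq_1]
  cases hp : m.pending 1 A with
  | nil =>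
    simp only [runs_bind, runs_popPending_nil hp, runs_pure]
    refine ⟨by simp only [totalCost]; omega, fun h => by simp at h, fun _ => ⟨⟨rfl,
      Progress.of_labels_eq (by simp) rfl rfl rfl fun _ h => h, h2,
      hL.congr rfl rfl rfl rfl rfl rfl rfl⟩, hp, fun x xs hx => ?_⟩⟩
    rw [hp] at hx; simp at hx
  | cons x xs =>
    have hxA : G.nodeX x = A := hL.node 1 A x (by simp [hp])
    subst hxA
    set l := G.layer (G.nodeX x) with hl
    have hpop := potential_pop_one (G := G) (N := k + 1) (d := d) (eV := m.exploredV)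
      (eY := m.exploredY) (ini := m.initial) hp
    have hany := Timed.any_time (fun e : X × Y => decide (e.1 = x)) (m.used l)
    have hUl := hE.length_layer_le
    rw [← hl] at hUl
    have hcut := hE.cut l
    have htc : typeOneCost (k + 1) d = k + 9 + combineTime (k + 1) +
        (d * forwardCost (k + 1) + 1) + alternatingTime (k + 1)
        + ((k + 1) * sameLayerCost (k + 1) d + 1) := by unfold typeOneCost; omega
    have hopen' : ∀ c, G.openValue { m with
        pending := Function.update m.pending 1 (Function.update (m.pending 1) (G.nodeX x) xs)
        clock := c } x 1 = G.openValue m x 1 := fun _ => rfl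
    have hpp : ∀ B, m.pending 1 B = [] →
        Function.update m.pending 1 (Function.update (m.pending 1) (G.nodeX x) xs) 1 B = [] := by
      intro B hB
      have hBx : B ≠ G.nodeX x := by
        rintro rfl
        rw [hp] at hB
        simp at hB
      simpa [Function.update_of_ne hBx] using hB
    have hp2 : ∀ B, Function.update m.pending 1 (Function.update (m.pending 1) (G.nodeX x) xs) 2 B
        = [] := fun B => by simpa using h2 B
    simp only [runs_bind, runs_popPending_cons hp, runs_isOpen, hopen']
    by_cases hopen : G.openValue m x 1 = true
    · simp only [hopen, if_true, setExploredX, runs_bind, runs_write, runs_look, runs_call]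
      obtain ⟨hx, -, -⟩ := openValue_eq_true.1 hopen
      rw [← hl] at hx ⊢
      obtain ⟨hΛ, hΛt⟩ := combine_spec hcut.nodup_fst hcut.indep (G.T x)
      have hΛt' := hΛt.trans (combineTime_mono (show _ ≤ k + 1 by omega))
      set Λ := (G.combine (m.used l) (G.T x)).val with hΛdef
      have hΛl := hΛ.length_le
      have hdl : (I.succ x).length * forwardCost (k + 1) ≤ d * forwardCost (k + 1) :=
        Nat.mul_le_mul_right _ (hd x)
      have hΛs : Λ.length * sameLayerCost (k + 1) d ≤ (k + 1) * sameLayerCost (k + 1) d :=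
        Nat.mul_le_mul_right _ (by omega)
      -- the closure under the moves from `x` joins the assumptions
      refine Runs.mono ((IH _ ?_).forward (fun Ω => H Ω ∧ G.XClosed Ω (m.used l) x) x Λ (I.succ x)
        _ hE ?_ hA hp2 hx (by omega) ⟨fun u hu => hΛ.mem_of_coeffs_ne_zero hu, hΛ.eq⟩
        (fun Ω hΩ => hΩ.2.2) (fun y hy => (I.mem_succ x y).1 hy) le_rfl) fun r m₁ hpost => ?_
      · simp only
        omega
      · exact (hL.strengthen fun Ω hΩ => hΩ.1).pop hp
          (fun Ω hΩ _ => (hL.transfers Ω ⟨hΩ.1, hΩ.2.1⟩ l).row x hΩ.2.2.rowIn) rfl rfl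
          (fun z hz => by simp [Function.update_of_ne hz]) rfl rfl rfl rfl
      have hc := hpost.1
      simp only [totalCost] at hc
      cases r with
      | true =>
        rw [if_pos rfl, runs_pure]
        refine hpost.success rfl ?_
        simp only [totalCost]
        omega
      | false =>
        obtain ⟨hf, hdone⟩ := hpost.2.2 rfl
        simp only [Bool.false_eq_true, if_false, runs_bind, runs_call]
        have hclock := hf.progress.clock
        simp only at hclock
        have hp₁ : G.Progress m m₁ := hf.progress.before (by simp only; omega) rfl rfl rfl hpp
        have hu₁ : m₁.used = m.used := hf.used
        have hat := (G.alternatingPaths_time x (m.used l)).trans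
          (alternatingTime_mono (show _ ≤ k + 1 by omega))
        refine Runs.mono ((IH _ ?_).sameLayer (fun Ω => H Ω ∧ G.XClosed Ω (m.used l) x) x Λ Λ
          (G.alternatingPaths x (m.used l)).val _ (by simp only [hu₁, hl]) (hu₁ ▸ hE)
          (hf.labels.congr rfl rfl rfl rfl rfl rfl rfl) (hp₁.exploredV _ hA) hf.pending_two
          (by simp only [hu₁]; exact hx) (by simp only [hu₁]; exact hΛ) (List.Subset.refl _)
          (fun Ω hΩ => by simp only [hu₁]; exact hΩ.2.2) le_rfl) fun r m₂ hpost₂ => ?_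
        · simp only
          omega
        have hc₂ := hpost₂.1
        simp only [totalCost] at hc₂
        cases r with
        | true =>
          rw [if_pos rfl, runs_pure]
          refine hpost₂.success hp₁.initial ?_
          simp only [totalCost]
          omega
        | false =>
          obtain ⟨hf₂, hdone₂⟩ := hpost₂.2.2 rfl
          simp only [Bool.false_eq_true, if_false]
          have hclock₂ := hf₂.progress.clock
          simp only at hclock₂
          have hp₂ : G.Progress m₁ m₂ := hf₂.progress.before (by simp only; omega) rfl rfl rfl
            fun _ h => h
          have hp₁₂ := hp₁.trans hp₂
          have hu₂ : m₂.used = m.used := hf₂.used.trans hu₁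
          simp only [← hl, hu₁] at hdone₂
          have hclosed : ∀ Ω : Set V, (∀ B, m₂.exploredV B = true → B ∈ Ω) →
              G.XClosed Ω (m.used l) x := by
            intro Ω hΩ
            refine hΛ.xClosed (I := I) (hΩ _ (hp₁₂.exploredV _ hA))
              (fun t ht => hΩ _ (hdone₂ t ht).1) (fun v hv hvU hvΩ => ?_)
              fun t ht v hv hvU hvΩ => ?_
            · exact (hdone v hv hvU).resolve_left fun h => hvΩ (hΩ _ (hp₂.exploredV _ h))
            · exact ((hdone₂ t ht).2 v hv hvU).resolve_left fun h => hvΩ (hΩ _ h)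
          refine Runs.mono ((IH _ ?_).typeOne H (G.nodeX x) m₂ (hu₂ ▸ hE)
            (hf₂.labels.discharge fun Ω hΩ => ⟨hΩ.2, hclosed Ω hΩ.1⟩) (hp₁₂.exploredV _ hA)
            hf₂.pending_two le_rfl) fun r m₃ hpost₃ => ?_
          · omega
          refine hpost₃.of_progress hp₁₂ hu₂ ?_ fun hf₃ hR => ⟨hR.1, fun z zs hz _ Ω hΩ => ?_⟩
          · simp only [totalCost]
            omega
          · rw [hp] at hz
            obtain ⟨rfl, rfl⟩ : x = z ∧ xs = zs := by simpa using hz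
            exact hclosed Ω fun B hB => hΩ B (hf₃.progress.exploredV B hB)
    · simp only [hopen, Bool.false_eq_true, if_false]
      refine Runs.mono ((IH _ ?_).typeOne H (G.nodeX x) _ hE ?_ hA hp2 le_rfl)
        fun r m₁ hpost => ?_
      · simp only
        omega
      · exact hL.pop hp (hL.row_of_not_open hopen) rfl rfl (fun _ _ => rfl) rfl rfl rfl rfl
      · refine hpost.of_progress
          (Progress.of_labels_eq (by simp only; omega) rfl rfl rfl hpp) rfl ?_
          fun hf hR => ⟨hR.1, fun z zs hz ho => ?_⟩
        · simp only [totalCost, ← hl]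
          omega
        · rw [hp] at hz
          obtain ⟨rfl, rfl⟩ : x = z ∧ xs = zs := by simpa using hz
          exact absurd ho hopen

/-- All recursive functions meet their specifications. -/
theorem specification (hd : ∀ x, (I.succ x).length ≤ d) (n : ℕ) :
    G.Specification I k d U₀ n := by
  induction n using Nat.strong_induction_on with
  | _ n IH =>
    exact ⟨nodeSpec IH, typeTwoSpec hd IH, typeOneSpec hd IH, forwardSpec IH, sameLayerSpec IH,
      backwardSpec IH⟩

end TypeOne

end ADTNetwork

/-! ### The initialization of an iteration -/

namespace UnicastProg

variable {F V X Y α : Type}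

/-- Loops preserve invariants, which may depend on the list of the items that have been dealt
with. -/
theorem runs_forM {f : α → UnicastProg F V X Y PUnit} (Inv : List α → UnicastMemory F V X Y → Prop)
    (l : List α) {m : UnicastMemory F V X Y} (h0 : Inv [] m)
    (hstep : ∀ a ∈ l, ∀ done m', Inv done m' → Runs (f a) m' fun _ => Inv (a :: done)) :
    Runs (l.forM f) m fun _ => Inv l.reverse := by
  suffices h : ∀ (l' done : List α) (m' : UnicastMemory F V X Y), l' ⊆ l → Inv done m' →
      Runs (l'.forM f) m' fun _ => Inv (l'.reverse ++ done) by
    simpa using h l [] m (List.Subset.refl _) h0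
  intro l'
  induction l' with
  | nil =>
    intro done m' _ hI
    rw [show List.forM [] f = pure PUnit.unit from rfl, runs_pure]
    simpa using hI
  | cons a l' ih =>
    intro done m' hsub hI
    rw [show List.forM (a :: l') f = (f a >>= fun _ => List.forM l' f) from rfl, runs_bind]
    refine (hstep a (hsub (by simp)) done m' hI).mono fun _ m'' hI' => ?_
    simpa using ih (a :: done) m'' (List.subset_of_cons_subset hsub) hI'

end UnicastProg

namespace ADTNetwork

open UnicastProg

theorem Listing.length_inputs {F V X Y : Type} [Field F] [Fintype X] {G : ADTNetwork F V X Y}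
    (I : G.Listing) : I.inputs.length = Fintype.card X := by
  classical
  rw [← List.toFinset_card_of_nodup I.nodup_inputs, ← Finset.card_univ]
  congr 1
  ext x
  simp [I.mem_inputs x]

section Reset

variable {F V X Y : Type} [Field F] {G : ADTNetwork F V X Y}

/-- What holds of the memory before and after every iteration.  Outputs without edges are never
initialized, and so must not be marked as used. -/
structure Valid (G : ADTNetwork F V X Y) (m : UnicastMemory F V X Y) : Prop where
  node : ∀ t B x, x ∈ m.pending t B → G.nodeX x = B
  dest : m.exploredV G.D = false
  initial : ∀ y, (∀ x, G.T x y = 0) → m.initial y = false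

/-- The state of the memory during the initialization by `reset`, when the inputs in `dx` and the
outputs in `dy` have been dealt with. -/
structure ResetState (G : ADTNetwork F V X Y) (U₀ : ℕ → List (X × Y)) (dx : X → Prop)
    (dy : Y → Prop) (c : ℕ) (m : UnicastMemory F V X Y) : Prop where
  valid : G.Valid m
  used : m.used = U₀
  inputs : ∀ x, dx x → m.exploredV (G.nodeX x) = false ∧ m.exploredX x = false ∧ m.type x = 1 ∧
    m.pending 1 (G.nodeX x) = [] ∧ m.pending 2 (G.nodeX x) = []
  outputs : ∀ y, dy y → m.exploredV (G.nodeY y) = false ∧ m.exploredY y = false ∧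
    (m.initial y = true ↔ y ∈ (U₀ (G.layer (G.nodeY y) - 1)).map Prod.snd)
  clock : m.clock ≤ c

variable [DecidableEq V]
  {used : ℕ → List (X × Y)} {dx : X → Prop} {dy : Y → Prop} {c N : ℕ} {m : UnicastMemory F V X Y}

/-- The initialization of one input and its node. -/
theorem ResetState.input [DecidableEq X] (h : G.ResetState used dx dy c m) (x : X) :
    Runs (do
      setExploredV (G.nodeX x) false
      setExploredX x false
      setType x 1
      setPending 1 (G.nodeX x) []
      setPending 2 (G.nodeX x) []) m
      fun _ => G.ResetState used (fun z => z = x ∨ dx z) dy (c + 5) := by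
  simp only [setExploredV, setExploredX, setType, setPending, runs_bind, runs_write]
  have hc := h.clock
  have hV : ∀ B, m.exploredV B = false →
      Function.update m.exploredV (G.nodeX x) false B = false := by
    intro B hB
    by_cases hBx : B = G.nodeX x
    · rw [hBx, Function.update_self]
    · rwa [Function.update_of_ne hBx]
  refine ⟨⟨fun t B z hz => ?_, hV _ h.valid.dest, h.valid.initial⟩, h.used, fun z hz => ?_,
    fun z hz => ⟨hV _ (h.outputs z hz).1, (h.outputs z hz).2⟩, by simp only; omega⟩
  · refine h.valid.node t B z ?_
    have key : ∀ f : V → List X, z ∈ Function.update f (G.nodeX x) [] B → z ∈ f B := by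
      intro f hf
      by_cases hB : B = G.nodeX x
      · rw [hB, Function.update_self] at hf
        simp at hf
      · rwa [Function.update_of_ne hB] at hf
    simp only at hz
    by_cases ht : t = 2
    · subst ht
      rw [Function.update_self] at hz
      simpa using key _ hz
    · rw [Function.update_of_ne ht] at hz
      by_cases ht' : t = 1
      · subst ht'
        rw [Function.update_self] at hz
        exact key _ hz
      · rwa [Function.update_of_ne ht'] at hz
  · have key : ∀ f : V → List X, f (G.nodeX z) = [] →
        Function.update f (G.nodeX x) [] (G.nodeX z) = [] := by
      intro f hf
      by_cases hB : G.nodeX z = G.nodeX x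
      · rw [hB, Function.update_self]
      · rwa [Function.update_of_ne hB]
    by_cases hzx : z = x
    · subst hzx
      simp
    · obtain ⟨h1, h2, h3, h4, h5⟩ := h.inputs z (hz.resolve_left hzx)
      exact ⟨hV _ h1, by simp [Function.update_of_ne hzx, h2],
        by simp [Function.update_of_ne hzx, h3],
        by simpa using key _ h4, by simpa using key _ h5⟩

variable [DecidableEq Y]

/-- The initialization of one output and its node. -/
theorem ResetState.output (h : G.ResetState used dx dy c m) {x : X} {y : Y} (hT : G.T x y ≠ 0)
    (hN : ∀ l, (used l).length ≤ N) :
    Runs (do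
      setExploredV (G.nodeY y) false
      setExploredY y false
      let U ← look fun m => m.used (G.layer (G.nodeX x))
      let u ← call (Timed.any (fun e => decide (e.2 = y)) U)
      setInitial y u) m
      fun _ => G.ResetState used dx (fun z => z = y ∨ dy z) (c + (N + 5)) := by
  simp only [setExploredV, setExploredY, setInitial, runs_bind, runs_write, runs_look, runs_call,
    Timed.any_val]
  have hany := Timed.any_time (fun e : X × Y => decide (e.2 = y)) (m.used (G.layer (G.nodeX x)))
  have hlen := hN (G.layer (G.nodeX x))
  have hc := h.clock
  have hV : ∀ B, m.exploredV B = false →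
      Function.update m.exploredV (G.nodeY y) false B = false := by
    intro B hB
    by_cases hBy : B = G.nodeY y
    · rw [hBy, Function.update_self]
    · rwa [Function.update_of_ne hBy]
  have hly := G.layer_edge x y hT
  refine ⟨⟨h.valid.node, hV _ h.valid.dest, fun z hz => ?_⟩, h.used, fun z hz => ?_, fun z hz => ?_,
    ?_⟩
  · have hzy : z ≠ y := by
      rintro rfl
      exact hT (hz x)
    simpa [Function.update_of_ne hzy] using h.valid.initial z hz
  · exact ⟨hV _ (h.inputs z hz).1, (h.inputs z hz).2⟩
  · by_cases hzy : z = y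
    · subst hzy
      refine ⟨by simp, by simp, ?_⟩
      simp only [Function.update_self, List.any_eq_true, decide_eq_true_eq, h.used, hly,
        Nat.add_sub_cancel, List.mem_map]
    · have := h.outputs z (hz.resolve_left hzy)
      simp only [Function.update_of_ne hzy]
      exact ⟨hV _ this.1, this.2⟩
  · rw [h.used] at hany ⊢
    simp only
    omega

/-- The state of the memory when an iteration begins. -/
structure Start (G : ADTNetwork F V X Y) [Fintype V] [Fintype X] (U₀ : ℕ → List (X × Y))
    (m : UnicastMemory F V X Y) : Prop where
  labels : G.Labels U₀ (fun _ => True) m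
  used : m.used = U₀
  pending_two : ∀ B, m.pending 2 B = []
  pending_one : ∑ B, (m.pending 1 B).length = Fintype.card X
  inputs : ∀ x, m.exploredV (G.nodeX x) = false
  outputs : ∀ y, m.initial y = true → m.exploredV (G.nodeY y) = false
  initial : ∀ y, (∀ x, G.T x y = 0) → m.initial y = false

/-- A bound for the number of steps of `reset`. -/
def resetTime (nX N d : ℕ) : ℕ := nX * (7 + d * (N + 5))

/-- Nodes are initialized through their inputs and outputs.  At the end all inputs are pending with
type 1, so that nothing needs to be accounted for. -/
theorem reset_spec [Fintype V] [Fintype X] [DecidableEq X] {I : G.Listing} {d : ℕ}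
    (hd : ∀ x, (I.succ x).length ≤ d) (hm : G.Valid m) (hN : ∀ l, (m.used l).length ≤ N)
    (hT : ∀ l, ∀ e ∈ m.used l, G.T e.1 e.2 ≠ 0) :
    Runs (reset I) m fun _ m' => G.Start m.used m' ∧
      m'.clock ≤ m.clock + resetTime (Fintype.card X) N d := by
  unfold reset
  rw [runs_bind]
  have hfirst := runs_forM (fun done => G.ResetState m.used (· ∈ done)
    (fun y => ∃ x ∈ done, y ∈ I.succ x) (m.clock + done.length * (5 + d * (N + 5)))) I.inputs
    (f := fun x => do
      setExploredV (G.nodeX x) false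
      setExploredX x false
      setType x 1
      setPending 1 (G.nodeX x) []
      setPending 2 (G.nodeX x) []
      (I.succ x).forM fun y => do
        setExploredV (G.nodeY y) false
        setExploredY y false
        let U ← look fun m => m.used (G.layer (G.nodeX x))
        let u ← call (Timed.any (fun e => decide (e.2 = y)) U)
        setInitial y u) (m := m)
    ⟨hm, rfl, by simp, by simp, by simp⟩ ?_
  · refine hfirst.mono fun _ m₁ h₁ => ?_
    have hsecond := runs_forM (fun done m₂ => ∃ p : ℕ → V → List X,
        m₂ = { m₁ with pending := p, clock := m₁.clock + 2 * done.length } ∧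
        (∀ B, p 2 B = []) ∧ (∑ B, (p 1 B).length = done.length) ∧
        (∀ t B x, x ∈ p t B → G.nodeX x = B) ∧ ∀ x ∈ done, x ∈ p 1 (G.nodeX x)) I.inputs
      (f := fun x => pushPending 1 (G.nodeX x) x) (m := m₁) ?_ ?_
    · refine hsecond.mono fun _ m₂ h₂ => ?_
      obtain ⟨p, rfl, hp2, hp1, hpn, hpm⟩ := h₂
      have hi : ∀ y, m₁.initial y = true → ∃ x ∈ I.inputs.reverse, y ∈ I.succ x := by
        intro y hy
        by_contra hcon
        have := h₁.valid.initial y fun x => by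
          by_contra h0
          exact hcon ⟨x, by simp [I.mem_inputs], (I.mem_succ x y).2 h0⟩
        rw [hy] at this
        simp at this
      have hu : ∀ l, ∀ y ∈ (m.used l).map Prod.snd, ∃ x ∈ I.inputs.reverse, y ∈ I.succ x := by
        intro l y hy
        obtain ⟨e, he, rfl⟩ := List.mem_map.1 hy
        exact ⟨e.1, by simp [I.mem_inputs], (I.mem_succ _ _).2 (hT l e he)⟩
      refine ⟨⟨⟨?_, ?_, ?_, ?_, ?_, hpn, h₁.valid.dest⟩, h₁.used, hp2, ?_, ?_, ?_,
        h₁.valid.initial⟩, ?_⟩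
      · intro Ω _ l
        simp only [h₁.used]
        exact Transfers.refl Ω _
      · intro x
        have := h₁.inputs x (by simp [I.mem_inputs])
        exact Or.inl ⟨hpm x (by simp [I.mem_inputs]), this.2.1, this.2.2.1⟩
      · intro y hy hye
        simp only at hy hye
        rw [(h₁.outputs y (hi y hy)).2.1] at hye
        simp at hye
      · intro y hy _
        simp only [h₁.used]
        exact (h₁.outputs y (hi y hy)).2.2.1 hy
      · intro y
        simp only
        constructor
        · exact fun hy => (h₁.outputs y (hi y hy)).2.2.1 hy
        · exact fun hy => (h₁.outputs y (hu _ y hy)).2.2.2 hy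
      · simp only [hp1, List.length_reverse, I.length_inputs]
      · exact fun x => (h₁.inputs x (by simp [I.mem_inputs])).1
      · exact fun y hy => (h₁.outputs y (hi y hy)).1
      · have := h₁.clock
        rw [List.length_reverse, I.length_inputs] at this ⊢
        unfold resetTime
        simp only
        calc _ ≤ m.clock + Fintype.card X * (5 + d * (N + 5)) + 2 * Fintype.card X := by omega
          _ = _ := by ring
    · refine ⟨m₁.pending, by simp, fun B => ?_, ?_, h₁.valid.node, by simp⟩
      · rw [List.eq_nil_iff_forall_not_mem]
        intro x hx
        have h2 := (h₁.inputs x (by simp [I.mem_inputs])).2.2.2.2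
        rw [h₁.valid.node 2 B x hx] at h2
        rw [h2] at hx
        simp at hx
      · refine Finset.sum_eq_zero fun B _ => ?_
        rw [List.length_eq_zero_iff, List.eq_nil_iff_forall_not_mem]
        intro x hx
        have h2 := (h₁.inputs x (by simp [I.mem_inputs])).2.2.2.1
        rw [h₁.valid.node 1 B x hx] at h2
        rw [h2] at hx
        simp at hx
    · rintro x - done _ ⟨p, rfl, hp2, hp1, hpn, hpm⟩
      rw [runs_pushPending]
      refine ⟨_, by simp only [List.length_cons]; congr 1, fun B => by simpa using hp2 B, ?_,
        fun t B z hz => ?_, fun z hz => ?_⟩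
      · have := sum_update_length (p 1) (G.nodeX x) (x :: p 1 (G.nodeX x))
        rw [List.length_cons] at this
        simp only [Function.update_self, List.length_cons]
        omega
      · by_cases ht : t = 1
        · subst ht
          rw [Function.update_self] at hz
          by_cases hB : B = G.nodeX x
          · subst hB
            rw [Function.update_self] at hz
            rcases List.mem_cons.1 hz with rfl | hz
            · rfl
            · exact hpn 1 _ z hz
          · rw [Function.update_of_ne hB] at hz
            exact hpn 1 B z hz
        · rw [Function.update_of_ne ht] at hz
          exact hpn t B z hz
      · simp only [Function.update_self, Function.update_apply]
        rcases List.mem_cons.1 hz with rfl | hz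
        · simp
        · have := hpm z hz
          split_ifs with h
          · rw [← h]; exact List.mem_cons_of_mem _ this
          · exact this
  · intro x _ done m₁ h₁
    have h₂ := h₁.input x
    simp only [runs_bind] at h₂ ⊢
    refine h₂.mono fun _ m₂ h₂ => h₂.mono fun _ m₃ h₃ => h₃.mono fun _ m₄ h₄ => h₄.mono
      fun _ m₅ h₅ => h₅.mono fun _ m₆ h₆ => ?_
    have h₇ := runs_forM (fun ys => G.ResetState m.used (fun z => z = x ∨ z ∈ done)
      (fun y => y ∈ ys ∨ ∃ x ∈ done, y ∈ I.succ x)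
      (m.clock + done.length * (5 + d * (N + 5)) + 5 + ys.length * (N + 5))) (I.succ x)
      (f := fun y => do
        setExploredV (G.nodeY y) false
        setExploredY y false
        let U ← look fun m => m.used (G.layer (G.nodeX x))
        let u ← call (Timed.any (fun e => decide (e.2 = y)) U)
        setInitial y u) (m := m₆) ?_ ?_
    · refine h₇.mono fun _ m₈ h₈ => ?_
      refine ⟨h₈.valid, h₈.used, fun z hz => h₈.inputs z (List.mem_cons.1 hz),
        fun y hy => h₈.outputs y ?_, h₈.clock.trans ?_⟩
      · obtain ⟨z, hz, hzy⟩ := hy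
        rcases List.mem_cons.1 hz with rfl | hz
        · exact Or.inl (by simpa using hzy)
        · exact Or.inr ⟨z, hz, hzy⟩
      · have := Nat.mul_le_mul_right (N + 5) (hd x)
        rw [List.length_reverse, List.length_cons, Nat.add_mul]
        omega
    · simpa using h₆
    · intro y hy ys m₇ h₇
      refine (h₇.output ((I.mem_succ x y).1 hy) hN).mono fun _ m₈ h₈ => ?_
      refine ⟨h₈.valid, h₈.used, h₈.inputs, fun z hz => h₈.outputs z ?_, h₈.clock.trans ?_⟩
      · rcases hz with hz | hz
        · rcases List.mem_cons.1 hz with rfl | hz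
          · exact Or.inl rfl
          · exact Or.inr (Or.inl hz)
        · exact Or.inr (Or.inr hz)
      · rw [List.length_cons, Nat.add_mul]
        omega

end Reset

end ADTNetwork

/-! ### Flows and cuts -/

namespace ADTNetwork

section Count

theorem card_filter_eq_count {α β : Type} [Fintype α] [DecidableEq α] [DecidableEq β] (f : α → β)
    (l : List α) (hl : l.Nodup) (b : β) :
    (Finset.univ.filter fun a => a ∈ l ∧ f a = b).card = (l.map f).count b := by
  rw [List.count, List.countP_map, List.countP_eq_length_filter,
    ← List.toFinset_card_of_nodup (hl.filter _)]
  congr 1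
  ext a
  simp [Function.comp]

end Count

section Cut

variable {F V X Y : Type} [Field F] [DecidableEq V] [Fintype X] {G : ADTNetwork F V X Y} {k : ℕ}
  {used : ℕ → List (X × Y)} {Ω : Finset V}

/-- A combination of used inputs that vanishes on all used outputs is trivial. -/
theorem Excess.eq_zero {A : V} (h : G.Excess k A used) {c : X → F}
    (hc : ∀ x, c x ≠ 0 → x ∈ (used (G.layer (G.nodeX x))).map Prod.fst)
    (hcU : ∀ l, ∀ y ∈ (used l).map Prod.snd, Matrix.vecMul c G.T y = 0) : c = 0 := by
  funext x
  by_contra hx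
  set l := G.layer (G.nodeX x)
  have key : (fun z => if G.layer (G.nodeX z) = l then c z else 0) = (0 : X → F) := by
    refine (h.cut l).indep _ (fun z hz => ?_) fun y hy => ?_
    · by_cases hzl : G.layer (G.nodeX z) = l
      · rw [← hzl]
        refine hc z ?_
        rwa [if_pos hzl] at hz
      · rw [if_neg hzl] at hz
        exact absurd rfl hz
    · rw [← hcU l y hy]
      refine Finset.sum_congr rfl fun z _ => ?_
      by_cases hzl : G.layer (G.nodeX z) = l
      · simp only [if_pos hzl]
      · have hT : G.T z y = 0 := by
          by_contra hT
          have h1 := G.layer_edge z y hT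
          have h2 := (h.cut l).layerY hy
          omega
        simp only [hT, mul_zero]
  have := congrFun key x
  rw [if_pos rfl] at this
  exact hx this

variable [DecidableEq X] [Fintype Y] [DecidableEq Y]

/-- The used inputs in `Ω`. -/
def inputsIn (G : ADTNetwork F V X Y) (used : ℕ → List (X × Y)) (Ω : Finset V) : Finset X :=
  Finset.univ.filter fun x => x ∈ (used (G.layer (G.nodeX x))).map Prod.fst ∧ G.nodeX x ∈ Ω

/-- The used outputs in `Ω`. -/
def outputsIn (G : ADTNetwork F V X Y) (used : ℕ → List (X × Y)) (Ω : Finset V) : Finset Y :=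
  Finset.univ.filter fun y => y ∈ (used (G.layer (G.nodeY y) - 1)).map Prod.snd ∧ G.nodeY y ∈ Ω

/-- Flow conservation: the number of used inputs in a set that separates `S` from `D` exceeds the
number of used outputs in it by the value of the flow. -/
theorem Excess.card_inputsIn (h : G.Excess k G.S used) (hS : G.S ∈ Ω) (hD : G.D ∉ Ω) :
    (G.inputsIn used Ω).card = (G.outputsIn used Ω).card + k := by
  have h1 : (G.inputsIn used Ω).card =
      ∑ B ∈ Ω, (((used (G.layer B)).map Prod.fst).map G.nodeX).count B := by
    rw [Finset.card_eq_sum_card_fiberwise (f := G.nodeX) (t := Ω)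
      fun x hx => (Finset.mem_filter.1 (Finset.mem_coe.1 hx)).2.2]
    refine Finset.sum_congr rfl fun B hB => ?_
    rw [← card_filter_eq_count G.nodeX _ (h.cut _).nodup_fst]
    congr 1
    ext x
    simp only [inputsIn, Finset.mem_filter, Finset.mem_univ, true_and]
    constructor
    · rintro ⟨⟨hx, -⟩, rfl⟩
      exact ⟨hx, rfl⟩
    · rintro ⟨hx, rfl⟩
      exact ⟨⟨hx, hB⟩, rfl⟩
  have h2 : (G.outputsIn used Ω).card =
      ∑ B ∈ Ω, (((used (G.layer B - 1)).map Prod.snd).map G.nodeY).count B := by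
    rw [Finset.card_eq_sum_card_fiberwise (f := G.nodeY) (t := Ω)
      fun y hy => (Finset.mem_filter.1 (Finset.mem_coe.1 hy)).2.2]
    refine Finset.sum_congr rfl fun B hB => ?_
    rw [← card_filter_eq_count G.nodeY _ (h.cut _).nodup_snd]
    congr 1
    ext y
    simp only [outputsIn, Finset.mem_filter, Finset.mem_univ, true_and]
    constructor
    · rintro ⟨⟨hy, -⟩, rfl⟩
      exact ⟨hy, rfl⟩
    · rintro ⟨hy, rfl⟩
      exact ⟨⟨hy, hB⟩, rfl⟩
  have hl1 : G.layer G.S = 1 := (G.layer_eq_one _).2 rfl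
  have h3 : ∀ B ∈ Ω, (((used (G.layer B)).map Prod.fst).map G.nodeX).count B =
      (((used (G.layer B - 1)).map Prod.snd).map G.nodeY).count B + if B = G.S then k else 0 := by
    intro B hB
    by_cases hBS : B = G.S
    · subst hBS
      have hlen := h.length 1 le_rfl (by have := G.two_le_L; omega)
      rw [hl1, if_neg (lt_irrefl _)] at hlen
      rw [hl1, Nat.sub_self, (h.cut 0).eq_nil (Or.inl rfl), if_pos rfl, ← hlen]
      simp only [List.map_nil, List.count_nil, zero_add]
      rw [List.count_eq_length.2 fun B hB' => ?_, List.length_map, List.length_map]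
      obtain ⟨x, hx, rfl⟩ := List.mem_map.1 hB'
      exact ((G.layer_eq_one _).1 ((h.cut 1).layerX hx)).symm
    · have := h.conserve B hBS (fun h => hD (h ▸ hB))
      rw [if_neg hBS] at this ⊢
      exact this.symm
  rw [h1, h2, Finset.sum_congr rfl h3, Finset.sum_add_distrib, Finset.sum_ite_eq' Ω, if_pos hS]

variable (G) in
/-- The coefficients between the inputs in `P` and the outputs outside `Ω`. -/
def crossing (P : Finset X) (Ω : Finset V) : Matrix P Y F :=
  Matrix.of fun u v => if G.nodeY v ∈ Ω then 0 else G.T u v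

/-- A flow is bounded by the value of every cut. -/
theorem Excess.le_cutValue [DecidableEq F] (h : G.Excess k G.S used) (hS : G.S ∈ Ω) (hD : G.D ∉ Ω) :
    k ≤ G.cutValue Ω := by
  set P := G.inputsIn used Ω with hP
  set Q := G.outputsIn used Ω with hQ
  have hcard : P.card = Q.card + k := h.card_inputsIn hS hD
  have hPx : ∀ x ∈ P, x ∈ (used (G.layer (G.nodeX x))).map Prod.fst ∧ G.nodeX x ∈ Ω := fun x hx =>
    (Finset.mem_filter.1 hx).2
  let M₀ : Matrix P Y F := Matrix.of fun u v => if v ∈ Q then G.T u v else 0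
  let M₁ : Matrix P Y F := G.crossing P Ω
  -- the rows of `M₀ + M₁` are independent, since all used outputs are in `Q` or outside `Ω`
  have hind : LinearIndependent F (M₀ + M₁).row := by
    rw [Fintype.linearIndependent_iff]
    intro g hg u
    let c : X → F := fun x => if hx : x ∈ P then g ⟨x, hx⟩ else 0
    have hvec : ∀ v, Matrix.vecMul c G.T v = ∑ u : P, g u * G.T u v := by
      intro v
      rw [Matrix.vecMul, dotProduct, ← Finset.sum_subset (Finset.subset_univ P),
        ← Finset.sum_attach, Finset.univ_eq_attach]
      · exact Finset.sum_congr rfl fun u _ => by simp [c]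
      · intro x _ hx
        simp [c, hx]
    have hc : c = 0 := by
      refine h.eq_zero (fun x hx => ?_) fun l v hv => ?_
      · by_cases hxP : x ∈ P
        · exact (hPx x hxP).1
        · simp [c, hxP] at hx
      · have hlv := (h.cut l).layerY hv
        have hgv := congrFun hg v
        simp only [Finset.sum_apply, Pi.smul_apply, Pi.zero_apply, smul_eq_mul, Matrix.row,
          Matrix.add_apply] at hgv
        rw [hvec, ← hgv]
        refine Finset.sum_congr rfl fun u _ => ?_
        congr 1
        by_cases hvΩ : G.nodeY v ∈ Ω
        · have hvQ : v ∈ Q := by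
            simp only [hQ, outputsIn, Finset.mem_filter, Finset.mem_univ, true_and]
            rw [hlv, Nat.add_sub_cancel]
            exact ⟨hv, hvΩ⟩
          simp [M₀, M₁, crossing, hvΩ, hvQ]
        · have hvQ : v ∉ Q := fun hvQ => hvΩ (Finset.mem_filter.1 hvQ).2.2
          simp [M₀, M₁, crossing, hvΩ, hvQ]
    have := congrFun hc u
    simpa [c] using this
  have h0 : M₀.rank ≤ Q.card := by
    rw [← Matrix.rank_transpose]
    refine Matrix.rank_le_card_of_support_subset _ Q fun v hv => ?_
    by_contra hvQ
    refine hv ?_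
    funext u
    have : v ∉ Q := by simpa using hvQ
    simp [M₀, Matrix.row, this]
  -- `M₁` consists of rows and columns of the adjacency matrix of the cut and of zeros
  have h1 : M₁.rank ≤ G.cutValue Ω := by
    let E := G.cutEdges Ω
    let A : Matrix P {x // x ∈ E.image Prod.fst} F :=
      Matrix.of fun u r => if r.1 = u.1 then 1 else 0
    let B : Matrix {y // y ∈ E.image Prod.snd} Y F := Matrix.of fun s v => if s.1 = v then 1 else 0
    have hM : M₁ = A * G.adjacency E * B := by
      ext u v
      by_cases hE : (u.1, v) ∈ E
      · have hu : u.1 ∈ E.image Prod.fst := Finset.mem_image_of_mem Prod.fst hE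
        have hv : v ∈ E.image Prod.snd := Finset.mem_image_of_mem Prod.snd hE
        have hvΩ : G.nodeY v ∉ Ω := by
          simpa using (Finset.mem_filter.1 hE).2.2.2
        rw [Matrix.mul_apply, Finset.sum_eq_single ⟨v, hv⟩, Matrix.mul_apply,
          Finset.sum_eq_single ⟨u.1, hu⟩]
        · simp [A, B, adjacency, M₁, crossing, hvΩ]
        · intro r _ hr
          have : r.1 ≠ u.1 := fun h => hr (Subtype.ext h)
          simp [A, this]
        · simp
        · intro s _ hs
          have : s.1 ≠ v := fun h => hs (Subtype.ext h)
          simp [B, this]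
        · simp
      · have hl : M₁ u v = 0 := by
          simp only [M₁, crossing, Matrix.of_apply]
          split_ifs with hvΩ
          · rfl
          · by_contra hT
            exact hE (Finset.mem_filter.2 ⟨Finset.mem_univ _, hT, (hPx u.1 u.2).2, hvΩ⟩)
        rw [hl, Matrix.mul_apply]
        refine (Finset.sum_eq_zero fun s _ => ?_).symm
        by_cases hs : s.1 = v
        · rw [Matrix.mul_apply, Finset.sum_eq_zero, zero_mul]
          intro r _
          by_cases hr : r.1 = u.1
          · have hT : G.T r.1 s.1 = 0 := by
              by_contra hT
              obtain ⟨e, he, her⟩ := Finset.mem_image.1 s.2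
              have heΩ := (Finset.mem_filter.1 he).2.2.2
              rw [her, hs] at heΩ
              rw [hr, hs] at hT
              exact hE (Finset.mem_filter.2 ⟨Finset.mem_univ _, hT, (hPx u.1 u.2).2, heΩ⟩)
            simp [adjacency, hT]
          · simp [A, hr]
        · simp [B, hs]
    rw [hM]
    exact (Matrix.rank_mul_le_left _ _).trans (Matrix.rank_mul_le_right _ _)
  have h2 : (M₀ + M₁).rank ≤ M₀.rank + M₁.rank := by
    unfold Matrix.rank
    rw [Matrix.mulVecLin_add]
    exact (Submodule.finrank_mono (LinearMap.range_add_le _ _)).trans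
      (Submodule.finrank_add_le_finrank_add_finrank _ _)
  rw [hind.rank_matrix, Fintype.card_coe] at h2
  omega

/-- If a set that separates `S` from `D` is closed with respect to a flow, then its cut is tight:
the rows of its used inputs span those of all its inputs, and satisfy as many independent relations
as it has used outputs. -/
theorem Excess.cutValue_le [DecidableEq F] (h : G.Excess k G.S used) (hS : G.S ∈ Ω) (hD : G.D ∉ Ω)
    (hrow : ∀ x, G.nodeX x ∈ Ω → G.RowIn Ω (used (G.layer (G.nodeX x))) x)
    (hcl : ∀ y ∈ (used (G.layer (G.nodeY y) - 1)).map Prod.snd, G.nodeY y ∈ Ω →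
      G.YClosed Ω (used (G.layer (G.nodeY y) - 1)) y) : G.cutValue Ω ≤ k := by
  set P := G.inputsIn used Ω with hP
  set Q := G.outputsIn used Ω with hQ
  have hcard : P.card = Q.card + k := h.card_inputsIn hS hD
  let M₁ : Matrix P Y F := G.crossing P Ω
  -- combinations of used inputs in one layer
  have hmem : ∀ (l : ℕ) (c : X → F),
      (∀ u, c u ≠ 0 → u ∈ (used l).map Prod.fst ∧ G.nodeX u ∈ (Ω : Set V)) → ∀ v,
      Matrix.vecMul c G.T v = ∑ u : P, c u * G.T u v := by
    intro l c hc v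
    rw [Matrix.vecMul, dotProduct, ← Finset.sum_subset (Finset.subset_univ P), ← Finset.sum_attach,
      Finset.univ_eq_attach]
    intro x _ hx
    have : c x = 0 := by
      by_contra h0
      obtain ⟨h1, h2⟩ := hc x h0
      refine hx (Finset.mem_filter.2 ⟨Finset.mem_univ _, ?_, h2⟩)
      rwa [(h.cut l).layerX h1]
    rw [this, zero_mul]
  -- the rows of the cut are combinations of the rows of `M₁`
  have h1 : G.cutValue Ω ≤ M₁.rank := by
    let E := G.cutEdges Ω
    have hEx : ∀ r : {x // x ∈ E.image Prod.fst}, G.nodeX r.1 ∈ Ω := by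
      intro r
      obtain ⟨e, he, her⟩ := Finset.mem_image.1 r.2
      rw [← her]
      exact (Finset.mem_filter.1 he).2.2.1
    have hEy : ∀ s : {y // y ∈ E.image Prod.snd}, G.nodeY s.1 ∉ Ω := by
      intro s
      obtain ⟨e, he, hes⟩ := Finset.mem_image.1 s.2
      rw [← hes]
      exact (Finset.mem_filter.1 he).2.2.2
    choose c hc1 hc2 using fun r : {x // x ∈ E.image Prod.fst} => hrow r.1 (hEx r)
    let A : Matrix {x // x ∈ E.image Prod.fst} P F := Matrix.of fun r u => c r u
    have hM : G.adjacency E = (A * M₁).submatrix id Subtype.val := by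
      ext r s
      have := hc2 r s.1 (by simpa using hEy s)
      rw [hmem _ _ (hc1 r)] at this
      simp only [adjacency, Matrix.submatrix_apply, id_eq, Matrix.mul_apply]
      rw [← this]
      refine Finset.sum_congr rfl fun u _ => ?_
      simp [A, M₁, crossing, hEy s]
    unfold cutValue
    rw [show G.adjacency (G.cutEdges Ω) = (A * M₁).submatrix id Subtype.val from hM]
    exact (Matrix.rank_submatrix_le _ _ _).trans (Matrix.rank_mul_le_right _ _)
  have hQy : ∀ y : Q, y.1 ∈ (used (G.layer (G.nodeY y.1) - 1)).map Prod.snd ∧ G.nodeY y.1 ∈ Ω :=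
    fun y => (Finset.mem_filter.1 y.2).2
  choose c hc1 hc2 hc3 hc4 using fun y : Q => hcl y.1 (hQy y).1 (hQy y).2
  let C : Matrix Q P F := Matrix.of fun y u => c y u
  -- every used output in `Ω` provides a relation between the rows of `M₁`
  have hCM : C * M₁ = 0 := by
    ext y v
    rw [Matrix.mul_apply, Matrix.zero_apply]
    by_cases hv : G.nodeY v ∈ Ω
    · exact Finset.sum_eq_zero fun u _ => by simp [M₁, crossing, hv]
    · rw [← hc2 y v (by simpa using hv), hmem _ _ (hc1 y)]
      exact Finset.sum_congr rfl fun u _ => by simp [C, M₁, crossing, hv]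
  -- these relations are independent: on the used outputs in `Ω` they form a diagonal matrix
  have hC : Q.card ≤ C.rank := by
    let B : Matrix P Q F := Matrix.of fun u y => G.T u y
    have hCB : C * B = Matrix.diagonal fun y : Q => Matrix.vecMul (c y) G.T y := by
      ext y z
      have hyz : (C * B) y z = Matrix.vecMul (c y) G.T z := by
        rw [Matrix.mul_apply, hmem _ _ (hc1 y)]
        rfl
      rw [hyz]
      by_cases hne : y = z
      · rw [hne, Matrix.diagonal_apply_eq]
      · rw [Matrix.diagonal_apply_ne _ hne]
        by_cases hl : G.layer (G.nodeY z.1) - 1 = G.layer (G.nodeY y.1) - 1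
        · exact hc3 y z.1 (hl ▸ (hQy z).1) fun h => hne (Subtype.ext h.symm)
        · refine Finset.sum_eq_zero fun u _ => ?_
          by_cases hcu : c y u = 0
          · rw [hcu, zero_mul]
          · have hT : G.T u z = 0 := by
              by_contra hT
              have h1 := G.layer_edge _ _ hT
              have h2 := (h.cut _).layerX (hc1 y u hcu).1
              omega
            simp only [hT, mul_zero]
    have hrank : (C * B).rank = Q.card := by
      rw [hCB, Matrix.rank_diagonal, Fintype.card_subtype,
        Finset.filter_true_of_mem fun y _ => hc4 y, Finset.card_univ, Fintype.card_coe]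
    rw [← hrank]
    exact Matrix.rank_mul_le_left _ _
  have h2 := Matrix.rank_add_rank_le_card_of_mul_eq_zero hCM
  rw [Fintype.card_coe] at h2
  omega

end Cut

end ADTNetwork

/-! ### Iterations -/

namespace ADTNetwork

open UnicastProg

section Capacity

variable {F V X Y : Type} [Field F] [DecidableEq F] [DecidableEq V] [Fintype X] [DecidableEq X]
  [Fintype Y] [DecidableEq Y] {G : ADTNetwork F V X Y} {k : ℕ} {used : ℕ → List (X × Y)}

theorem Excess.le_capacity (h : G.Excess k G.S used) : k ≤ G.capacity := by
  refine le_csInf ⟨_, {G.S}, by simp, by simpa using S_ne_D.symm, rfl⟩ ?_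
  rintro _ ⟨Ω, hS, hD, rfl⟩
  exact h.le_cutValue hS hD

theorem capacity_le {Ω : Finset V} (hS : G.S ∈ Ω) (hD : G.D ∉ Ω) : G.capacity ≤ G.cutValue Ω :=
  Nat.sInf_le ⟨Ω, hS, hD, rfl⟩

end Capacity

section Iteration

variable {F V X Y : Type} [Field F] [DecidableEq F] [Fintype V] [Fintype X]
  [DecidableEq X] [Fintype Y] [DecidableEq Y] {G : ADTNetwork F V X Y} {I : G.Listing}
  {k d N : ℕ} {m : UnicastMemory F V X Y}

/-- A bound for the number of steps of an iteration, for a flow of value less than `N`. -/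
def iterationTime (nX N d : ℕ) : ℕ :=
  resetTime nX N d + (enterCost N * (nX * d) + backwardCost N d * nX + typeOneCost N d * nX)
    + enterCost N

/-- There are at most `|X| d` edges, at most `|X|` used outputs, as they are matched with inputs,
and `|X|` pending inputs of type 1. -/
theorem Start.potential_le {U₀ : ℕ → List (X × Y)} (h : G.Start U₀ m)
    (hd : ∀ x, (I.succ x).length ≤ d) (hU : ∀ l, G.IsRegularCut l (U₀ l)) :
    G.potential N d m.exploredV m.exploredY m.initial m.pending ≤
      enterCost N * (Fintype.card X * d) + backwardCost N d * Fintype.card X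
        + typeOneCost N d * Fintype.card X := by
  have h1 : (Finset.univ.filter fun e : X × Y =>
      G.T e.1 e.2 ≠ 0 ∧ m.exploredV (G.nodeY e.2) = false).card ≤ Fintype.card X * d := by
    refine le_trans (Finset.card_le_card (t := Finset.univ.biUnion fun x =>
      (I.succ x).toFinset.image fun y => (x, y)) fun e he => ?_)
      (Finset.card_biUnion_le_card_mul _ _ _ fun x _ => ?_)
    · have := (Finset.mem_filter.1 he).2.1
      simp only [Finset.mem_biUnion, Finset.mem_univ, true_and, Finset.mem_image,
        List.mem_toFinset, I.mem_succ]
      exact ⟨e.1, e.2, this, rfl⟩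
    · exact Finset.card_image_le.trans ((List.toFinset_card_le _).trans (hd x))
  have h2 : (Finset.univ.filter fun y : Y => m.initial y = true ∧ m.exploredY y = false).card ≤
      Fintype.card X * 1 := by
    refine le_trans (Finset.card_le_card (t := Finset.univ.biUnion fun x =>
      (((U₀ (G.layer (G.nodeX x))).filter fun e => decide (e.1 = x)).map Prod.snd).toFinset)
      fun y hy => ?_) (Finset.card_biUnion_le_card_mul _ _ _ fun x _ => ?_)
    · have := (h.labels.initial y).1 (Finset.mem_filter.1 hy).2.1
      obtain ⟨e, he, hey⟩ := List.mem_map.1 this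
      simp only [Finset.mem_biUnion, Finset.mem_univ, true_and, List.mem_toFinset, List.mem_map,
        List.mem_filter, decide_eq_true_eq]
      refine ⟨e.1, e, ⟨?_, rfl⟩, hey⟩
      rwa [(hU _).layer e he]
    · refine (List.toFinset_card_le _).trans ?_
      have := List.nodup_iff_count_le_one.1 (hU (G.layer (G.nodeX x))).nodup_fst x
      rw [List.count, List.countP_map, List.countP_eq_length_filter] at this
      rw [List.length_map]
      exact this
  have h3 : ∑ B, (m.pending 2 B).length = 0 :=
    Finset.sum_eq_zero fun B _ => by rw [h.pending_two B, List.length_nil]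
  have h4 := Nat.mul_le_mul_left (enterCost N) h1
  have h5 := Nat.mul_le_mul_left (backwardCost N d) h2
  rw [Nat.mul_one] at h5
  unfold potential
  rw [h.pending_one, h3, Nat.mul_zero]
  omega

variable [DecidableEq V]

/-- After a failed iteration, the explored nodes form a cut whose value is that of the flow. -/
theorem Failure.capacity_le {U₀ : ℕ → List (X × Y)} {m' : UnicastMemory F V X Y}
    (h : G.Start U₀ m) (hE : G.Excess k G.S U₀) (hf : G.Failure U₀ (fun _ => True) m m')
    (hS : m'.exploredV G.S = true) : G.capacity ≤ k := by
  let Ω : Finset V := Finset.univ.filter fun B => m'.exploredV B = true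
  have hΩ : ∀ B, B ∈ Ω ↔ m'.exploredV B = true := fun B => by simp [Ω]
  have hyp : Hyp (fun _ => True) m'.exploredV (Ω : Set V) := ⟨fun B hB => by simpa [hΩ], trivial⟩
  have hD : G.D ∉ Ω := by rw [hΩ, hf.labels.dest]; simp
  refine (ADTNetwork.capacity_le ((hΩ _).2 hS) hD).trans
    (hE.cutValue_le ((hΩ _).2 hS) hD (fun x hx => ?_) fun y hy hyΩ => ?_)
  · rcases hf.progress.finished _ ((hΩ _).1 hx) with h1 | h1
    · rw [h.inputs x] at h1
      simp at h1
    · rcases hf.labels.row x with h2 | h2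
      · rw [h1.1] at h2
        simp at h2
      · exact h2 _ hyp (by simpa using hx)
  · have hi := (hf.labels.initial y).2 hy
    rcases hf.progress.finished _ ((hΩ _).1 hyΩ) with h1 | h1
    · rw [h.outputs y (hf.progress.initial ▸ hi)] at h1
      simp at h1
    · exact (hf.labels.closed y hi (h1.2 y rfl hi)).2 _ hyp

/-- An iteration increases the value of the flow by one, or the flow is maximal. -/
theorem iteration_spec (hd : ∀ x, (I.succ x).length ≤ d) (hm : G.Valid m)
    (hE : G.Excess k G.S m.used) :
    Runs (do reset I; exploreNode I G.S) m fun r m' =>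
      m'.clock ≤ m.clock + iterationTime (Fintype.card X) (k + 1) d ∧ G.Valid m' ∧
      (r = true → G.Excess (k + 1) G.S m'.used) ∧
      (r = false → m'.used = m.used ∧ G.capacity ≤ k) := by
  rw [runs_bind]
  refine (reset_spec hd hm hE.length_le fun l => (hE.cut l).edge).mono fun _ m₁ ⟨hst, hc⟩ => ?_
  refine ((specification hd _).node (fun _ => True) G.S m₁ (by rw [hst.used]; exact hE) hst.labels
    S_ne_D ⟨fun B _ => hst.pending_two B, Or.inl (hst.pending_two _)⟩ le_rfl).mono
    fun r m' hpost => ?_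
  have h1 := hst.potential_le (N := k + 1) hd hE.cut
  have h2 := potential_exploreV_le (G := G) (N := k + 1) (d := d) (eV := m₁.exploredV)
    (eY := m₁.exploredY) (ini := m₁.initial) (pend := m₁.pending) G.S
  have h3 := hpost.1
  simp only [totalCost] at h3
  refine ⟨?_, ?_, fun hr => (hpost.2.1 hr).flow, fun hr => ?_⟩
  · unfold iterationTime
    omega
  · cases r with
    | true =>
      have hs := hpost.2.1 rfl
      exact ⟨hs.node, hs.dest, fun y hy => hs.initial ▸ hst.initial y hy⟩
    | false =>
      obtain ⟨hf, -⟩ := hpost.2.2 rfl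
      exact ⟨hf.labels.node, hf.labels.dest, fun y hy => hf.progress.initial ▸ hst.initial y hy⟩
  · obtain ⟨hf, hR⟩ := hpost.2.2 hr
    exact ⟨hf.used.trans hst.used, hf.capacity_le hst hE hR.1⟩

theorem iterationTime_mono {nX N N' d : ℕ} (h : N ≤ N') :
    iterationTime nX N d ≤ iterationTime nX N' d := by
  unfold iterationTime resetTime backwardCost typeOneCost sameLayerCost enterCost typeTwoCost
    forwardCost releaseTime combineTime alternatingTime rematchTime
  gcongr

/-- A flow of value `k` becomes maximal after `C + 1 - k` iterations, the last of which fails. -/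
theorem iterate_spec (hd : ∀ x, (I.succ x).length ≤ d) (hm : G.Valid m)
    (hE : G.Excess k G.S m.used) :
    Runs (iterate I) m fun _ m' => G.Excess G.capacity G.S m'.used ∧
      m'.clock ≤ m.clock + (G.capacity + 1 - k) *
        iterationTime (Fintype.card X) (G.capacity + 1) d := by
  obtain ⟨j, hj⟩ := Nat.exists_eq_add_of_le hE.le_capacity
  induction j generalizing k m with
  | zero =>
    rw [iterate.eq_1]
    have h := iteration_spec hd hm hE
    rw [runs_bind] at h ⊢
    refine h.mono fun _ m₁ h => ?_
    rw [runs_bind]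
    refine h.mono fun r m₂ ⟨hc, hv, h1, h2⟩ => ?_
    cases r with
    | true =>
      have := (h1 rfl).le_capacity
      omega
    | false =>
      have hk : G.capacity = k := hj
      simp only [Bool.false_eq_true, if_false, runs_pure]
      rw [hk]
      refine ⟨(h2 rfl).1 ▸ hE, ?_⟩
      rwa [Nat.add_sub_cancel_left, Nat.one_mul]
  | succ j ih =>
    rw [iterate.eq_1]
    have h := iteration_spec hd hm hE
    rw [runs_bind] at h ⊢
    refine h.mono fun _ m₁ h => ?_
    rw [runs_bind]
    refine h.mono fun r m₂ ⟨hc, hv, h1, h2⟩ => ?_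
    cases r with
    | true =>
      rw [if_pos rfl]
      refine (ih hv (h1 rfl) (by omega)).mono fun _ m₃ ⟨h3, h4⟩ => ⟨h3, ?_⟩
      have h5 := iterationTime_mono (nX := Fintype.card X) (d := d)
        (show k + 1 ≤ G.capacity + 1 by omega)
      rw [show G.capacity + 1 - k = (G.capacity + 1 - (k + 1)) + 1 by omega, Nat.add_mul,
        Nat.one_mul]
      omega
    | false =>
      have := (h2 rfl).2
      omega

end Iteration

end ADTNetwork

/-! ### Linearly independent paths and flows -/

namespace ADTNetwork

section Rank

variable {F V X Y : Type} [Field F] [Fintype X] [DecidableEq X] [DecidableEq Y]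
  {G : ADTNetwork F V X Y}

/-- The rows of the adjacency matrix of a list of edges are linearly independent if and only if its
rank is the number of rows. -/
theorem independent_iff_rank (U : List (X × Y)) : G.Independent U ↔
    (G.adjacency U.toFinset).rank = (U.toFinset.image Prod.fst).card := by
  have hX : ∀ x, x ∈ U.toFinset.image Prod.fst ↔ x ∈ U.map Prod.fst := fun x => by simp
  have hY : ∀ y, y ∈ U.toFinset.image Prod.snd ↔ y ∈ U.map Prod.snd := fun y => by simp
  have hrank : (G.adjacency U.toFinset).rank = (U.toFinset.image Prod.fst).card ↔
      LinearIndependent F (G.adjacency U.toFinset).row := by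
    rw [linearIndependent_iff_card_eq_finrank_span, Set.finrank, ← Matrix.rank_eq_finrank_span_row,
      Fintype.card_coe, eq_comm]
  rw [hrank, Fintype.linearIndependent_iff]
  set R := U.toFinset.image Prod.fst with hR
  have hvec : ∀ c : X → F, (∀ x, c x ≠ 0 → x ∈ R) → ∀ v,
      Matrix.vecMul c G.T v = ∑ u : R, c u * G.T u v := by
    intro c hc v
    rw [Matrix.vecMul, dotProduct, ← Finset.sum_subset (Finset.subset_univ R), ← Finset.sum_attach,
      Finset.univ_eq_attach]
    intro x _ hx
    rw [not_not.1 (mt (hc x) hx), zero_mul]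
  constructor
  · intro h g hg u
    let c : X → F := fun x => if hx : x ∈ R then g ⟨x, hx⟩ else 0
    have hcR : ∀ x, c x ≠ 0 → x ∈ R := by
      intro x hx
      by_contra hxR
      simp [c, hxR] at hx
    have hc : c = 0 := by
      refine h c (fun x hx => (hX x).1 (hcR x hx)) fun y hy => ?_
      have := congrFun hg ⟨y, (hY y).2 hy⟩
      simp only [Finset.sum_apply, Pi.smul_apply, Pi.zero_apply, smul_eq_mul, Matrix.row] at this
      rw [hvec c hcR, ← this]
      exact Finset.sum_congr rfl fun u _ => by simp [c, adjacency]
    have := congrFun hc u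
    simpa [c] using this
  · intro h c hc hcU
    have hcR : ∀ x, c x ≠ 0 → x ∈ R := fun x hx => (hX x).2 (hc x hx)
    have h0 := h (fun u => c u) (by
      funext s
      simp only [Finset.sum_apply, Pi.smul_apply, Pi.zero_apply, smul_eq_mul, Matrix.row]
      rw [← hcU s.1 ((hY _).1 s.2), hvec c hcR]
      exact Finset.sum_congr rfl fun u _ => by simp [adjacency])
    funext x
    by_contra hx
    exact hx (h0 ⟨x, hcR x hx⟩)

theorem IsRegularCut.card {l : ℕ} {U : List (X × Y)} (h : G.IsRegularCut l U) :
    U.toFinset.card = U.length ∧ (G.adjacency U.toFinset).rank = U.length := by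
  refine ⟨List.toFinset_card_of_nodup h.nodup_fst.of_map, ?_⟩
  rw [(independent_iff_rank U).1 h.indep,
    show U.toFinset.image Prod.fst = (U.map Prod.fst).toFinset by ext; simp,
    List.toFinset_card_of_nodup h.nodup_fst, List.length_map]

/-- A set of `k` edges whose adjacency matrix has rank `k` is a matching. -/
theorem IsRegularCut.of_rank {l : ℕ} {U : List (X × Y)} (hT : ∀ e ∈ U, G.T e.1 e.2 ≠ 0)
    (hl : ∀ e ∈ U, G.layer (G.nodeX e.1) = l) (hc : U.toFinset.card = U.length)
    (hr : (G.adjacency U.toFinset).rank = U.length) : G.IsRegularCut l U := by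
  have hnd : U.Nodup := by
    rw [← List.dedup_eq_self]
    exact (List.dedup_sublist U).eq_of_length (by rw [← List.card_toFinset, hc])
  have h1 : U.length ≤ (U.toFinset.image Prod.fst).card := by
    rw [← hr, ← Fintype.card_coe]
    exact Matrix.rank_le_card_height _
  have h2 : U.length ≤ (U.toFinset.image Prod.snd).card := by
    rw [← hr, ← Fintype.card_coe]
    exact Matrix.rank_le_card_width _
  have h1' : (U.toFinset.image Prod.fst).card = U.toFinset.card :=
    le_antisymm Finset.card_image_le (hc ▸ h1)
  have h2' : (U.toFinset.image Prod.snd).card = U.toFinset.card :=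
    le_antisymm Finset.card_image_le (hc ▸ h2)
  refine ⟨hT, hl, hnd.map_on fun e he e' he' h => ?_, hnd.map_on fun e he e' he' h => ?_,
    (independent_iff_rank U).2 (by rw [h1', hc, hr])⟩
  · exact Finset.injOn_of_card_image_eq h1' (by simpa using he) (by simpa using he') h
  · exact Finset.injOn_of_card_image_eq h2' (by simpa using he) (by simpa using he') h

end Rank

section Paths

variable {F V X Y : Type} [Field F] {G : ADTNetwork F V X Y}

/-- `p` is a path from the node `A` to `D`. -/
structure IsPathFrom (G : ADTNetwork F V X Y) (A : V) (p : List (X × Y)) : Prop where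
  edge : ∀ e ∈ p, G.T e.1 e.2 ≠ 0
  chain : p.IsChain fun e e' => G.nodeY e.2 = G.nodeX e'.1
  head : (p.head?.map fun e => G.nodeX e.1) = some A
  last : (p.getLast?.map fun e => G.nodeY e.2) = some G.D

theorem isPath_iff {p : List (X × Y)} : G.IsPath p ↔ G.IsPathFrom G.S p :=
  ⟨fun h => ⟨h.1, h.2.1, h.2.2.1, h.2.2.2⟩, fun h => ⟨h.edge, h.chain, h.head, h.last⟩⟩

theorem isPathFrom_singleton {e : X × Y} :
    G.IsPathFrom (G.nodeX e.1) [e] ↔ G.T e.1 e.2 ≠ 0 ∧ G.nodeY e.2 = G.D := by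
  constructor
  · intro h
    exact ⟨h.edge e (by simp), by simpa using h.last⟩
  · intro h
    exact ⟨by simpa using h.1, by simp, by simp, by simpa using h.2⟩

theorem isPathFrom_cons {e : X × Y} {p : List (X × Y)} (hp : p ≠ []) :
    G.IsPathFrom (G.nodeX e.1) (e :: p) ↔ G.T e.1 e.2 ≠ 0 ∧ G.IsPathFrom (G.nodeY e.2) p := by
  obtain ⟨e', p, rfl⟩ := List.exists_cons_of_ne_nil hp
  constructor
  · intro h
    have h2 := List.isChain_cons_cons.1 h.chain
    exact ⟨h.edge e (by simp), fun a ha => h.edge a (by simp [ha]), h2.2, by simp [h2.1],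
      by simpa using h.last⟩
  · rintro ⟨h1, h2⟩
    refine ⟨fun a ha => ?_, List.isChain_cons_cons.2 ⟨?_, h2.chain⟩, by simp,
      by simpa using h2.last⟩
    · rcases List.mem_cons.1 ha with rfl | ha
      · exact h1
      · exact h2.edge a ha
    · simpa using h2.head.symm

/-- Induction on paths to `D`. -/
theorem IsPathFrom.induction {P : V → List (X × Y) → Prop}
    (h1 : ∀ e : X × Y, G.T e.1 e.2 ≠ 0 → G.nodeY e.2 = G.D → P (G.nodeX e.1) [e])
    (h2 : ∀ (e : X × Y) (p : List (X × Y)), G.T e.1 e.2 ≠ 0 → G.IsPathFrom (G.nodeY e.2) p →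
      P (G.nodeY e.2) p → P (G.nodeX e.1) (e :: p)) {A : V} {p : List (X × Y)}
    (h : G.IsPathFrom A p) : P A p := by
  induction p generalizing A with
  | nil => simpa using h.head
  | cons e p ih =>
    obtain rfl : G.nodeX e.1 = A := by simpa using h.head
    by_cases hp : p = []
    · subst hp
      obtain ⟨h3, h4⟩ := isPathFrom_singleton.1 h
      exact h1 e h3 h4
    · obtain ⟨h3, h4⟩ := (isPathFrom_cons hp).1 h
      exact h2 e p h3 h4 (ih h4)

/-- A path leaves as many nodes as it enters, up to its end points. -/
theorem IsPathFrom.map_nodeX {A : V} {p : List (X × Y)} (h : G.IsPathFrom A p) :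
    (p.map fun e => G.nodeX e.1) ++ [G.D] = A :: p.map fun e => G.nodeY e.2 := by
  refine h.induction (P := fun A p =>
    (p.map fun e => G.nodeX e.1) ++ [G.D] = A :: p.map fun e => G.nodeY e.2) ?_ ?_
  · intro e _ h
    simp [h]
  · intro e p _ _ ih
    simp [ih]

/-- A path has one edge in every layer cut. -/
theorem IsPathFrom.map_layer {A : V} {p : List (X × Y)} (h : G.IsPathFrom A p) :
    (p.map fun e => G.layer (G.nodeX e.1)) = List.range' (G.layer A) (G.L - G.layer A) := by
  refine h.induction (P := fun A p =>
    (p.map fun e => G.layer (G.nodeX e.1)) = List.range' (G.layer A) (G.L - G.layer A)) ?_ ?_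
  · intro e hT h
    have h1 := G.layer_edge _ _ hT
    rw [h, (G.layer_eq_L _).2 rfl] at h1
    rw [h1, Nat.add_sub_cancel_left]
    simp
  · intro e p hT hp ih
    have h1 := G.layer_edge _ _ hT
    have h2 := G.layer_le (G.nodeY e.2)
    rw [List.map_cons, ih, h1, show G.L - G.layer (G.nodeX e.1) =
      G.L - (G.layer (G.nodeX e.1) + 1) + 1 by omega, List.range'_succ]

theorem IsPathFrom.countP_layer {p : List (X × Y)} (h : G.IsPathFrom G.S p) {l : ℕ} (h1 : 1 ≤ l)
    (h2 : l < G.L) : p.countP (fun e => decide (G.layer (G.nodeX e.1) = l)) = 1 := by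
  have h3 := congrArg (List.count l) h.map_layer
  rw [(G.layer_eq_one _).2 rfl, List.count_eq_one_of_mem (List.nodup_range' 1)
    (List.mem_range'_1.2 ⟨h1, by omega⟩), List.count, List.countP_map] at h3
  rw [← h3]
  exact List.countP_congr fun e _ => by simp

theorem IsPathFrom.countP_node [DecidableEq V] {p : List (X × Y)} (h : G.IsPathFrom G.S p) {B : V}
    (hS : B ≠ G.S) (hD : B ≠ G.D) : p.countP (fun e => decide (G.nodeX e.1 = B)) =
      p.countP fun e => decide (G.nodeY e.2 = B) := by
  have h3 := congrArg (List.count B) h.map_nodeX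
  rw [List.count_append, List.count_cons_of_ne hS.symm, List.count_eq_zero_of_not_mem (l := [G.D])
    (by simpa using hD), Nat.add_zero] at h3
  simp only [List.count, List.countP_map] at h3
  calc _ = _ := List.countP_congr fun e _ => by simp
    _ = _ := h3
    _ = _ := List.countP_congr fun e _ => by simp

theorem countP_flatten_congr {P : List (List (X × Y))} {f g : X × Y → Bool}
    (h : ∀ p ∈ P, p.countP f = p.countP g) : P.flatten.countP f = P.flatten.countP g := by
  rw [List.countP_flatten, List.countP_flatten, List.map_congr_left h]

/-- Linearly independent paths form a flow. -/
theorem excess_of_paths [DecidableEq V] [Fintype X] [DecidableEq X] [DecidableEq Y]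
    {P : List (List (X × Y))} (hP : ∀ p ∈ P, G.IsPath p) (h : G.LinIndepPaths P) :
    G.Excess P.length G.S
      fun l => P.flatten.filter fun e => decide (G.layer (G.nodeX e.1) = l) := by
  have hT : ∀ e ∈ P.flatten, G.T e.1 e.2 ≠ 0 := by
    intro e he
    obtain ⟨p, hp, hep⟩ := List.mem_flatten.1 he
    exact (hP p hp).1 e hep
  have hlen : ∀ l, 1 ≤ l → l < G.L →
      (P.flatten.filter fun e => decide (G.layer (G.nodeX e.1) = l)).length = P.length := by
    intro l h1 h2
    rw [← List.countP_eq_length_filter, List.countP_flatten, List.map_congr_left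
      fun p hp => (isPath_iff.1 (hP p hp)).countP_layer h1 h2]
    simp
  refine ⟨fun l => ?_, fun l h1 h2 => ?_, fun B hS hD => ?_⟩
  · by_cases hl : 1 ≤ l ∧ l < G.L
    · have hset : (P.flatten.filter fun e => decide (G.layer (G.nodeX e.1) = l)).toFinset =
          G.layerEdges P l := by
        ext e
        simp only [layerEdges, List.mem_toFinset, List.mem_filter, Finset.mem_filter,
          decide_eq_true_eq]
      obtain ⟨h1, h2⟩ := h l hl.1 hl.2
      exact IsRegularCut.of_rank (fun e he => hT e (List.mem_of_mem_filter he))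
        (fun e he => by simpa using List.of_mem_filter he)
        (by rw [hset, h1, hlen l hl.1 hl.2]) (by rw [hset, h2, hlen l hl.1 hl.2])
    · rw [List.filter_eq_nil_iff.2 fun e he => ?_]
      · exact ⟨by simp, by simp, by simp, by simp,
          fun c hc _ => funext fun x => by_contra fun hx => by simpa using hc x hx⟩
      · have h1 := G.layer_edge _ _ (hT e he)
        have h2 := G.layer_le (G.nodeY e.2)
        have h3 := G.one_le_layer (G.nodeX e.1)
        simp only [decide_eq_true_eq]
        omega
  · rw [hlen l h1 h2, if_neg (by rw [(G.layer_eq_one _).2 rfl]; omega)]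
  · have h1 := one_lt_layer hS
    rw [if_neg hS, Nat.add_zero]
    simp only [List.count, List.countP_map, List.countP_filter]
    calc _ = P.flatten.countP fun e => decide (G.nodeY e.2 = B) := by
          refine List.countP_congr fun e he => ?_
          have h2 := G.layer_edge _ _ (hT e he)
          simp only [Function.comp_apply, Bool.and_eq_true, beq_iff_eq, decide_eq_true_eq]
          constructor
          · exact fun h => h.1
          · rintro rfl
            exact ⟨rfl, by omega⟩
      _ = P.flatten.countP fun e => decide (G.nodeX e.1 = B) :=
          (countP_flatten_congr fun p hp => (isPath_iff.1 (hP p hp)).countP_node hS hD).symm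
      _ = _ := by
          refine List.countP_congr fun e he => ?_
          simp only [Function.comp_apply, Bool.and_eq_true, beq_iff_eq, decide_eq_true_eq]
          constructor
          · rintro rfl
            exact ⟨rfl, rfl⟩
          · exact fun h => h.1

end Paths

section Assemble

variable {F V X Y : Type} [Field F] {G : ADTNetwork F V X Y}

/-- The partial paths in `P` consist of the used edges in the layer cuts from `l` on. -/
structure PartialPaths (G : ADTNetwork F V X Y) (used : ℕ → List (X × Y)) (l : ℕ)
    (P : List (List (X × Y))) : Prop where
  path : ∀ p ∈ P, ∃ A, G.IsPathFrom A p
  heads : (P.map List.head?).Perm ((used l).map some)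
  edges : ∀ e, e ∈ P.flatten ↔ ∃ l', l ≤ l' ∧ e ∈ used l'

theorem PartialPaths.length {used : ℕ → List (X × Y)} {P : List (List (X × Y))} {l : ℕ}
    (h : G.PartialPaths used l P) : P.length = (used l).length := by
  simpa using h.heads.length_eq

variable [DecidableEq V]

theorem prependEdges_time (P : List (List (X × Y))) (U : List (X × Y)) {n : ℕ} (hU : U.length ≤ n) :
    (G.prependEdges P U).time ≤ P.length * (n + 2) + 1 := by
  induction P generalizing U with
  | nil => simp [prependEdges]
  | cons p P ih =>
    rw [prependEdges.eq_def]
    cases p with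
    | nil => simp only [Timed.time_bind, Timed.time_step, Timed.time_pure]; omega
    | cons e p =>
      have h1 := Timed.extract_time (fun e' : X × Y => decide (G.nodeY e'.2 = G.nodeX e.1)) U
      simp only [Timed.time_bind, Timed.time_step, List.length_cons]
      rw [Nat.add_mul]
      cases hv : (Timed.extract (fun e' : X × Y => decide (G.nodeY e'.2 = G.nodeX e.1)) U).val with
      | none => simp only [Timed.time_pure]; omega
      | some r =>
        obtain ⟨e', U'⟩ := r
        have h2 := (Timed.extract_eq_some hv).2.length_eq
        rw [List.length_cons] at h2
        have h3 := ih U' (by omega)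
        simp only [Timed.time_bind, Timed.time_pure]
        omega

/-- If the starting nodes of the partial paths match the end nodes of the edges, then every partial
path is prolonged and every edge is used once. -/
theorem prependEdges_spec (P : List (List (X × Y))) (U : List (X × Y))
    (h : (P.map fun p => p.head?.map fun e => G.nodeX e.1).Perm
      (U.map fun e => some (G.nodeY e.2))) :
    ((G.prependEdges P U).val.map List.head?).Perm (U.map some) ∧
      (∀ p' ∈ (G.prependEdges P U).val, ∃ e ∈ U, ∃ p ∈ P, p' = e :: p ∧
        (p.head?.map fun e => G.nodeX e.1) = some (G.nodeY e.2)) ∧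
      ∀ p ∈ P, ∃ p' ∈ (G.prependEdges P U).val, p ⊆ p' := by
  induction P generalizing U with
  | nil =>
    have : U = [] := by simpa using h.length_eq.symm
    subst this
    simp [prependEdges]
  | cons p P ih =>
    have hmem := h.subset (List.mem_cons_self (a := p.head?.map fun e => G.nodeX e.1))
    obtain ⟨e₀, he₀, hpe₀⟩ := List.mem_map.1 hmem
    rw [prependEdges.eq_def]
    cases p with
    | nil => simp at hpe₀
    | cons e p =>
      simp only [List.head?_cons, Option.map_some, Option.some.injEq] at hpe₀
      simp only [Timed.val_bind]
      cases hv : (Timed.extract (fun e' : X × Y => decide (G.nodeY e'.2 = G.nodeX e.1)) U).val with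
      | none =>
        have := Timed.extract_eq_none hv e₀ he₀
        simp [hpe₀] at this
      | some r =>
        obtain ⟨e', U'⟩ := r
        obtain ⟨h1, h2⟩ := Timed.extract_eq_some hv
        have h1 : G.nodeY e'.2 = G.nodeX e.1 := by simpa using h1
        have h3 := h.trans (h2.map fun e => some (G.nodeY e.2))
        simp only [List.map_cons, List.head?_cons, Option.map_some, h1, List.perm_cons] at h3
        obtain ⟨h4, h5, h6⟩ := ih U' h3
        simp only [Timed.val_bind, Timed.val_pure]
        refine ⟨?_, ?_, ?_⟩
        · rw [List.map_cons, List.head?_cons]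
          exact (h4.cons _).trans (h2.symm.map some)
        · intro p' hp'
          rcases List.mem_cons.1 hp' with rfl | hp'
          · exact ⟨e', h2.symm.subset (by simp), e :: p, by simp, rfl, by simp [h1]⟩
          · obtain ⟨a, ha, q, hq, h7⟩ := h5 p' hp'
            exact ⟨a, h2.symm.subset (List.mem_cons_of_mem _ ha), q, List.mem_cons_of_mem _ hq, h7⟩
        · intro q hq
          rcases List.mem_cons.1 hq with rfl | hq
          · exact ⟨_, List.mem_cons_self, List.subset_cons_self _ _⟩
          · obtain ⟨q', hq', h7⟩ := h6 q hq
            exact ⟨q', List.mem_cons_of_mem _ hq', h7⟩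

variable [Fintype X] {k : ℕ} {used : ℕ → List (X × Y)} {P : List (List (X × Y))}

theorem PartialPaths.prepend (hE : G.Excess k G.S used) {l : ℕ} (hl : 1 ≤ l) (hL : l + 1 < G.L)
    (h : G.PartialPaths used (l + 1) P) :
    G.PartialPaths used l (G.prependEdges P (used l)).val := by
  have hheads : (P.map fun p => p.head?.map fun e => G.nodeX e.1).Perm
      ((used l).map fun e => some (G.nodeY e.2)) := by
    have h1 := h.heads.map (Option.map fun e : X × Y => G.nodeX e.1)
    rw [List.map_map, List.map_map] at h1
    refine (show (P.map fun p => p.head?.map fun e => G.nodeX e.1).Perm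
      ((used (l + 1)).map fun e => some (G.nodeX e.1)) from h1).trans ?_
    have h2 : (((used (l + 1)).map Prod.fst).map G.nodeX).Perm
        (((used l).map Prod.snd).map G.nodeY) := by
      refine List.perm_iff_count.2 fun B => ?_
      by_cases hB : G.layer B = l + 1
      · have hS : B ≠ G.S := by
          rintro rfl
          rw [(G.layer_eq_one _).2 rfl] at hB
          omega
        have hD : B ≠ G.D := by
          rintro rfl
          rw [(G.layer_eq_L _).2 rfl] at hB
          omega
        have := hE.conserve B hS hD
        rw [hB, Nat.add_sub_cancel, if_neg hS] at this
        exact this.symm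
      · rw [List.count_eq_zero_of_not_mem, List.count_eq_zero_of_not_mem]
        · intro hmem
          obtain ⟨y, hy, rfl⟩ := List.mem_map.1 hmem
          exact hB ((hE.cut l).layerY hy)
        · intro hmem
          obtain ⟨x, hx, rfl⟩ := List.mem_map.1 hmem
          exact hB ((hE.cut (l + 1)).layerX hx)
    have h3 := h2.map some
    rw [List.map_map, List.map_map, List.map_map, List.map_map] at h3
    exact h3
  obtain ⟨h1, h2, h3⟩ := prependEdges_spec P (used l) hheads
  refine ⟨fun p' hp' => ?_, h1, fun e => ?_⟩
  · obtain ⟨e, he, p, hp, rfl, hpe⟩ := h2 p' hp'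
    obtain ⟨A, hA⟩ := h.path p hp
    have hA' : A = G.nodeY e.2 := by
      have := hA.head
      rw [hpe] at this
      simpa using this.symm
    subst hA'
    refine ⟨_, (isPathFrom_cons ?_).2 ⟨(hE.cut l).edge e he, hA⟩⟩
    rintro rfl
    simp at hpe
  · constructor
    · intro he
      obtain ⟨p', hp', hep⟩ := List.mem_flatten.1 he
      obtain ⟨a, ha, p, hp, rfl, -⟩ := h2 p' hp'
      rcases List.mem_cons.1 hep with rfl | hep
      · exact ⟨l, le_rfl, ha⟩
      · obtain ⟨l', h4, h5⟩ := (h.edges e).1 (List.mem_flatten.2 ⟨p, hp, hep⟩)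
        exact ⟨l', by omega, h5⟩
    · rintro ⟨l', h4, h5⟩
      rcases Nat.eq_or_lt_of_le h4 with rfl | h4
      · have := h1.symm.subset (List.mem_map.2 ⟨e, h5, rfl⟩)
        obtain ⟨p', hp', hpe⟩ := List.mem_map.1 this
        exact List.mem_flatten.2 ⟨p', hp', List.mem_of_mem_head? hpe⟩
      · obtain ⟨p, hp, hep⟩ := List.mem_flatten.1 ((h.edges e).2 ⟨l', h4, h5⟩)
        obtain ⟨p', hp', hpp'⟩ := h3 p hp
        exact List.mem_flatten.2 ⟨p', hp', hpp' hep⟩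

theorem assemble_spec (hE : G.Excess k G.S used) {l : ℕ} (hL : l + 1 < G.L)
    (h : G.PartialPaths used (l + 1) P) :
    G.PartialPaths used 1 (G.assemble used l P).val ∧
      (G.assemble used l P).time ≤ l * (k * (k + 2) + 2) + 1 := by
  induction l generalizing P with
  | zero => exact ⟨by simpa [assemble] using h, by simp [assemble]⟩
  | succ l ih =>
    have h1 := h.prepend hE (by omega) hL
    have hlen : ∀ l, 1 ≤ l → l < G.L → (used l).length = k := by
      intro l h1 h2
      rw [hE.length l h1 h2, (G.layer_eq_one _).2 rfl, if_neg (by omega)]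
    obtain ⟨h2, h3⟩ := ih (by omega) h1
    have h4 := G.prependEdges_time P (used (l + 1)) (hlen (l + 1) (by omega) (by omega)).le
    rw [h.length, hlen (l + 1 + 1) (by omega) hL] at h4
    rw [assemble]
    refine ⟨by simpa using h2, ?_⟩
    simp only [Timed.time_bind, Timed.time_step]
    rw [Nat.add_mul]
    omega

/-- The used edges in the last layer cut, as partial paths of length one. -/
theorem partialPaths_last (hE : G.Excess k G.S used) :
    G.PartialPaths used (G.L - 1) ((used (G.L - 1)).map fun e => [e]) := by
  have hL := G.two_le_L
  refine ⟨fun p hp => ?_, ?_, fun e => ?_⟩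
  · obtain ⟨e, he, rfl⟩ := List.mem_map.1 hp
    refine ⟨_, isPathFrom_singleton.2 ⟨(hE.cut _).edge e he, ?_⟩⟩
    have := (hE.cut (G.L - 1)).layerY (List.mem_map.2 ⟨e, he, rfl⟩)
    exact (G.layer_eq_L _).1 (by omega)
  · rw [List.map_map]
    exact List.Perm.of_eq (List.map_congr_left fun e _ => rfl)
  · simp only [List.mem_flatten, List.mem_map]
    constructor
    · rintro ⟨_, ⟨a, ha, rfl⟩, he⟩
      rw [List.mem_singleton.1 he]
      exact ⟨_, le_rfl, ha⟩
    · rintro ⟨l', h1, h2⟩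
      by_cases hl : G.L ≤ l'
      · rw [(hE.cut l').eq_nil (Or.inr hl)] at h2
        simp at h2
      · obtain rfl : l' = G.L - 1 := by omega
        exact ⟨_, ⟨e, h2, rfl⟩, by simp⟩

/-- Complete paths that consist of the edges of a flow are linearly independent. -/
theorem PartialPaths.complete [DecidableEq X] [DecidableEq Y] (hE : G.Excess k G.S used)
    (h : G.PartialPaths used 1 P) :
    (∀ p ∈ P, G.IsPath p) ∧ G.LinIndepPaths P ∧ P.length = k := by
  have hlen : ∀ l, 1 ≤ l → l < G.L → (used l).length = k := by
    intro l h1 h2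
    rw [hE.length l h1 h2, (G.layer_eq_one _).2 rfl, if_neg (by omega)]
  have hk : P.length = k := by
    rw [h.length, hlen 1 le_rfl (by have := G.two_le_L; omega)]
  refine ⟨fun p hp => ?_, fun l h1 h2 => ?_, hk⟩
  · obtain ⟨A, hA⟩ := h.path p hp
    have h1 := h.heads.subset (List.mem_map_of_mem hp)
    obtain ⟨e, he, hpe⟩ := List.mem_map.1 h1
    have h2 := hA.head
    rw [← hpe] at h2
    have h3 : G.nodeX e.1 = G.S := (G.layer_eq_one _).1 ((hE.cut 1).layer e he)
    rw [isPath_iff]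
    simp only [Option.map_some, Option.some.injEq] at h2
    rwa [← h3, h2]
  · have hset : G.layerEdges P l = (used l).toFinset := by
      ext e
      simp only [layerEdges, Finset.mem_filter, List.mem_toFinset, h.edges]
      constructor
      · rintro ⟨⟨l', _, h4⟩, rfl⟩
        rwa [(hE.cut l').layer e h4]
      · exact fun he => ⟨⟨l, h1, he⟩, (hE.cut l).layer e he⟩
    obtain ⟨h3, h4⟩ := (hE.cut l).card
    rw [hset, h3, h4, hlen l h1 h2, hk]
    exact ⟨rfl, rfl⟩

end Assemble

end ADTNetwork

/-! ### The result and the running time of the algorithm -/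

namespace ADTNetwork

open UnicastProg

section Time

/-- The constants are the sums of the coefficients of the terms without and with the factor `d`. -/
theorem iterationTime_le {nX N d : ℕ} (hX : 1 ≤ nX) (hN : 1 ≤ N) :
    iterationTime nX N d ≤ nX * (252 * N ^ 3 + 55 * d * N ^ 2) := by
  have h1 : N ≤ N ^ 2 := Nat.le_self_pow two_ne_zero N
  have h2 : N ^ 2 ≤ N ^ 3 := Nat.pow_le_pow_right hN (by norm_num)
  have m0 := Nat.mul_le_mul_left nX (hN.trans (h1.trans h2))
  have m1 := Nat.mul_le_mul_left nX (h1.trans h2)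
  have m2 := Nat.mul_le_mul_left nX h2
  have d0 := Nat.mul_le_mul_left (nX * d) (hN.trans h1)
  have d1 := Nat.mul_le_mul_left (nX * d) h1
  have e := Nat.mul_le_mul_right (enterCost N) hX
  unfold iterationTime resetTime backwardCost typeOneCost sameLayerCost
    releaseTime combineTime alternatingTime rematchTime typeTwoCost forwardCost
  unfold enterCost at e ⊢
  nlinarith

/-- The running time of all iterations and of the assembly of the paths, where `n` is the number of
the layer cuts but the last. The bound uses `C + 1 ≤ 2 C`. -/
theorem unicastTime_le {nX C d n : ℕ} (hX : 1 ≤ nX) (hC : 1 ≤ C) (hn : n ≤ nX) :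
    (C + 1) * iterationTime nX (C + 1) d + 1 + (C * (0 + 1) + 1) + (n * (C * (C + 2) + 2) + 1) ≤
      5000 * (nX * C ^ 4 + d * nX * C ^ 3) := by
  have h0 := iterationTime_le (d := d) hX (show 1 ≤ C + 1 by omega)
  have h1 : (C + 1) ^ 3 ≤ (2 * C) ^ 3 := Nat.pow_le_pow_left (by omega) 3
  have h2 : (C + 1) ^ 2 ≤ (2 * C) ^ 2 := Nat.pow_le_pow_left (by omega) 2
  have h3 : (C + 1) * iterationTime nX (C + 1) d ≤
      2 * C * (nX * (252 * (2 * C) ^ 3 + 55 * d * (2 * C) ^ 2)) :=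
    Nat.mul_le_mul (by omega) (h0.trans (Nat.mul_le_mul_left _
      (Nat.add_le_add (Nat.mul_le_mul_left _ h1) (Nat.mul_le_mul_left _ h2))))
  have h4 : n * (C * (C + 2) + 2) ≤ nX * (C * (C + 2) + 2) := Nat.mul_le_mul_right _ hn
  have c1 : C ≤ C ^ 4 := Nat.le_self_pow (by norm_num) C
  have c2 : C ^ 2 ≤ C ^ 4 := Nat.pow_le_pow_right hC (by norm_num)
  have m0 := Nat.mul_le_mul_left nX (hC.trans c1)
  have m1 := Nat.mul_le_mul_left nX c1
  have m2 := Nat.mul_le_mul_left nX c2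
  have e1 := Nat.mul_le_mul_right C hX
  nlinarith

end Time

section Unicast

variable {F V X Y : Type} [Field F] [Fintype X] {G : ADTNetwork F V X Y}

theorem Listing.length_succ_le [DecidableEq F] [Fintype Y] [DecidableEq Y] (I : G.Listing) (x : X) :
    (I.succ x).length ≤ G.maxOutDegree := by
  rw [← List.toFinset_card_of_nodup (I.nodup_succ x)]
  refine le_trans (Finset.card_le_card fun y hy => ?_)
    (Finset.le_sup (f := fun x => (Finset.univ.filter fun y => G.T x y ≠ 0).card)
      (Finset.mem_univ x))
  simpa [I.mem_succ] using hy

variable [DecidableEq V]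

theorem excess_zero : G.Excess 0 G.S fun _ => [] := by
  refine ⟨fun l => ⟨by simp, by simp, by simp, by simp,
    fun c hc _ => funext fun x => by_contra fun hx => by simpa using hc x hx⟩, fun l h1 _ => ?_,
    fun B hS _ => by simp [hS]⟩
  rw [if_neg (by rw [(G.layer_eq_one _).2 rfl]; omega)]
  rfl

/-- A flow of positive value uses an input in every layer but the last. -/
theorem Excess.pred_L_le {k : ℕ} {used : ℕ → List (X × Y)} (h : G.Excess k G.S used) (hk : 1 ≤ k) :
    G.L - 1 ≤ Fintype.card X := by
  rw [← Nat.card_Ico 1 G.L]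
  refine le_trans (Finset.card_le_card (t := Finset.univ.image fun x => G.layer (G.nodeX x))
    fun l hl => ?_) Finset.card_image_le
  obtain ⟨h1, h2⟩ := Finset.mem_Ico.1 hl
  have hlen := h.length l h1 h2
  rw [if_neg (by rw [(G.layer_eq_one _).2 rfl]; omega)] at hlen
  obtain ⟨e, he⟩ := List.exists_mem_of_length_pos (by omega : 0 < (used l).length)
  exact Finset.mem_image.2 ⟨e.1, Finset.mem_univ _, (h.cut l).layer e he⟩

variable [DecidableEq F] [Fintype V] [DecidableEq X] [Fintype Y] [DecidableEq Y] (I : G.Listing)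

/-- The running time also contains the assembly of the paths, which is linear in the number of
layers; this number is bounded by that of the inputs, since a flow of positive value uses an input
in every layer cut. -/
theorem unicast_spec : ∃ (P : List (List (X × Y))) (t : ℕ), unicast I = some (P, t) ∧
    (∀ p ∈ P, G.IsPath p) ∧ G.LinIndepPaths P ∧ P.length = G.capacity ∧
    (1 ≤ G.capacity → t ≤ 5000 * (Fintype.card X * G.capacity ^ 4 +
      G.maxOutDegree * Fintype.card X * G.capacity ^ 3)) := by
  let m₀ : UnicastMemory F V X Y :=
    { used := fun _ => [], exploredV := fun _ => false, exploredX := fun _ => false,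
      exploredY := fun _ => false, type := fun _ => 1, initial := fun _ => false,
      pending := fun _ _ => [], lam := fun _ => [], clock := 0 }
  have hrun : Runs (unicastProg I) m₀ fun P m => ((∀ p ∈ P, G.IsPath p) ∧ G.LinIndepPaths P ∧
      P.length = G.capacity) ∧ (1 ≤ G.capacity → m.clock ≤ 5000 * (Fintype.card X *
        G.capacity ^ 4 + G.maxOutDegree * Fintype.card X * G.capacity ^ 3)) := by
    rw [unicastProg, runs_bind]
    refine (iterate_spec (k := 0) I.length_succ_le (m := m₀) ⟨by simp [m₀], rfl, fun _ _ => rfl⟩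
      excess_zero).mono fun _ m ⟨hE, hc⟩ => ?_
    simp only [runs_bind, runs_look, runs_call, Timed.map_val]
    have hL := G.two_le_L
    have hlast := partialPaths_last hE
    rw [show G.L - 1 = G.L - 2 + 1 by omega] at hlast
    obtain ⟨h1, h2⟩ := assemble_spec hE (l := G.L - 2) (by omega) hlast
    have hmap := Timed.map_time_le (fun e : X × Y => (pure [e] : Timed (List (X × Y))))
      (m.used (G.L - 1)) 0 (by simp)
    rw [show G.L - 2 + 1 = G.L - 1 by omega] at h1 h2
    refine ⟨h1.complete hE, fun hC => ?_⟩
    rw [hE.length (G.L - 1) (by omega) (by omega), if_neg (by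
      rw [(G.layer_eq_one _).2 rfl]; omega)] at hmap
    have hX := hE.pred_L_le hC
    refine le_trans ?_ (unicastTime_le (n := G.L - 2) (by omega) hC (by omega))
    rw [Nat.sub_zero] at hc
    have hm₀ : m₀.clock = 0 := rfl
    simp only [Timed.val_pure] at h2 ⊢
    omega
  obtain ⟨P, m, hP, ⟨h1, h2, h3⟩, h4⟩ := hrun
  refine ⟨P, m.clock, ?_, h1, h2, h3, h4⟩
  rw [unicast, show StateT.run (unicastProg I) _ = some (P, m) from hP]
  rfl

end Unicast

end ADTNetwork

theorem mainTheorem1 :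
    ∃ K : ℕ, ∀ (F V X Y : Type) [Field F] [Fintype F] [DecidableEq F] [Fintype V] [DecidableEq V]
      [Fintype X] [DecidableEq X] [Fintype Y] [DecidableEq Y]
      (G : ADTNetwork F V X Y) (I : G.Listing),
      ∃ (P : List (List (X × Y))) (t : ℕ),
        ADTNetwork.unicast I = some (P, t) ∧
        (∀ p ∈ P, G.IsPath p) ∧
        G.LinIndepPaths P ∧
        P.length = G.capacity ∧
        IsGreatest {k | ∃ Q : List (List (X × Y)), (∀ q ∈ Q, G.IsPath q) ∧ G.LinIndepPaths Q ∧
          Q.length = k} G.capacity ∧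
        (1 ≤ G.capacity →
          t ≤ K * (Fintype.card X * G.capacity ^ 4 +
            G.maxOutDegree * Fintype.card X * G.capacity ^ 3)) := by
  refine ⟨5000, ?_⟩
  intro F V X Y _ _ _ _ _ _ _ _ _ G I
  obtain ⟨P, t, h1, h2, h3, h4, h5⟩ := ADTNetwork.unicast_spec I
  refine ⟨P, t, h1, h2, h3, h4, ⟨⟨P, h2, h3, h4⟩, ?_⟩, h5⟩
  rintro _ ⟨Q, hQ, hQ', rfl⟩
  exact (ADTNetwork.excess_of_paths hQ hQ').le_capacity
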